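/- **Setting.** Let $m,N\in\mathbb N_0$, $T>0$, and let $\Lambda$ be either $\mathbb R$ or $[0,1]_{per}$ (functions on the latter are identified with $1$-periodic functions on $\mathbb R$). Let $\xi=(\xi_1,\dots,\xi_N):\Omega\to\Xi\subset\mathbb R^N$ be a random vector on a probability space with independent components having densities $w_i$; put $w(y)=\prod_i w_i(y_i)$ and let $\tilde{\mathbb P}$ be the law of $\xi$. Write $\|f\|^2_{L^2_w(A;L^2(\Lambda))}=\int_A\|f(\cdot,y)\|^2_{L^2(\Lambda)}\,w(y)\,dy$. Let $\mathcal U\subset\mathbb R^m$ be open and $\mathcal C\subset\mathcal U$ compact and convex. For $\tilde{\mathbb P}$-a.e. $y$ let $F(\cdot,y)\in C^2(\mathcal U;\mathbb R^m)$, and let $\eta(\cdot,y),q(\cdot,y)\in C^2(\mathcal U;\mathbb R)$ be an entropy/entropy-flux pair: $\eta(\cdot,y)$ is strictly convex and $D\eta\,DF=Dq$. Let $C_F,\underline C_\eta,\overline C_\eta$ be functions of $y$ such that for $\tilde{\mathbb P}$-a.e. $y$: $0\le C_F(y)$, $0<\underline C_\eta(y)\le\overline C_\eta(y)$, and for all $z\in\mathcal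 C$, $v\in\mathbb R^m$, $$|v^\top H_uF(z,y)v|\le C_F(y)|v|^2,\qquad \underline C_\eta(y)|v|^2\le v^\top H_u\eta(z,y)v\le\overline C_\eta(y)|v|^2 .$$ Let $u^0\in L^1_w(\Xi;L^1(\Lambda;\mathbb R^m))$ take values in $\mathcal C$ a.e., and let $u\in L^1_w(\Xi;L^1((0,T)\times\Lambda;\mathcal U))$ be a random entropy admissible solution of $\partial_tu+\partial_xF(u,y)=0$, $u(0,\cdot,y)=u^0(\cdot,y)$; that is, for $\tilde{\mathbb P}$-a.e. $y$ it satisfies $$\int_0^T\!\!\int_\Lambda u\cdot\partial_t\phi+F(u,y)\cdot\partial_x\phi\,dx\,dt=-\int_\Lambda u^0\cdot\phi(0,x)\,dx$$ for all $\phi\in C_c^\infty([0,T)\times\Lambda;\mathbb R^m)$ and $$\int_0^T\!\!\int_\Lambda \eta(u,y)\,\partial_t\Phi+q(u,y)\,\partial_x\Phi\,dx\,dt\ge-\int_\Lambda\eta(u^0,y)\,\Phi(0,x)\,dx$$ for all $\Phi\in C_c^\infty([0,T)\times\Lambda;[0,\infty))$. Assume that $u$ takes values in $\mathcal C$ almost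 everywhere, and let $u(t,\cdot,y)$, $t\in[0,T]$, be understood through the representative of $u(\cdot,\cdot,y)$ that is continuous in time on $[0,T]$ in the sense of distributions in $x$. Let $0=t_0<t_1<\dots<t_{N_t}=T$. For a degree $r\in\mathbb N_0$ and, for each $i$, distinct points $y_{i,0},\dots,y_{i,r}\in\mathbb R$, let $y_\kappa=(y_{1,k_1},\dots,y_{N,k_N})$ and let $l_\kappa$, $\kappa\in\mathcal K=\{0,\dots,r\}^N$, be the tensor product Lagrange polynomials for these collocation points. For $n=0,\dots,N_t$ and $\kappa\in\mathcal K$ let $u_h^n(\cdot,y_\kappa):\Lambda\to\mathbb R^m$ be measurable (for instance the Runge--Kutta discontinuous Galerkin approximation at time $t_n$ of the problem with parameter $y_\kappa$), and let $\hat u^{st}(\cdot,\cdot,y_\kappa):[0,T]\times\Lambda\to\mathbb R^m$ be Lipschitz continuous in space and time (its space-time reconstruction). Put $$u_h^n(x,y)=\sum_{\kappa\in\mathcal K}u_h^n(x,y_\kappa)\,l_\kappa(y),\qquad \hat u^{sts}(t,x,y)=\sum_{\kappa\in\mathcal K}\hat u^{st}(t,x,y_\kappa)\,l_\kappa(y),$$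 $$\mathcal R^{sts}=\partial_t\hat u^{sts}+\partial_xF(\hat u^{sts},y),$$ and assume that, for $\tilde{\mathbb P}$-a.e. $y$, $\hat u^{sts}(\cdot,\cdot,y)$ takes only values in $\mathcal C$. **Claim.** For every $n=0,\dots,N_t$ and every $\tilde{\mathbb P}$-measurable $\tilde\Xi\subseteq\Xi$, $$\begin{aligned}\|u(t_n,\cdot,\cdot)-u_h^n\|^2_{L^2_w(\tilde\Xi;L^2(\Lambda))}\le{}&2\,\|\hat u^{sts}(t_n,\cdot,\cdot)-u_h^n\|^2_{L^2_w(\tilde\Xi;L^2(\Lambda))}\\&+2\int_{\tilde\Xi}\underline C_\eta(y)^{-1}\Big(\mathcal E^{sts}(t_n,y)+\overline C_\eta(y)\,\mathcal E^{sts}_0(y)\Big)\\&\qquad\times\exp\Big(\int_0^{t_n}\frac{\overline C_\eta(y)\,C_F(y)\,\|\partial_x\hat u^{sts}(t,\cdot,y)\|_{L^\infty(\Lambda)}+\overline C_\eta(y)^2}{\underline C_\eta(y)}\,dt\Big)\,w(y)\,dy,\end{aligned}$$ where $\mathcal E^{sts}(t_n,y)=\|\mathcal R^{sts}(\cdot,\cdot,y)\|^2_{L^2((0,t_n)\times\Lambda)}$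 and $\mathcal E^{sts}_0(y)=\|u^0(\cdot,y)-\hat u^{sts}(0,\cdot,y)\|^2_{L^2(\Lambda)}$; norms and integrals of nonnegative functions may be $+\infty$. -/

import Mathlib

open MeasureTheory ProbabilityTheory Set
open scoped ContDiff ENNReal

noncomputable section

namespace RandomCL

/-- State vectors: `ℝ^m` with the Euclidean norm. -/
abbrev State (m : ℕ) := EuclideanSpace ℝ (Fin m)

/-! ### The spatial domain -/

/-- The spatial domain `Λ`: the real line, or the unit interval with periodic boundary.
A function on the periodic interval is identified with a `1`-periodic function on `ℝ`. -/
inductive Domain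
  | line
  | periodic

namespace Domain

/-- The set over which integrals and norms on `Λ` are taken. -/
def cell : Domain → Set ℝ
  | line => univ
  | periodic => Ico 0 1

/-- `f : ℝ → V` represents a function on `Λ`. -/
def IsFunctionOn {V : Type*} : Domain → (ℝ → V) → Prop
  | line, _ => True
  | periodic, f => Function.Periodic f 1

/-- `f` vanishes outside a bounded subset of `Λ`. -/
def HasBoundedSupport {V : Type*} [Zero V] : Domain → (ℝ → ℝ → V) → Prop
  | line, f => ∃ R : ℝ, ∀ t x : ℝ, R ≤ |x| → f t x = 0
  | periodic, _ => True

/-- `‖f‖²` in `L²(Λ)`, as an extended nonnegative number. -/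
def sqNorm {V : Type*} [NormedAddCommGroup V] (Λ : Domain) (f : ℝ → V) : ℝ≥0∞ :=
  ∫⁻ x in Λ.cell, ‖f x‖ₑ ^ 2

/-- `‖f‖` in `L^∞(Λ)` (essential supremum). -/
def supNorm {V : Type*} [NormedAddCommGroup V] (Λ : Domain) (f : ℝ → V) : ℝ :=
  (eLpNorm f ⊤ (volume.restrict Λ.cell)).toReal

end Domain

/-! ### Deterministic conservation laws -/

/-- `φ` represents an element of `C_c^∞([0,T) × Λ; V)`: it is (the restriction to `t ≥ 0` of) a
smooth function that vanishes near `t = T` and outside a bounded set of `x`. -/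
structure IsTestFunction {V : Type*} [NormedAddCommGroup V] [NormedSpace ℝ V]
    (Λ : Domain) (T : ℝ) (φ : ℝ → ℝ → V) : Prop where
  smooth : ContDiff ℝ ∞ (fun p : ℝ × ℝ => φ p.1 p.2)
  on_domain : ∀ t, Λ.IsFunctionOn (φ t)
  support_time : ∃ T' < T, ∀ t x : ℝ, T' ≤ t → φ t x = 0
  support_space : Λ.HasBoundedSupport φ

/-- `u` satisfies `∂ₜ u + ∂ₓ F(u) = 0`, `u(0,·) = u₀` in the weak sense on `[0,T) × Λ`. -/
def IsWeakSolution {m : ℕ} (Λ : Domain) (T : ℝ) (F : State m → State m)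
    (u₀ : ℝ → State m) (u : ℝ → ℝ → State m) : Prop :=
  ∀ φ : ℝ → ℝ → State m, IsTestFunction Λ T φ →
    IntegrableOn (fun p : ℝ × ℝ =>
      inner ℝ (u p.1 p.2) (deriv (fun s => φ s p.2) p.1)
        + inner ℝ (F (u p.1 p.2)) (deriv (fun z => φ p.1 z) p.2)) (Ioo 0 T ×ˢ Λ.cell) ∧
    IntegrableOn (fun x => inner ℝ (u₀ x) (φ 0 x)) Λ.cell ∧
    (∫ p in Ioo 0 T ×ˢ Λ.cell,
      (inner ℝ (u p.1 p.2) (deriv (fun s => φ s p.2) p.1)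
        + inner ℝ (F (u p.1 p.2)) (deriv (fun z => φ p.1 z) p.2)))
      = - ∫ x in Λ.cell, inner ℝ (u₀ x) (φ 0 x)

/-- The weak entropy inequality `∂ₜ η(u) + ∂ₓ q(u) ≤ 0` with initial datum `u₀`. -/
def SatisfiesEntropyInequality {m : ℕ} (Λ : Domain) (T : ℝ) (η q : State m → ℝ)
    (u₀ : ℝ → State m) (u : ℝ → ℝ → State m) : Prop :=
  ∀ φ : ℝ → ℝ → ℝ, IsTestFunction Λ T φ → (∀ t ∈ Ico 0 T, ∀ x, 0 ≤ φ t x) →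
    IntegrableOn (fun p : ℝ × ℝ =>
      η (u p.1 p.2) * deriv (fun s => φ s p.2) p.1
        + q (u p.1 p.2) * deriv (fun z => φ p.1 z) p.2) (Ioo 0 T ×ˢ Λ.cell) ∧
    IntegrableOn (fun x => η (u₀ x) * φ 0 x) Λ.cell ∧
    - ∫ x in Λ.cell, η (u₀ x) * φ 0 x ≤
      ∫ p in Ioo 0 T ×ˢ Λ.cell,
        (η (u p.1 p.2) * deriv (fun s => φ s p.2) p.1
          + q (u p.1 p.2) * deriv (fun z => φ p.1 z) p.2)

/-- `(η, q)` is an entropy/entropy-flux pair for the flux `F` on the open state space `U`: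
both are `C²`, `η` is strictly convex (on every convex part of `U`, as `U` need not be convex),
and `Dη DF = Dq`. -/
structure IsEntropyPair {m : ℕ} (U : Set (State m)) (F : State m → State m)
    (η q : State m → ℝ) : Prop where
  contDiffOn_entropy : ContDiffOn ℝ 2 η U
  contDiffOn_flux : ContDiffOn ℝ 2 q U
  strictConvex : ∀ V ⊆ U, Convex ℝ V → StrictConvexOn ℝ V η
  compatible : ∀ v ∈ U, (fderiv ℝ η v).comp (fderiv ℝ F v) = fderiv ℝ q v

/-- The quadratic form `v ↦ vᵀ (H f)(z) v` of the second derivative of `f` at `z`. -/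
def hessianForm {m : ℕ} {V : Type*} [NormedAddCommGroup V] [NormedSpace ℝ V]
    (f : State m → V) (z v : State m) : V :=
  fderiv ℝ (fun z' => fderiv ℝ f z') z v v

/-! ### The random input -/

/-- The random vector `ξ` has independent components, and `w i` is a probability density of the
`i`-th one. -/
structure HasIndependentDensities {Ω : Type*} [MeasurableSpace Ω] (P : Measure Ω) {N : ℕ}
    (ξ : Ω → Fin N → ℝ) (w : Fin N → ℝ → ℝ) : Prop where
  measurable : Measurable ξ
  indep : iIndepFun (fun i a => ξ a i) P
  measurable_density : ∀ i, Measurable (w i)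
  density_nonneg : ∀ i s, 0 ≤ w i s
  map_eq : ∀ i, P.map (fun a => ξ a i) = volume.withDensity (fun s => ENNReal.ofReal (w i s))

/-- The joint density `w(y) = ∏ᵢ wᵢ(yᵢ)`. -/
def jointDensity {N : ℕ} (w : Fin N → ℝ → ℝ) (y : Fin N → ℝ) : ℝ := ∏ i, w i (y i)

/-- The measure `w(y) dy` on `ℝ^N`. -/
def weightedMeasure {N : ℕ} (w : Fin N → ℝ → ℝ) : Measure (Fin N → ℝ) :=
  volume.withDensity (fun y => ENNReal.ofReal (jointDensity w y))

/-- `‖f‖²` in `L²_w(A; L²(Λ))` for `f = f(x,y)`, as an extended nonnegative number. -/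
def weightedSqNorm {N : ℕ} {V : Type*} [NormedAddCommGroup V] (Λ : Domain)
    (w : Fin N → ℝ → ℝ) (A : Set (Fin N → ℝ)) (f : ℝ → (Fin N → ℝ) → V) : ℝ≥0∞ :=
  ∫⁻ y in A, Λ.sqNorm (fun x => f x y) ∂(weightedMeasure w)

/-! ### Random conservation laws -/

/-- `u` is a random entropy admissible solution, for the law `μ` of the random parameter, of
`∂ₜ u + ∂ₓ F(u,y) = 0`, `u(0,·,y) = u₀(·,y)`, with respect to the entropy pair `(η, q)`. -/
structure IsRandomEntropySolution {m N : ℕ} (Λ : Domain) (T : ℝ) (U : Set (State m))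
    (μ : Measure (Fin N → ℝ)) (F : (Fin N → ℝ) → State m → State m)
    (η q : (Fin N → ℝ) → State m → ℝ) (u₀ : ℝ → (Fin N → ℝ) → State m)
    (u : ℝ → ℝ → (Fin N → ℝ) → State m) : Prop where
  integrable : Integrable (fun p : (Fin N → ℝ) × (ℝ × ℝ) => u p.2.1 p.2.2 p.1)
    (μ.prod (volume.restrict (Ioo 0 T ×ˢ Λ.cell)))
  on_domain : ∀ t y, Λ.IsFunctionOn (fun x => u t x y)
  mem_state : ∀ᵐ y ∂μ, ∀ᵐ p : ℝ × ℝ ∂(volume.restrict (Ioo 0 T ×ˢ Λ.cell)), u p.1 p.2 y ∈ U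
  weak : ∀ᵐ y ∂μ, IsWeakSolution Λ T (F y) (fun x => u₀ x y) (fun t x => u t x y)
  entropy : ∀ᵐ y ∂μ,
    SatisfiesEntropyInequality Λ T (η y) (q y) (fun x => u₀ x y) (fun t x => u t x y)

/-- `t ↦ v(t,·)` is continuous on `[0,T]` in the sense of distributions. For a bounded weak
solution this selects the representative whose values `v(t,·)` at individual times are
meaningful. -/
def IsWeaklyContinuousInTime {m : ℕ} (T : ℝ) (v : ℝ → ℝ → State m) : Prop :=
  (∀ t ∈ Icc 0 T, LocallyIntegrable (v t)) ∧
  ∀ ψ : ℝ → ℝ, ContDiff ℝ ∞ ψ → HasCompactSupport ψ →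
    ContinuousOn (fun t => ∫ x, ψ x • v t x) (Icc 0 T)

/-! ### Stochastic collocation -/

/-- The tensor product Lagrange polynomial `l_k(y) = ∏ᵢ l_{i,kᵢ}(yᵢ)` for the one-dimensional
collocation points `z i 0, …, z i r`. -/
def lagrangeTensor {N r : ℕ} (z : Fin N → Fin (r + 1) → ℝ) (k : Fin N → Fin (r + 1))
    (y : Fin N → ℝ) : ℝ :=
  ∏ i, (Lagrange.basis Finset.univ (z i) (k i)).eval (y i)

/-- The interpolant `∑_k v_k l_k(y)` of values `v_k` prescribed at the collocation points
`y_k = (z 1 k₁, …, z N k_N)`. -/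
def collocationInterpolant {N r : ℕ} {V : Type*} [AddCommGroup V] [Module ℝ V]
    (z : Fin N → Fin (r + 1) → ℝ) (v : (Fin N → Fin (r + 1)) → V) (y : Fin N → ℝ) : V :=
  ∑ k, lagrangeTensor z k y • v k

/-- A space-time reconstruction: a function on `[0,T] × Λ`, Lipschitz in space and time. -/
structure IsSpaceTimeReconstruction {m : ℕ} (Λ : Domain) (T : ℝ) (v : ℝ → ℝ → State m) :
    Prop where
  on_domain : ∀ t, Λ.IsFunctionOn (v t)
  lipschitz : ∃ K, LipschitzOnWith K (fun p : ℝ × ℝ => v p.1 p.2) (Icc 0 T ×ˢ univ)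

/-- The stochastic collocation approximation `u_h^n(x,y) = ∑_k u_h^n(x,y_k) l_k(y)`. -/
def collocationSolution {m N r : ℕ} (z : Fin N → Fin (r + 1) → ℝ)
    (uh : (Fin N → Fin (r + 1)) → ℝ → State m) (x : ℝ) (y : Fin N → ℝ) : State m :=
  collocationInterpolant z (fun k => uh k x) y

/-- The space-time-stochastic reconstruction `∑_k û^st(t,x,y_k) l_k(y)`. -/
def stsReconstruction {m N r : ℕ} (z : Fin N → Fin (r + 1) → ℝ)
    (ust : (Fin N → Fin (r + 1)) → ℝ → ℝ → State m) (t x : ℝ) (y : Fin N → ℝ) : State m :=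
  collocationInterpolant z (fun k => ust k t x) y

/-- The space-time-stochastic residual `∂ₜ v + ∂ₓ F(v, y)`; for a Lipschitz `v` with values in a
compact convex set on which the flux is `C²`, the derivatives exist almost everywhere. -/
def stsResidual {m N : ℕ} (F : (Fin N → ℝ) → State m → State m)
    (v : ℝ → ℝ → (Fin N → ℝ) → State m) (t x : ℝ) (y : Fin N → ℝ) : State m :=
  deriv (fun s => v s x y) t + deriv (fun x' => F y (v t x' y)) x

/-- `‖R(·,·,y)‖²` in `L²((0,t) × Λ)` for the space-time-stochastic residual `R`. -/
def residualIndicator {m N : ℕ} (Λ : Domain) (F : (Fin N → ℝ) → State m → State m)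
    (v : ℝ → ℝ → (Fin N → ℝ) → State m) (t : ℝ) (y : Fin N → ℝ) : ℝ≥0∞ :=
  ∫⁻ p in Ioo 0 t ×ˢ Λ.cell, ‖stsResidual F v p.1 p.2 y‖ₑ ^ 2

/-- `‖u₀(·,y) - v(0,·,y)‖²` in `L²(Λ)`. -/
def initialIndicator {m N : ℕ} (Λ : Domain) (u₀ : ℝ → (Fin N → ℝ) → State m)
    (v : ℝ → ℝ → (Fin N → ℝ) → State m) (y : Fin N → ℝ) : ℝ≥0∞ :=
  Λ.sqNorm (fun x => u₀ x y - v 0 x y)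

end RandomCL

end

/-!
The estimate holds for almost every parameter value `y` separately, and is then integrated. For
fixed `y` it compares an entropy solution `u` with a Lipschitz function `v` (the reconstruction),
both with values in the compact convex set `C`, by the relative entropy method of Dafermos and
DiPerna. The relative entropy `η(u|v) = η(u) - η(v) - Dη(v)(u - v)` (`bregman`) lies between
`lo/2 |u - v|²` and `up/2 |u - v|²`.

* Mollification extends the weak formulation and the entropy inequality from smooth to Lipschitz
  test functions. Then `Φ ∇η(v)` is an admissible test function in the weak formulation, and
  subtracting it from the entropy inequality tested with `Φ` gives the relative entropy inequality
  (`EntropyComparison.balance`), whose source is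
  `-D²η(v)(∂ₜv, u - v) - D²η(v)(∂ₓv, F(u) - F(v))`.
* Differentiating `Dη DF = Dq` shows that `D²η(v)` symmetrizes `DF(v)`
  (`EntropySetting.hessian_symmetrizes`). So the source equals
  `-D²η(v)(R, u - v) - D²η(v)(∂ₓv, F(u|v))`, where `R` is the residual of `v` and `F(u|v)` the
  quadratic Taylor remainder of `F`; it is at most `|R|²/2 + k η(u|v)` with
  `k = (up CF ‖∂ₓv‖ + up²)/lo` (`EntropySetting.source_le`).
* The test function is a product of a cutoff in time, the Gronwall factor `exp (-∫₀ᵗ k)`, and, on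
  the line, a cutoff to a backward cone. The relative entropy flux is at most a constant times
  `η(u|v)` (`EntropySetting.exists_speed`), so a cone of that speed absorbs it. The result bounds
  the mean of the localized relative entropy over any time interval
  (`EntropyComparison.local_estimate`), hence its value at some time in that interval.
* Choosing such times close to a given time `t`, the estimate passes to `t` because `u` is
  continuous in time in the sense of distributions and local `L²` bounds survive such limits
  (`lintegral_sq_le_of_weak_limit`). Exhausting the line gives `EntropyComparison.stability`.

Finally, independence identifies the law of `ξ` with the measure `w(y) dy`
(`HasIndependentDensities.map_eq_weightedMeasure`), and `|a - c|² ≤ 2|b - c|² + 2|a - b|²` splits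
the error at the reconstruction.
-/

namespace RandomCL

open Filter Topology

/-! ### Mollification of Lipschitz functions on the plane -/

section Mollify

variable {V : Type*} [NormedAddCommGroup V] [NormedSpace ℝ V]

open scoped Convolution in
/-- The mollification `ρ ⋆ φ` of a function on the plane by the normalized bump function `ρ`. -/
noncomputable def mollify (b : ContDiffBump (0 : ℝ × ℝ)) (φ : ℝ × ℝ → V) : ℝ × ℝ → V :=
  b.normed volume ⋆[ContinuousLinearMap.lsmul ℝ ℝ, volume] φ

lemma mollify_apply (b : ContDiffBump (0 : ℝ × ℝ)) (φ : ℝ × ℝ → V) (p : ℝ × ℝ) :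
    mollify b φ p = ∫ z, b.normed volume z • φ (p - z) := rfl

lemma contDiff_mollify [CompleteSpace V] (b : ContDiffBump (0 : ℝ × ℝ)) {φ : ℝ × ℝ → V}
    (hφ : Continuous φ) : ContDiff ℝ ∞ (mollify b φ) :=
  b.hasCompactSupport_normed.contDiff_convolution_left _ b.contDiff_normed hφ.locallyIntegrable

lemma norm_mollify_le (b : ContDiffBump (0 : ℝ × ℝ)) {φ : ℝ × ℝ → V} {B : ℝ}
    (hB : ∀ p, ‖φ p‖ ≤ B) (p : ℝ × ℝ) : ‖mollify b φ p‖ ≤ B := by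
  have hi : Integrable (fun z => b.normed volume z * B) :=
    (b.integrable_normed (μ := volume)).mul_const B
  refine (norm_integral_le_of_norm_le hi (Eventually.of_forall fun z => ?_)).trans ?_
  · rw [ContinuousLinearMap.lsmul_apply, norm_smul, Real.norm_of_nonneg (b.nonneg_normed z)]
    exact mul_le_mul_of_nonneg_left (hB _) (b.nonneg_normed z)
  · rw [integral_mul_const, b.integral_normed, one_mul]

lemma mollify_nonneg (b : ContDiffBump (0 : ℝ × ℝ)) {φ : ℝ × ℝ → ℝ} (h : ∀ p, 0 ≤ φ p)
    (p : ℝ × ℝ) : 0 ≤ mollify b φ p :=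
  integral_nonneg fun z => mul_nonneg (b.nonneg_normed z) (h _)

lemma mollify_eq_zero (b : ContDiffBump (0 : ℝ × ℝ)) {φ : ℝ × ℝ → V} {p : ℝ × ℝ}
    (h : ∀ z, ‖z‖ < b.rOut → φ (p - z) = 0) : mollify b φ p = 0 := by
  rw [mollify_apply]
  refine integral_eq_zero_of_ae (Eventually.of_forall fun z => ?_)
  by_cases hz : ‖z‖ < b.rOut
  · simp [h z hz]
  · have : z ∉ Function.support (b.normed volume) := by
      rw [b.support_normed_eq]; simpa using hz
    simp [Function.notMem_support.1 this]

/-- Derivatives pass onto a Lipschitz function almost everywhere, by Rademacher's theorem and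
dominated convergence. -/
lemma fderiv_mollify [FiniteDimensional ℝ V] (b : ContDiffBump (0 : ℝ × ℝ)) {φ : ℝ × ℝ → V}
    {K : NNReal} (hφ : LipschitzWith K φ) (p : ℝ × ℝ) :
    fderiv ℝ (mollify b φ) p = mollify b (fderiv ℝ φ) p := by
  have hcb : Continuous (b.normed (volume : Measure (ℝ × ℝ))) := b.continuous_normed
  have hm : ∀ x : ℝ × ℝ, Continuous fun z => b.normed volume z • φ (x - z) := fun x =>
    hcb.smul (hφ.continuous.comp (continuous_const.sub continuous_id))
  borelize V
  have hd : ∀ᵐ z : ℝ × ℝ, DifferentiableAt ℝ φ (p - z) :=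
    (volume.measurePreserving_sub_left p).quasiMeasurePreserving.ae hφ.ae_differentiableAt
  refine (hasFDerivAt_integral_of_dominated_loc_of_lip' (bound := fun z => b.normed volume z * K)
    (F' := fun z => b.normed volume z • fderiv ℝ φ (p - z)) univ_mem
    (fun x _ => (hm x).aestronglyMeasurable) ?_ ?_ ?_ ?_ ?_).2.fderiv
  · refine (hm p).integrable_of_hasCompactSupport ?_
    exact (b.hasCompactSupport_normed (μ := volume)).smul_right
  · refine hcb.aestronglyMeasurable.smul ?_
    exact ((measurable_fderiv ℝ φ).comp (measurable_const.sub measurable_id)).aestronglyMeasurable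
  · refine Eventually.of_forall fun z x _ => ?_
    rw [← smul_sub, norm_smul, Real.norm_of_nonneg (b.nonneg_normed z), mul_assoc]
    refine mul_le_mul_of_nonneg_left ?_ (b.nonneg_normed z)
    simpa using hφ.norm_sub_le (x - z) (p - z)
  · exact (b.integrable_normed (μ := volume)).mul_const _
  · filter_upwards [hd] with z hz
    have h1 : HasFDerivAt (fun x : ℝ × ℝ => φ (x - z)) (fderiv ℝ φ (p - z)) p := by
      exact (hasFDerivAt_comp_sub z).2 hz.hasFDerivAt
    exact h1.const_smul _

lemma norm_fderiv_mollify_le [FiniteDimensional ℝ V] (b : ContDiffBump (0 : ℝ × ℝ))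
    {φ : ℝ × ℝ → V} {K : NNReal} (hφ : LipschitzWith K φ) (p : ℝ × ℝ) :
    ‖fderiv ℝ (mollify b φ) p‖ ≤ K := by
  rw [fderiv_mollify b hφ]
  exact norm_mollify_le b (fun q => norm_fderiv_le_of_lipschitz ℝ hφ) p

lemma locallyIntegrable_fderiv [FiniteDimensional ℝ V] {φ : ℝ × ℝ → V}
    {K : NNReal} (hφ : LipschitzWith K φ) : LocallyIntegrable (fderiv ℝ φ) := by
  borelize V
  refine (locallyIntegrable_const (K : ℝ)).mono (measurable_fderiv ℝ φ).aestronglyMeasurable ?_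
  refine Eventually.of_forall fun p => ?_
  simpa using norm_fderiv_le_of_lipschitz ℝ hφ

end Mollify

/-! ### Lipschitz test functions -/

namespace Domain

lemma measurableSet_cell (Λ : Domain) : MeasurableSet Λ.cell := by
  cases Λ
  · exact MeasurableSet.univ
  · exact measurableSet_Ico

end Domain

/-- Lipschitz analogue of `IsTestFunction`, for functions on the whole plane: since mollification
mixes times, the conditions are imposed for negative times as well. -/
structure IsLipschitzTest {V : Type*} [NormedAddCommGroup V]
    (Λ : Domain) (T : ℝ) (φ : ℝ × ℝ → V) : Prop where
  lipschitz : ∃ K, LipschitzWith K φ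
  bounded : ∃ B : ℝ, ∀ p, ‖φ p‖ ≤ B
  on_domain : ∀ t, Λ.IsFunctionOn (fun x => φ (t, x))
  support_time : ∃ T' < T, ∀ t x : ℝ, T' ≤ t → φ (t, x) = 0
  support_space : Λ.HasBoundedSupport (fun t x => φ (t, x))

/-- The mollifiers at scale `δ / (j + 1)`. The fixed ratio of the radii is what almost everywhere
convergence of the mollified derivatives needs. -/
noncomputable def bump (δ : ℝ) (hδ : 0 < δ) (j : ℕ) : ContDiffBump (0 : ℝ × ℝ) where
  rIn := δ / (j + 1) / 2
  rOut := δ / (j + 1)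
  rIn_pos := by positivity
  rIn_lt_rOut := half_lt_self (by positivity)

lemma tendsto_bump_rOut (δ : ℝ) (hδ : 0 < δ) :
    Tendsto (fun j => (bump δ hδ j).rOut) atTop (𝓝 0) := by
  have := (tendsto_one_div_add_atTop_nhds_zero_nat (𝕜 := ℝ)).const_mul δ
  simpa [bump, div_eq_mul_inv] using this

lemma bump_rOut_le (δ : ℝ) (hδ : 0 < δ) (j : ℕ) : (bump δ hδ j).rOut ≤ δ := by
  have : (0 : ℝ) ≤ j := j.cast_nonneg
  exact div_le_self hδ.le (by linarith)

section LipschitzTest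

variable {V : Type*} [NormedAddCommGroup V]

variable [NormedSpace ℝ V]

lemma IsLipschitzTest.isTestFunction_mollify [CompleteSpace V] {Λ : Domain} {T : ℝ}
    {φ : ℝ × ℝ → V} (h : IsLipschitzTest Λ T φ) {T' : ℝ}
    (hT' : ∀ t x : ℝ, T' ≤ t → φ (t, x) = 0) (b : ContDiffBump (0 : ℝ × ℝ))
    (hb : T' + b.rOut < T) : IsTestFunction Λ T (fun t x => mollify b φ (t, x)) where
  smooth := by
    obtain ⟨K, hK⟩ := h.lipschitz
    exact contDiff_mollify b hK.continuous
  on_domain t := by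
    have h1 := h.on_domain
    cases Λ
    · trivial
    · intro x
      simp only [mollify_apply]
      congr 1
      ext z
      have := h1 (t - z.1) (x - z.2)
      have e : ((t, x + 1) : ℝ × ℝ) - z = (t - z.1, x - z.2 + 1) := by
        ext <;> simp; ring
      rw [e]
      exact congrArg (b.normed volume z • ·) this
  support_time := by
    refine ⟨_, hb, fun t x ht => mollify_eq_zero b fun z hz => hT' _ _ ?_⟩
    have : |z.1| ≤ ‖z‖ := norm_fst_le z
    show T' ≤ t - z.1
    linarith [le_abs_self z.1]
  support_space := by
    have h1 := h.support_space
    cases Λ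
    · obtain ⟨R, hR⟩ := h1
      refine ⟨R + b.rOut, fun t x hx => mollify_eq_zero b fun z hz => hR _ _ ?_⟩
      have : |z.2| ≤ ‖z‖ := norm_snd_le z
      show R ≤ |x - z.2|
      linarith [abs_sub_abs_le_abs_sub x z.2]
    · trivial

lemma fderiv_eq_zero_of_support {φ : ℝ × ℝ → V} {R : ℝ}
    (h : ∀ t x : ℝ, R ≤ |x| → φ (t, x) = 0) {p : ℝ × ℝ} (hp : R < |p.2|) :
    fderiv ℝ φ p = 0 := by
  have : φ =ᶠ[𝓝 p] fun _ => 0 := by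
    have ho : IsOpen {q : ℝ × ℝ | R < |q.2|} := isOpen_lt continuous_const (by fun_prop)
    filter_upwards [ho.mem_nhds hp] with q hq using h q.1 q.2 (le_of_lt hq)
  rw [this.fderiv_eq]; simp

/-- On the cell of the domain, test functions have bounded support in space; on the periodic
interval this holds for all functions. -/
lemma exists_support_radius {Λ : Domain} {φ : ℝ × ℝ → V}
    (h : Λ.HasBoundedSupport (fun t x => φ (t, x))) :
    ∃ R : ℝ, ∀ p : ℝ × ℝ, p.2 ∈ Λ.cell → R < |p.2| → φ p = 0 ∧ fderiv ℝ φ p = 0 := by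
  cases Λ
  · obtain ⟨R, hR⟩ := h
    exact ⟨R, fun p _ hp => ⟨hR p.1 p.2 hp.le, fderiv_eq_zero_of_support hR hp⟩⟩
  · refine ⟨1, fun p hp hp1 => ?_⟩
    have hx' : (0 : ℝ) ≤ p.2 ∧ p.2 < 1 := hp
    rw [abs_of_nonneg hx'.1] at hp1
    linarith [hx'.2]

end LipschitzTest

section Pairing

variable {V : Type*} [NormedAddCommGroup V] [InnerProductSpace ℝ V]

/-- The weak form `∫∫ a · ∂ₜφ + b · ∂ₓφ + ∫ c · φ(0,·)` on `(0,T) × Λ`. -/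
noncomputable def weakPairing (Λ : Domain) (T : ℝ) (a b : ℝ × ℝ → V) (c : ℝ → V)
    (φ : ℝ × ℝ → V) : ℝ :=
  (∫ p in Ioo 0 T ×ˢ Λ.cell,
    (inner ℝ (a p) (fderiv ℝ φ p (1, 0)) + inner ℝ (b p) (fderiv ℝ φ p (0, 1))))
  + ∫ x in Λ.cell, inner ℝ (c x) (φ (0, x))

/-- `a`, `b` and `c` are measurable and essentially bounded on `(0,T) × Λ` and `Λ`. -/
structure BoundedData (Λ : Domain) (T : ℝ) (a b : ℝ × ℝ → V) (c : ℝ → V) (A : ℝ) : Prop where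
  meas_a : AEStronglyMeasurable a (volume.restrict (Ioo 0 T ×ˢ Λ.cell))
  meas_b : AEStronglyMeasurable b (volume.restrict (Ioo 0 T ×ˢ Λ.cell))
  meas_c : AEStronglyMeasurable c (volume.restrict Λ.cell)
  bound_a : ∀ᵐ p ∂(volume.restrict (Ioo 0 T ×ˢ Λ.cell)), ‖a p‖ ≤ A
  bound_b : ∀ᵐ p ∂(volume.restrict (Ioo 0 T ×ˢ Λ.cell)), ‖b p‖ ≤ A
  bound_c : ∀ᵐ x ∂(volume.restrict Λ.cell), ‖c x‖ ≤ A

/-- A dominating function for integrands supported in `|x| ≤ R`. -/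
lemma integrable_boxBound (T R D : ℝ) (Λ : Domain) :
    Integrable (fun p : ℝ × ℝ => (Icc 0 T ×ˢ Icc (-R) R).indicator (fun _ => D) p)
      (volume.restrict (Ioo 0 T ×ˢ Λ.cell)) := by
  refine Integrable.mono_measure ?_ Measure.restrict_le_self
  rw [integrable_indicator_iff (measurableSet_Icc.prod measurableSet_Icc)]
  refine integrableOn_const ?_
  exact (isCompact_Icc.prod isCompact_Icc).measure_ne_top

lemma integrable_segBound (R D : ℝ) (Λ : Domain) :
    Integrable (fun x : ℝ => (Icc (-R) R).indicator (fun _ => D) x)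
      (volume.restrict Λ.cell) := by
  refine Integrable.mono_measure ?_ Measure.restrict_le_self
  rw [integrable_indicator_iff measurableSet_Icc]
  exact integrableOn_const isCompact_Icc.measure_ne_top

lemma norm_fderiv_apply_fst_le {φ : ℝ × ℝ → V} {K : ℝ} {p : ℝ × ℝ} (h : ‖fderiv ℝ φ p‖ ≤ K) :
    ‖fderiv ℝ φ p (1, 0)‖ ≤ K := by
  refine ((fderiv ℝ φ p).le_opNorm _).trans ?_
  simpa using h

lemma norm_fderiv_apply_snd_le {φ : ℝ × ℝ → V} {K : ℝ} {p : ℝ × ℝ} (h : ‖fderiv ℝ φ p‖ ≤ K) :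
    ‖fderiv ℝ φ p (0, 1)‖ ≤ K := by
  refine ((fderiv ℝ φ p).le_opNorm _).trans ?_
  simpa using h

/-- The weak form at a Lipschitz test function is the limit of its values at the mollifications. -/
lemma tendsto_weakPairing_mollify [FiniteDimensional ℝ V] {Λ : Domain} {T : ℝ}
    {a b : ℝ × ℝ → V} {c : ℝ → V} {A : ℝ} (hd : BoundedData Λ T a b c A) {φ : ℝ × ℝ → V}
    (h : IsLipschitzTest Λ T φ) {δ : ℝ} (hδ : 0 < δ) :
    Tendsto (fun j => weakPairing Λ T a b c (mollify (bump δ hδ j) φ)) atTop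
      (𝓝 (weakPairing Λ T a b c φ)) := by
  obtain ⟨K, hK⟩ := h.lipschitz
  obtain ⟨B, hB⟩ := h.bounded
  have hB0 : 0 ≤ B := (norm_nonneg _).trans (hB 0)
  have hcell := Λ.measurableSet_cell
  borelize V
  obtain ⟨R, hR⟩ : ∃ R : ℝ, ∀ j : ℕ, ∀ p : ℝ × ℝ, p.2 ∈ Λ.cell → R < |p.2| →
      mollify (bump δ hδ j) φ p = 0 ∧ fderiv ℝ (mollify (bump δ hδ j) φ) p = 0 := by
    have h1 := h.support_space
    cases Λ
    · obtain ⟨R, hR⟩ := h1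
      have key : ∀ j, ∀ t x : ℝ, R + δ ≤ |x| → mollify (bump δ hδ j) φ (t, x) = 0 := by
        intro j t x hx
        refine mollify_eq_zero _ fun z hz => hR _ _ ?_
        have : |z.2| ≤ ‖z‖ := norm_snd_le z
        have := bump_rOut_le δ hδ j
        show R ≤ |x - z.2|
        linarith [abs_sub_abs_le_abs_sub x z.2]
      exact ⟨R + δ, fun j p _ hp => ⟨key j p.1 p.2 hp.le, fderiv_eq_zero_of_support (key j) hp⟩⟩
    · refine ⟨1, fun j p hp hp1 => ?_⟩
      have hx' : (0 : ℝ) ≤ p.2 ∧ p.2 < 1 := hp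
      rw [abs_of_nonneg hx'.1] at hp1
      linarith [hx'.2]
  have hsm : ∀ j, ContDiff ℝ ∞ (mollify (bump δ hδ j) φ) := fun j =>
    contDiff_mollify _ hK.continuous
  have hdm : ∀ j, Continuous (fderiv ℝ (mollify (bump δ hδ j) φ)) := fun j =>
    (hsm j).continuous_fderiv (by simp)
  have hconv : ∀ᵐ p : ℝ × ℝ, Tendsto (fun j => fderiv ℝ (mollify (bump δ hδ j) φ) p) atTop
      (𝓝 (fderiv ℝ φ p)) := by
    have := ContDiffBump.ae_convolution_tendsto_right_of_locallyIntegrable (K := 2)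
      (tendsto_bump_rOut δ hδ)
      (Eventually.of_forall fun j => by
        show δ / (j + 1) ≤ 2 * (δ / (j + 1) / 2); linarith)
      (locallyIntegrable_fderiv hK)
    filter_upwards [this] with p hp
    refine hp.congr fun j => (fderiv_mollify _ hK p).symm
  refine Tendsto.add ?_ ?_
  · refine tendsto_integral_of_dominated_convergence
      (fun p => (Icc 0 T ×ˢ Icc (-R) R).indicator (fun _ => A * K + A * K) p) ?_
      (integrable_boxBound T R _ Λ) ?_ ?_
    · intro j
      exact (hd.meas_a.inner ((hdm j).clm_apply continuous_const).aestronglyMeasurable).add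
        (hd.meas_b.inner ((hdm j).clm_apply continuous_const).aestronglyMeasurable)
    · intro j
      filter_upwards [hd.bound_a, hd.bound_b, ae_restrict_mem (measurableSet_Ioo.prod hcell)]
        with p ha hb hp
      have hA : 0 ≤ A := (norm_nonneg _).trans ha
      by_cases hpR : R < |p.2|
      · rw [(hR j p hp.2 hpR).2]
        simp only [zero_apply, inner_zero_right, add_zero, norm_zero]
        exact indicator_nonneg (fun _ _ => by positivity) _
      · have hm : p ∈ Icc 0 T ×ˢ Icc (-R) R :=
          ⟨Ioo_subset_Icc_self hp.1, abs_le.1 (not_lt.1 hpR)⟩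
        rw [indicator_of_mem hm]
        have hn := norm_fderiv_mollify_le (bump δ hδ j) hK p
        refine (norm_add_le _ _).trans (add_le_add ?_ ?_)
        · exact (norm_inner_le_norm _ _).trans
            (mul_le_mul ha (norm_fderiv_apply_fst_le hn) (norm_nonneg _) hA)
        · exact (norm_inner_le_norm _ _).trans
            (mul_le_mul hb (norm_fderiv_apply_snd_le hn) (norm_nonneg _) hA)
    · filter_upwards [ae_restrict_of_ae hconv] with p hp
      have h1 : ∀ v : ℝ × ℝ, Tendsto (fun j => fderiv ℝ (mollify (bump δ hδ j) φ) p v) atTop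
          (𝓝 (fderiv ℝ φ p v)) := fun v =>
        ((ContinuousLinearMap.apply ℝ V v).continuous.tendsto _).comp hp
      exact (tendsto_const_nhds.inner (h1 _)).add (tendsto_const_nhds.inner (h1 _))
  · refine tendsto_integral_of_dominated_convergence
      (fun p => (Icc (-R) R).indicator (fun _ => A * B) p) ?_
      (integrable_segBound R _ Λ) ?_ ?_
    · intro j
      refine hd.meas_c.inner (Continuous.aestronglyMeasurable ?_)
      exact (hsm j).continuous.comp (by fun_prop)
    · intro j
      filter_upwards [hd.bound_c, ae_restrict_mem hcell] with x hc hx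
      have hA : 0 ≤ A := (norm_nonneg _).trans hc
      by_cases hpR : R < |x|
      · rw [(hR j (0, x) hx hpR).1]
        simp only [inner_zero_right, norm_zero]
        exact indicator_nonneg (fun _ _ => by positivity) _
      · have hm : x ∈ Icc (-R) R := abs_le.1 (not_lt.1 hpR)
        rw [indicator_of_mem hm]
        exact (norm_inner_le_norm _ _).trans
            (mul_le_mul hc (norm_mollify_le _ hB _) (norm_nonneg _) hA)
    · refine Eventually.of_forall fun x => tendsto_const_nhds.inner ?_
      exact ContDiffBump.convolution_tendsto_right_of_continuous (tendsto_bump_rOut δ hδ)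
        hK.continuous _

lemma weakPairing_eq_zero_of_lipschitz [FiniteDimensional ℝ V] {Λ : Domain} {T : ℝ}
    {a b : ℝ × ℝ → V} {c : ℝ → V} {A : ℝ} (hd : BoundedData Λ T a b c A)
    (hs : ∀ φ : ℝ → ℝ → V, IsTestFunction Λ T φ →
      weakPairing Λ T a b c (fun p => φ p.1 p.2) = 0)
    {φ : ℝ × ℝ → V} (h : IsLipschitzTest Λ T φ) : weakPairing Λ T a b c φ = 0 := by
  obtain ⟨T', hT', hz⟩ := h.support_time
  have hδ : 0 < (T - T') / 2 := by linarith
  refine tendsto_nhds_unique (tendsto_weakPairing_mollify hd h hδ) ?_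
  refine tendsto_const_nhds.congr fun j => ?_
  exact (hs _ (h.isTestFunction_mollify hz (bump _ hδ j)
    (by linarith [bump_rOut_le _ hδ j]))).symm

lemma weakPairing_nonneg_of_lipschitz {Λ : Domain} {T : ℝ}
    {a b : ℝ × ℝ → ℝ} {c : ℝ → ℝ} {A : ℝ} (hd : BoundedData Λ T a b c A)
    (hs : ∀ φ : ℝ → ℝ → ℝ, IsTestFunction Λ T φ → (∀ t x, 0 ≤ φ t x) →
      0 ≤ weakPairing Λ T a b c (fun p => φ p.1 p.2))
    {φ : ℝ × ℝ → ℝ} (h : IsLipschitzTest Λ T φ) (h0 : ∀ p, 0 ≤ φ p) :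
    0 ≤ weakPairing Λ T a b c φ := by
  obtain ⟨T', hT', hz⟩ := h.support_time
  have hδ : 0 < (T - T') / 2 := by linarith
  refine ge_of_tendsto' (tendsto_weakPairing_mollify hd h hδ) fun j => ?_
  exact hs _ (h.isTestFunction_mollify hz (bump _ hδ j)
    (by linarith [bump_rOut_le _ hδ j])) fun t x => mollify_nonneg _ h0 _

end Pairing

/-! ### Weak formulations with Lipschitz test functions -/

section PartialDerivatives

variable {V : Type*} [NormedAddCommGroup V] [NormedSpace ℝ V]

lemma hasDerivAt_fst {φ : ℝ × ℝ → V} {t x : ℝ} (h : DifferentiableAt ℝ φ (t, x)) :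
    HasDerivAt (fun s => φ (s, x)) (fderiv ℝ φ (t, x) (1, 0)) t :=
  h.hasFDerivAt.comp_hasDerivAt t ((hasDerivAt_id t).prodMk (hasDerivAt_const t x))

lemma hasDerivAt_snd {φ : ℝ × ℝ → V} {t x : ℝ} (h : DifferentiableAt ℝ φ (t, x)) :
    HasDerivAt (fun z => φ (t, z)) (fderiv ℝ φ (t, x) (0, 1)) x :=
  h.hasFDerivAt.comp_hasDerivAt x ((hasDerivAt_const x t).prodMk (hasDerivAt_id x))

lemma IsTestFunction.differentiable {Λ : Domain} {T : ℝ} {φ : ℝ → ℝ → V}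
    (h : IsTestFunction Λ T φ) : Differentiable ℝ (fun p : ℝ × ℝ => φ p.1 p.2) :=
  h.smooth.differentiable (by simp)

end PartialDerivatives

lemma weakPairing_eq_zero_of_isWeakSolution {m : ℕ} {Λ : Domain} {T : ℝ}
    {F : State m → State m} {u₀ : ℝ → State m} {u : ℝ → ℝ → State m}
    (hu : IsWeakSolution Λ T F u₀ u) {A : ℝ}
    (hd : BoundedData Λ T (fun p => u p.1 p.2) (fun p => F (u p.1 p.2)) u₀ A)
    {φ : ℝ × ℝ → State m} (hφ : IsLipschitzTest Λ T φ) :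
    weakPairing Λ T (fun p => u p.1 p.2) (fun p => F (u p.1 p.2)) u₀ φ = 0 := by
  refine weakPairing_eq_zero_of_lipschitz hd (fun ψ hψ => ?_) hφ
  have h := (hu ψ hψ).2.2
  have e1 : ∀ p : ℝ × ℝ, deriv (fun s => ψ s p.2) p.1
      = fderiv ℝ (fun p : ℝ × ℝ => ψ p.1 p.2) p (1, 0) := fun p =>
    (hasDerivAt_fst (hψ.differentiable (p.1, p.2))).deriv
  have e2 : ∀ p : ℝ × ℝ, deriv (fun z => ψ p.1 z) p.2
      = fderiv ℝ (fun p : ℝ × ℝ => ψ p.1 p.2) p (0, 1) := fun p =>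
    (hasDerivAt_snd (hψ.differentiable (p.1, p.2))).deriv
  simp only [e1, e2] at h
  rw [weakPairing, h]
  exact neg_add_cancel _

lemma weakPairing_nonneg_of_entropyInequality {m : ℕ} {Λ : Domain} {T : ℝ}
    {η q : State m → ℝ} {u₀ : ℝ → State m} {u : ℝ → ℝ → State m}
    (hu : SatisfiesEntropyInequality Λ T η q u₀ u) {A : ℝ}
    (hd : BoundedData Λ T (fun p => η (u p.1 p.2)) (fun p => q (u p.1 p.2)) (fun x => η (u₀ x)) A)
    {φ : ℝ × ℝ → ℝ} (hφ : IsLipschitzTest Λ T φ) (h0 : ∀ p, 0 ≤ φ p) :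
    0 ≤ weakPairing Λ T (fun p => η (u p.1 p.2)) (fun p => q (u p.1 p.2))
      (fun x => η (u₀ x)) φ := by
  refine weakPairing_nonneg_of_lipschitz hd (fun ψ hψ hψ0 => ?_) hφ h0
  have h := (hu ψ hψ fun t _ x => hψ0 t x).2.2
  have e1 : ∀ p : ℝ × ℝ, deriv (fun s => ψ s p.2) p.1
      = fderiv ℝ (fun p : ℝ × ℝ => ψ p.1 p.2) p (1, 0) := fun p =>
    (hasDerivAt_fst (hψ.differentiable (p.1, p.2))).deriv
  have e2 : ∀ p : ℝ × ℝ, deriv (fun z => ψ p.1 z) p.2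
      = fderiv ℝ (fun p : ℝ × ℝ => ψ p.1 p.2) p (0, 1) := fun p =>
    (hasDerivAt_snd (hψ.differentiable (p.1, p.2))).deriv
  simp only [e1, e2] at h
  simp only [weakPairing, RCLike.inner_apply, conj_trivial]
  simp only [mul_comm (fderiv ℝ _ _ _), mul_comm (ψ 0 _)]
  linarith

/-! ### The divergence theorem for Lipschitz test functions -/

lemma integrableOn_of_box {Λ : Domain} {T R : ℝ} {f : ℝ × ℝ → ℝ} (hf : Continuous f)
    (h0 : ∀ p : ℝ × ℝ, p.2 ∈ Λ.cell → R < |p.2| → f p = 0) :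
    IntegrableOn f (Ioo 0 T ×ˢ Λ.cell) := by
  have h1 : IntegrableOn f (Icc 0 T ×ˢ Icc (-R) R) :=
    hf.continuousOn.integrableOn_compact (isCompact_Icc.prod isCompact_Icc)
  refine h1.of_forall_sdiff_eq_zero (measurableSet_Ioo.prod Λ.measurableSet_cell) ?_
  rintro p ⟨hp, hp'⟩
  refine h0 p hp.2 (not_le.1 fun h => hp' ⟨Ioo_subset_Icc_self hp.1, abs_le.1 h⟩)

lemma integral_deriv_time {Λ : Domain} {T : ℝ} (hT : 0 < T) {φ : ℝ → ℝ → ℝ}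
    (hφ : IsTestFunction Λ T φ) :
    (∫ p in Ioo 0 T ×ˢ Λ.cell, fderiv ℝ (fun p : ℝ × ℝ => φ p.1 p.2) p (1, 0))
      + ∫ x in Λ.cell, φ 0 x = 0 := by
  have hc : Continuous fun p => fderiv ℝ (fun p : ℝ × ℝ => φ p.1 p.2) p (1, 0) :=
    (hφ.smooth.continuous_fderiv (by simp)).clm_apply continuous_const
  obtain ⟨R, hR⟩ := exists_support_radius (φ := fun p : ℝ × ℝ => φ p.1 p.2) hφ.support_space
  have hi : IntegrableOn (fun p => fderiv ℝ (fun p : ℝ × ℝ => φ p.1 p.2) p (1, 0))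
      (Ioo 0 T ×ˢ Λ.cell) := integrableOn_of_box (R := R) hc fun p hp hp' => by simp [(hR p hp hp').2]
  rw [IntegrableOn, Measure.volume_eq_prod, ← Measure.prod_restrict] at hi
  rw [Measure.volume_eq_prod, ← Measure.prod_restrict, integral_prod_symm _ hi]
  obtain ⟨T', hT', hz⟩ := hφ.support_time
  have : ∀ x, ∫ t in Ioo 0 T, fderiv ℝ (fun p : ℝ × ℝ => φ p.1 p.2) (t, x) (1, 0) = - φ 0 x := by
    intro x
    rw [← integral_Ioc_eq_integral_Ioo, ← intervalIntegral.integral_of_le hT.le,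
      intervalIntegral.integral_eq_sub_of_hasDerivAt
        (fun t _ => hasDerivAt_fst (hφ.differentiable (t, x)))]
    · simp [hz T x hT'.le]
    · exact (hc.comp (by fun_prop : Continuous fun t : ℝ => (t, x))).intervalIntegrable _ _
  simp only [this, integral_neg]
  exact neg_add_cancel _

lemma integral_deriv_space {Λ : Domain} {T : ℝ} {φ : ℝ → ℝ → ℝ}
    (hφ : IsTestFunction Λ T φ) :
    (∫ p in Ioo 0 T ×ˢ Λ.cell, fderiv ℝ (fun p : ℝ × ℝ => φ p.1 p.2) p (0, 1)) = 0 := by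
  have hc : Continuous fun p => fderiv ℝ (fun p : ℝ × ℝ => φ p.1 p.2) p (0, 1) :=
    (hφ.smooth.continuous_fderiv (by simp)).clm_apply continuous_const
  obtain ⟨R, hR⟩ := exists_support_radius (φ := fun p : ℝ × ℝ => φ p.1 p.2) hφ.support_space
  have hi : IntegrableOn (fun p => fderiv ℝ (fun p : ℝ × ℝ => φ p.1 p.2) p (0, 1))
      (Ioo 0 T ×ˢ Λ.cell) := integrableOn_of_box (R := R) hc fun p hp hp' => by simp [(hR p hp hp').2]
  rw [IntegrableOn, Measure.volume_eq_prod, ← Measure.prod_restrict] at hi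
  rw [Measure.volume_eq_prod, ← Measure.prod_restrict, integral_prod _ hi]
  refine integral_eq_zero_of_ae (Eventually.of_forall fun t => ?_)
  have hft : ∀ a b : ℝ, ∫ x in a..b, fderiv ℝ (fun p : ℝ × ℝ => φ p.1 p.2) (t, x) (0, 1)
      = φ t b - φ t a := fun a b =>
    intervalIntegral.integral_eq_sub_of_hasDerivAt
      (fun x _ => hasDerivAt_snd (hφ.differentiable (t, x)))
      ((hc.comp (by fun_prop : Continuous fun x : ℝ => (t, x))).intervalIntegrable _ _)
  have hd := hφ.on_domain
  have hs := hφ.support_space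
  cases Λ
  · obtain ⟨R', hR'⟩ := hs
    simp only [Domain.cell, Measure.restrict_univ, Pi.zero_apply]
    set r := max (max R R') 0 + 1 with hr
    have h1 : R < r := by have := le_max_left R R'; have := le_max_left (max R R') 0; linarith
    have h2 : R' < r := by have := le_max_right R R'; have := le_max_left (max R R') 0; linarith
    have h3 : 0 < r := by have := le_max_right (max R R') 0; linarith
    rw [← intervalIntegral.integral_eq_integral_of_support_subset (a := -r) (b := r), hft,
      hR' t r (by rw [abs_of_pos h3]; exact h2.le),
      hR' t (-r) (by rw [abs_neg, abs_of_pos h3]; exact h2.le), sub_zero]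
    intro x hx
    by_contra hx'
    refine hx ?_
    have : R < |x| := by
      refine h1.trans_le ?_
      by_contra h
      have := abs_lt.1 (not_le.1 h)
      exact hx' ⟨this.1, this.2.le⟩
    simp [(hR (t, x) trivial this).2]
  · simp only [Domain.cell, Pi.zero_apply]
    rw [integral_Ico_eq_integral_Ioc, ← intervalIntegral.integral_of_le zero_le_one, hft]
    have := hd t 0
    rw [zero_add] at this
    rw [this, sub_self]

/-- The divergence theorem on `(0,T) × Λ` for Lipschitz fields vanishing near `t = T`. -/
lemma integral_divergence_eq_zero {Λ : Domain} {T : ℝ} (hT : 0 < T) {W₁ W₂ : ℝ × ℝ → ℝ}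
    (h₁ : IsLipschitzTest Λ T W₁) (h₂ : IsLipschitzTest Λ T W₂) :
    (∫ p in Ioo 0 T ×ˢ Λ.cell, fderiv ℝ W₁ p (1, 0)) + (∫ x in Λ.cell, W₁ (0, x)) = 0 ∧
    (∫ p in Ioo 0 T ×ˢ Λ.cell, fderiv ℝ W₂ p (0, 1)) = 0 := by
  constructor
  · have hd : BoundedData Λ T (fun _ => (1 : ℝ)) (fun _ => 0) (fun _ => 1) 1 := by
      constructor <;> first | exact aestronglyMeasurable_const | simp
    have := weakPairing_eq_zero_of_lipschitz hd (fun φ hφ => by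
      simpa [weakPairing] using integral_deriv_time hT hφ) h₁
    simpa [weakPairing] using this
  · have hd : BoundedData Λ T (fun _ => (0 : ℝ)) (fun _ => 1) (fun _ => 0) 1 := by
      constructor <;> first | exact aestronglyMeasurable_const | simp
    have := weakPairing_eq_zero_of_lipschitz hd (fun φ hφ => by
      simpa [weakPairing] using integral_deriv_space hφ) h₂
    simpa [weakPairing] using this

/-! ### Relative entropy and relative flux -/

/-- The hypotheses on flux, entropy and state space for one fixed value of the random parameter. -/
structure EntropySetting {m : ℕ} (U C : Set (State m)) (F : State m → State m)
    (η q : State m → ℝ) (CF lo up : ℝ) : Prop where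
  isOpen : IsOpen U
  subset : C ⊆ U
  isCompact : IsCompact C
  convex : Convex ℝ C
  contDiffOn_F : ContDiffOn ℝ 2 F U
  pair : IsEntropyPair U F η q
  CF_nonneg : 0 ≤ CF
  lo_pos : 0 < lo
  lo_le_up : lo ≤ up
  bounds : ∀ z ∈ C, ∀ v : State m, ‖hessianForm F z v‖ ≤ CF * ‖v‖ ^ 2 ∧
    lo * ‖v‖ ^ 2 ≤ hessianForm η z v ∧ hessianForm η z v ≤ up * ‖v‖ ^ 2

/-- The first order Taylor remainder of `f` at `v`. For an entropy `f = η` this is the relative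
entropy `η(u|v)`. -/
noncomputable def bregman {m : ℕ} {V : Type*} [NormedAddCommGroup V] [NormedSpace ℝ V]
    (f : State m → V) (u v : State m) : V := f u - f v - fderiv ℝ f v (u - v)

/-- The relative entropy flux `q(u) - q(v) - Dη(v) (F(u) - F(v))`. -/
noncomputable def relFlux {m : ℕ} (F : State m → State m) (η q : State m → ℝ)
    (u v : State m) : ℝ := q u - q v - fderiv ℝ η v (F u - F v)

lemma taylor_le {g g' g'' : ℝ → ℝ} {c : ℝ} (h1 : ∀ τ ∈ Icc (0 : ℝ) 1, HasDerivAt g (g' τ) τ)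
    (h2 : ∀ τ ∈ Icc (0 : ℝ) 1, HasDerivAt g' (g'' τ) τ) (hc : ∀ τ ∈ Icc (0 : ℝ) 1, g'' τ ≤ c) :
    g 1 - g 0 - g' 0 ≤ c / 2 := by
  have k1 : ∀ ⦃τ⦄, τ ∈ Icc (0 : ℝ) 1 → g' τ ≤ g' 0 + c * τ := by
    refine image_le_of_deriv_right_le_deriv_boundary (B' := fun _ => c)
      (fun τ hτ => (h2 τ hτ).continuousAt.continuousWithinAt)
      (fun τ hτ => (h2 τ (Ico_subset_Icc_self hτ)).hasDerivWithinAt) (by simp) (by fun_prop)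
      (fun τ _ => ?_) (fun τ hτ => hc τ (Ico_subset_Icc_self hτ))
    have := ((hasDerivAt_id τ).const_mul c).const_add (g' 0)
    simpa using this.hasDerivWithinAt
  have k2 : ∀ ⦃τ⦄, τ ∈ Icc (0 : ℝ) 1 → g τ ≤ g 0 + g' 0 * τ + c / 2 * τ ^ 2 := by
    refine image_le_of_deriv_right_le_deriv_boundary (B' := fun τ => g' 0 + c * τ)
      (fun τ hτ => (h1 τ hτ).continuousAt.continuousWithinAt)
      (fun τ hτ => (h1 τ (Ico_subset_Icc_self hτ)).hasDerivWithinAt) (by simp) (by fun_prop)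
      (fun τ _ => ?_) (fun τ hτ => k1 (Ico_subset_Icc_self hτ))
    have := (((hasDerivAt_id τ).const_mul (g' 0)).const_add (g 0)).add
      (((hasDerivAt_id τ).pow 2).const_mul (c / 2))
    refine (this.congr_deriv ?_).hasDerivWithinAt
    simp; ring
  have := k2 (right_mem_Icc.2 zero_le_one)
  linarith

section C2

variable {m : ℕ} {V : Type*} [NormedAddCommGroup V] [NormedSpace ℝ V] {U C : Set (State m)}
  {f : State m → V}

lemma hasFDerivAt_of_contDiffOn (hU : IsOpen U) (hf : ContDiffOn ℝ 2 f U) {z : State m}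
    (hz : z ∈ U) : HasFDerivAt f (fderiv ℝ f z) z :=
  ((hf.contDiffAt (hU.mem_nhds hz)).differentiableAt (by simp)).hasFDerivAt

lemma contDiffOn_fderiv (hU : IsOpen U) (hf : ContDiffOn ℝ 2 f U) :
    ContDiffOn ℝ 1 (fderiv ℝ f) U :=
  hf.fderiv_of_isOpen hU (by norm_num)

lemma hasFDerivAt_fderiv (hU : IsOpen U) (hf : ContDiffOn ℝ 2 f U) {z : State m}
    (hz : z ∈ U) : HasFDerivAt (fderiv ℝ f) (fderiv ℝ (fderiv ℝ f) z) z :=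
  (((contDiffOn_fderiv hU hf).contDiffAt (hU.mem_nhds hz)).differentiableAt (by simp)).hasFDerivAt

lemma continuousOn_fderiv_fderiv (hU : IsOpen U) (hf : ContDiffOn ℝ 2 f U) :
    ContinuousOn (fderiv ℝ (fderiv ℝ f)) U :=
  (contDiffOn_fderiv hU hf).continuousOn_fderiv_of_isOpen hU le_rfl

lemma snd_fderiv_symm (hU : IsOpen U) (hf : ContDiffOn ℝ 2 f U) {z : State m}
    (hz : z ∈ U) (a b : State m) :
    fderiv ℝ (fderiv ℝ f) z a b = fderiv ℝ (fderiv ℝ f) z b a :=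
  ((hf.contDiffAt (hU.mem_nhds hz)).isSymmSndFDerivAt (by simp)).eq a b

/-- Taylor's theorem with a one-sided bound on the second derivative, tested by a functional. -/
lemma apply_bregman_le (hU : IsOpen U) (hC : Convex ℝ C) (hCU : C ⊆ U) (hf : ContDiffOn ℝ 2 f U)
    (L : V →L[ℝ] ℝ) {c : ℝ} (hb : ∀ z ∈ C, ∀ w, L (hessianForm f z w) ≤ c * ‖w‖ ^ 2)
    {u v : State m} (hu : u ∈ C) (hv : v ∈ C) :
    L (bregman f u v) ≤ c / 2 * ‖u - v‖ ^ 2 := by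
  have hmem : ∀ τ ∈ Icc (0 : ℝ) 1, v + τ • (u - v) ∈ C := fun τ hτ =>
    hC.add_smul_sub_mem hv hu hτ
  have hl : ∀ τ : ℝ, HasDerivAt (fun τ : ℝ => v + τ • (u - v)) (u - v) τ := fun τ => by
    simpa using ((hasDerivAt_id τ).smul_const (u - v)).const_add v
  have h := taylor_le (g := fun τ => L (f (v + τ • (u - v))))
    (g' := fun τ => L (fderiv ℝ f (v + τ • (u - v)) (u - v)))
    (g'' := fun τ => L (fderiv ℝ (fderiv ℝ f) (v + τ • (u - v)) (u - v) (u - v)))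
    (c := c * ‖u - v‖ ^ 2) (fun τ hτ => ?_) (fun τ hτ => ?_) fun τ hτ => hb _ (hmem τ hτ) _
  · simp only [one_smul, zero_smul, add_zero, add_sub_cancel] at h
    simp only [bregman, map_sub] at h ⊢
    linarith
  · exact L.hasFDerivAt.comp_hasDerivAt τ
      ((hasFDerivAt_of_contDiffOn hU hf (hCU (hmem τ hτ))).comp_hasDerivAt τ (hl τ))
  · refine L.hasFDerivAt.comp_hasDerivAt τ ?_
    have h1 : HasDerivAt (fun τ : ℝ => fderiv ℝ f (v + τ • (u - v)))
        (fderiv ℝ (fderiv ℝ f) (v + τ • (u - v)) (u - v)) τ :=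
      (hasFDerivAt_fderiv hU hf (hCU (hmem τ hτ))).comp_hasDerivAt τ (hl τ)
    exact (ContinuousLinearMap.apply ℝ V (u - v)).hasFDerivAt.comp_hasDerivAt τ h1

end C2

namespace EntropySetting

variable {m : ℕ} {U C : Set (State m)} {F : State m → State m} {η q : State m → ℝ}
  {CF lo up : ℝ}

lemma up_pos (h : EntropySetting U C F η q CF lo up) : 0 < up := h.lo_pos.trans_le h.lo_le_up

lemma relEntropy_le (h : EntropySetting U C F η q CF lo up) {u v : State m} (hu : u ∈ C)
    (hv : v ∈ C) : bregman η u v ≤ up / 2 * ‖u - v‖ ^ 2 :=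
  apply_bregman_le h.isOpen h.convex h.subset h.pair.contDiffOn_entropy
    (ContinuousLinearMap.id ℝ ℝ) (fun z hz w => (h.bounds z hz w).2.2) hu hv

lemma le_relEntropy (h : EntropySetting U C F η q CF lo up) {u v : State m} (hu : u ∈ C)
    (hv : v ∈ C) : lo / 2 * ‖u - v‖ ^ 2 ≤ bregman η u v := by
  have := apply_bregman_le h.isOpen h.convex h.subset h.pair.contDiffOn_entropy
    (-ContinuousLinearMap.id ℝ ℝ) (c := -lo) (fun z hz w => by
      have := (h.bounds z hz w).2.1
      simp only [neg_apply, ContinuousLinearMap.id_apply]; linarith) hu hv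
  simp only [neg_apply, ContinuousLinearMap.id_apply] at this
  linarith

lemma relEntropy_nonneg (h : EntropySetting U C F η q CF lo up) {u v : State m} (hu : u ∈ C)
    (hv : v ∈ C) : 0 ≤ bregman η u v :=
  le_trans (mul_nonneg (half_pos h.lo_pos).le (sq_nonneg _)) (h.le_relEntropy hu hv)

/-- The bound on the Hessian form of `F` controls the vector-valued Taylor remainder `e = F(u|v)`:
test it with the functional `⟨e, ·⟩`. -/
lemma norm_bregman_flux_le (h : EntropySetting U C F η q CF lo up) {u v : State m} (hu : u ∈ C)
    (hv : v ∈ C) : ‖bregman F u v‖ ≤ CF / 2 * ‖u - v‖ ^ 2 := by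
  set e := bregman F u v
  have := apply_bregman_le h.isOpen h.convex h.subset h.contDiffOn_F
    (innerSL ℝ e) (c := ‖e‖ * CF) (fun z hz w => by
      simp only [innerSL_apply_apply]
      refine (real_inner_le_norm _ _).trans ?_
      rw [mul_assoc]
      exact mul_le_mul_of_nonneg_left (h.bounds z hz w).1 (norm_nonneg _)) hu hv
  simp only [innerSL_apply_apply] at this
  change inner ℝ e e ≤ _ at this
  rw [real_inner_self_eq_norm_sq] at this
  by_cases he : ‖e‖ = 0
  · rw [he]; exact mul_nonneg (by linarith [h.CF_nonneg]) (sq_nonneg _)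
  · have he : 0 < ‖e‖ := lt_of_le_of_ne (norm_nonneg _) (Ne.symm he)
    refine le_of_mul_le_mul_left ?_ he
    linarith

/-- By compatibility the first order terms of the relative entropy flux cancel. -/
lemma relFlux_eq (h : EntropySetting U C F η q CF lo up) {u v : State m} (hv : v ∈ C) :
    relFlux F η q u v = bregman q u v - fderiv ℝ η v (bregman F u v) := by
  have := DFunLike.congr_fun (h.pair.compatible v (h.subset hv)) (u - v)
  rw [ContinuousLinearMap.comp_apply] at this
  simp only [relFlux, bregman]
  rw [map_sub (fderiv ℝ η v) (F u - F v), this]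
  ring

/-- The relative entropy flux is controlled by the relative entropy: a finite propagation speed.
Indeed, by compatibility it is a combination of Taylor remainders, hence quadratic in `u - v`. -/
lemma exists_speed (h : EntropySetting U C F η q CF lo up) :
    ∃ s : ℝ, 0 ≤ s ∧ ∀ u ∈ C, ∀ v ∈ C, |relFlux F η q u v| ≤ s * bregman η u v := by
  obtain ⟨c, hc⟩ := IsCompact.exists_bound_of_continuousOn
    (E := State m →L[ℝ] State m →L[ℝ] ℝ) h.isCompact
    ((continuousOn_fderiv_fderiv h.isOpen h.pair.contDiffOn_flux).mono h.subset)
  obtain ⟨M, hM⟩ := h.isCompact.exists_bound_of_continuousOn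
    ((contDiffOn_fderiv h.isOpen h.pair.contDiffOn_entropy).continuousOn.mono h.subset)
  have hq : ∀ z ∈ C, ∀ w, |hessianForm q z w| ≤ |c| * ‖w‖ ^ 2 := fun z hz w => by
    have := (fderiv ℝ (fderiv ℝ q) z).le_opNorm₂ w w
    rw [mul_assoc, ← sq] at this
    exact this.trans (mul_le_mul_of_nonneg_right ((hc z hz).trans (le_abs_self c)) (sq_nonneg _))
  have hlo := h.lo_pos
  have hCF := h.CF_nonneg
  refine ⟨(|c| + |M| * CF) / lo, by positivity, fun u hu v hv => ?_⟩
  have h1 : |bregman q u v| ≤ |c| / 2 * ‖u - v‖ ^ 2 := by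
    refine abs_le.2 ⟨?_, ?_⟩
    · have := apply_bregman_le h.isOpen h.convex h.subset h.pair.contDiffOn_flux
        (-ContinuousLinearMap.id ℝ ℝ) (c := |c|) (fun z hz w => by
          simpa using (neg_le_abs _).trans (hq z hz w)) hu hv
      simp only [neg_apply, ContinuousLinearMap.id_apply] at this
      linarith
    · exact apply_bregman_le h.isOpen h.convex h.subset h.pair.contDiffOn_flux
        (ContinuousLinearMap.id ℝ ℝ) (c := |c|) (fun z hz w => by
          simpa using (le_abs_self _).trans (hq z hz w)) hu hv
  have h2 : |fderiv ℝ η v (bregman F u v)| ≤ |M| * (CF / 2 * ‖u - v‖ ^ 2) :=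
    ((fderiv ℝ η v).le_opNorm _).trans (mul_le_mul ((hM v hv).trans (le_abs_self M))
      (h.norm_bregman_flux_le hu hv) (norm_nonneg _) (abs_nonneg _))
  have h3 := h.le_relEntropy hu hv
  rw [h.relFlux_eq hv]
  calc |bregman q u v - fderiv ℝ η v (bregman F u v)|
      ≤ |bregman q u v| + |fderiv ℝ η v (bregman F u v)| := abs_sub _ _
    _ ≤ (|c| + |M| * CF) / lo * (lo / 2 * ‖u - v‖ ^ 2) := by
        have : (|c| + |M| * CF) / lo * (lo / 2 * ‖u - v‖ ^ 2)
          = |c| / 2 * ‖u - v‖ ^ 2 + |M| * (CF / 2 * ‖u - v‖ ^ 2) := by field_simp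
        linarith
    _ ≤ _ := mul_le_mul_of_nonneg_left h3 (by positivity)

/-- Differentiating `Dη DF = Dq` shows that `D²η(v)` symmetrizes `DF(v)`. -/
lemma hessian_symmetrizes (h : EntropySetting U C F η q CF lo up) {v : State m} (hv : v ∈ C)
    (a b : State m) :
    fderiv ℝ (fderiv ℝ η) v a (fderiv ℝ F v b) = fderiv ℝ (fderiv ℝ η) v b (fderiv ℝ F v a) := by
  have hvU := h.subset hv
  have e : (fun z => (fderiv ℝ η z).comp (fderiv ℝ F z)) =ᶠ[𝓝 v] fderiv ℝ q := by
    filter_upwards [h.isOpen.mem_nhds hvU] with z hz using h.pair.compatible z hz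
  have h1 := ((hasFDerivAt_fderiv h.isOpen h.pair.contDiffOn_entropy hvU).clm_comp
    (hasFDerivAt_fderiv h.isOpen h.contDiffOn_F hvU)).congr_of_eventuallyEq e.symm
  have h2 := h1.unique (hasFDerivAt_fderiv h.isOpen h.pair.contDiffOn_flux hvU)
  have key : ∀ a b, fderiv ℝ (fderiv ℝ q) v a b = fderiv ℝ η v (fderiv ℝ (fderiv ℝ F) v a b)
      + fderiv ℝ (fderiv ℝ η) v a (fderiv ℝ F v b) := fun a b => by
    rw [← h2]; simp
  have s1 := snd_fderiv_symm h.isOpen h.pair.contDiffOn_flux hvU a b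
  rw [key, key, snd_fderiv_symm h.isOpen h.contDiffOn_F hvU a b] at s1
  exact add_left_cancel s1

/-- Polarization turns the bounds on the quadratic form of `D²η` into a bound on the bilinear
form. -/
lemma hessian_le (h : EntropySetting U C F η q CF lo up) {v : State m} (hv : v ∈ C)
    (a b : State m) : |fderiv ℝ (fderiv ℝ η) v a b| ≤ up * ‖a‖ * ‖b‖ := by
  set B := fderiv ℝ (fderiv ℝ η) v with hB
  have hsym : ∀ a b, B a b = B b a :=
    snd_fderiv_symm h.isOpen h.pair.contDiffOn_entropy (h.subset hv)
  have hup := h.up_pos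
  have hlow : ∀ w, 0 ≤ B w w := fun w =>
    le_trans (mul_nonneg h.lo_pos.le (sq_nonneg _)) (h.bounds v hv w).2.1
  have hupp : ∀ w, B w w ≤ up * ‖w‖ ^ 2 := fun w => (h.bounds v hv w).2.2
  have key : ∀ a b, ‖a‖ = 1 → ‖b‖ = 1 → B a b ≤ up := fun a b ha hb => by
    have h1 := hupp (a + b)
    have h2 := hlow (a - b)
    have h3 : ‖a + b‖ ^ 2 ≤ 4 := by
      have := norm_add_le a b
      rw [ha, hb] at this
      nlinarith [norm_nonneg (a + b)]
    simp only [map_add, map_sub, add_apply, sub_apply] at h1 h2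
    rw [hsym b a] at h1 h2
    nlinarith
  by_cases ha : a = 0
  · simp [ha]
  by_cases hb : b = 0
  · simp [hb]
  have ha' : 0 < ‖a‖ := norm_pos_iff.2 ha
  have hb' : 0 < ‖b‖ := norm_pos_iff.2 hb
  have k : ∀ a : State m, 0 < ‖a‖ → B a b ≤ up * ‖a‖ * ‖b‖ := fun a ha' => by
    have := key (‖a‖⁻¹ • a) (‖b‖⁻¹ • b) (by simp [norm_smul, ha'.ne']) (by simp [norm_smul, hb'.ne'])
    simp only [map_smul, smul_apply, smul_eq_mul] at this
    have e : B a b = (‖a‖ * ‖b‖) * (‖b‖⁻¹ * (‖a‖⁻¹ * B a b)) := by field_simp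
    rw [e, mul_assoc up, mul_comm up]
    exact mul_le_mul_of_nonneg_left (by linarith) (by positivity)
  refine abs_le.2 ⟨?_, k a ha'⟩
  have := k (-a) (by simpa using ha')
  simp only [map_neg, neg_apply, norm_neg] at this
  linarith

/-- The source term of the relative entropy balance: `vt`, `vx` are the derivatives of the
approximate solution `v`, and `vt + DF(v) vx` is its residual. By symmetry only the residual and
the Taylor remainder of the flux remain, and Young's inequality separates the residual. -/
lemma source_le (h : EntropySetting U C F η q CF lo up) {u v : State m} (hu : u ∈ C)
    (hv : v ∈ C) (vt vx : State m) {L : ℝ} (hL : ‖vx‖ ≤ L) :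
    -(fderiv ℝ (fderiv ℝ η) v vt (u - v) + fderiv ℝ (fderiv ℝ η) v vx (F u - F v))
      ≤ ‖vt + fderiv ℝ F v vx‖ ^ 2 / 2 + (up * CF * L + up ^ 2) / lo * bregman η u v := by
  set R := vt + fderiv ℝ F v vx with hR
  set B := fderiv ℝ (fderiv ℝ η) v with hB
  have e : B vt (u - v) + B vx (F u - F v) = B R (u - v) + B vx (bregman F u v) := by
    have h1 : B (fderiv ℝ F v vx) (u - v) = B vx (fderiv ℝ F v (u - v)) := by
      have s := snd_fderiv_symm h.isOpen h.pair.contDiffOn_entropy (h.subset hv)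
      rw [s, ← h.hessian_symmetrizes hv]
    simp only [hR, map_add, add_apply, h1, bregman, map_sub (B vx) (F u - F v)]
    ring
  rw [e]
  have h1 := (abs_le.1 (h.hessian_le hv R (u - v))).1
  have h2 := (abs_le.1 (h.hessian_le hv vx (bregman F u v))).1
  have h3 := h.norm_bregman_flux_le hu hv
  have h4 := h.le_relEntropy hu hv
  have hup := h.up_pos
  have hlo := h.lo_pos
  have hCF := h.CF_nonneg
  have hL0 : 0 ≤ L := (norm_nonneg _).trans hL
  have h5 : up * ‖vx‖ * ‖bregman F u v‖ ≤ up * L * (CF / 2 * ‖u - v‖ ^ 2) := by gcongr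
  have h6 : up * ‖R‖ * ‖u - v‖ ≤ ‖R‖ ^ 2 / 2 + up ^ 2 * ‖u - v‖ ^ 2 / 2 := by
    nlinarith [sq_nonneg (‖R‖ - up * ‖u - v‖)]
  have h7 : (up * CF * L + up ^ 2) / lo * (lo / 2 * ‖u - v‖ ^ 2)
      ≤ (up * CF * L + up ^ 2) / lo * bregman η u v :=
    mul_le_mul_of_nonneg_left h4 (by positivity)
  have h8 : (up * CF * L + up ^ 2) / lo * (lo / 2 * ‖u - v‖ ^ 2)
      = up * L * (CF / 2 * ‖u - v‖ ^ 2) + up ^ 2 * ‖u - v‖ ^ 2 / 2 := by field_simp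
  linarith

end EntropySetting

/-! ### The relative entropy balance -/

section Composition

variable {m : ℕ} {V : Type*} [NormedAddCommGroup V] [NormedSpace ℝ V] {U C : Set (State m)}

lemma exists_lipschitzOnWith_of_compact {E : Type*} [NormedAddCommGroup E] [NormedSpace ℝ E]
    {O S : Set E} {H : E → V} (hO : IsOpen O) (hH : ContDiffOn ℝ 1 H O) (hSO : S ⊆ O)
    (hS : IsCompact S) (hconv : Convex ℝ S) : ∃ K, LipschitzOnWith K H S := by
  obtain ⟨K, hK⟩ := IsCompact.exists_bound_of_continuousOn (E := E →L[ℝ] V) hS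
    ((hH.continuousOn_fderiv_of_isOpen hO le_rfl).mono hSO)
  refine ⟨K.toNNReal, hconv.lipschitzOnWith_of_nnnorm_fderiv_le (𝕜 := ℝ) (fun z hz =>
    (hH.contDiffAt (hO.mem_nhds (hSO hz))).differentiableAt (by simp)) fun z hz => ?_⟩
  rw [← NNReal.coe_le_coe, coe_nnnorm]
  exact (hK z hz).trans (Real.le_coe_toNNReal K)

/-- Nonlinear functions of a Lipschitz test function and a Lipschitz state that vanish with the
test function are Lipschitz test functions. -/
lemma IsLipschitzTest.comp {Λ : Domain} {T : ℝ} {Φ : ℝ × ℝ → ℝ} (hΦ : IsLipschitzTest Λ T Φ)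
    (hU : IsOpen U) (hCU : C ⊆ U) (hC : IsCompact C) (hconv : Convex ℝ C) {v : ℝ × ℝ → State m}
    (hv : ∃ K, LipschitzWith K v) (hvC : ∀ p, v p ∈ C)
    (hvΛ : ∀ t, Λ.IsFunctionOn fun x => v (t, x)) {H : ℝ × State m → V}
    (hH : ContDiffOn ℝ 1 H (univ ×ˢ U)) (hH0 : ∀ z, H (0, z) = 0) :
    IsLipschitzTest Λ T (fun p => H (Φ p, v p)) := by
  obtain ⟨B, hB⟩ := hΦ.bounded
  obtain ⟨K₁, hK₁⟩ := hΦ.lipschitz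
  obtain ⟨K₂, hK₂⟩ := hv
  have hS : IsCompact (Icc (-B) B ×ˢ C) := isCompact_Icc.prod hC
  have hsub : Icc (-B) B ×ˢ C ⊆ (univ : Set ℝ) ×ˢ U := prod_mono (subset_univ _) hCU
  have hmem : ∀ p, (Φ p, v p) ∈ Icc (-B) B ×ˢ C := fun p => ⟨abs_le.1 (hB p), hvC p⟩
  obtain ⟨K, hK⟩ := exists_lipschitzOnWith_of_compact (isOpen_univ.prod hU) hH hsub hS
    ((convex_Icc _ _).prod hconv)
  constructor
  · refine ⟨K * max K₁ K₂, fun p p' => ?_⟩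
    refine (hK (hmem p) (hmem p')).trans ?_
    rw [ENNReal.coe_mul, mul_assoc]
    gcongr
    exact (hK₁.prodMk hK₂) p p'
  · obtain ⟨D, hD⟩ := hS.exists_bound_of_continuousOn (hH.continuousOn.mono hsub)
    exact ⟨D, fun p => hD _ (hmem p)⟩
  · intro t
    have h1 := hΦ.on_domain t
    have h2 := hvΛ t
    cases Λ
    · trivial
    · intro x
      have e1 : Φ (t, x + 1) = Φ (t, x) := h1 x
      have e2 : v (t, x + 1) = v (t, x) := h2 x
      simp only [e1, e2]
  · obtain ⟨T', hT', h0⟩ := hΦ.support_time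
    exact ⟨T', hT', fun t x ht => by simp only [h0 t x ht, hH0]⟩
  · have h1 := hΦ.support_space
    cases Λ
    · obtain ⟨R, hR⟩ := h1
      exact ⟨R, fun t x hx => by simp only [hR t x hx, hH0]⟩
    · trivial

end Composition

section Integrability

variable {V : Type*} [NormedAddCommGroup V] [InnerProductSpace ℝ V] [FiniteDimensional ℝ V]

lemma integrable_weakPairing {Λ : Domain} {T : ℝ}
    {a b : ℝ × ℝ → V} {c : ℝ → V} {A : ℝ} (hd : BoundedData Λ T a b c A) {φ : ℝ × ℝ → V}
    (h : IsLipschitzTest Λ T φ) :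
    IntegrableOn (fun p => inner ℝ (a p) (fderiv ℝ φ p (1, 0))
      + inner ℝ (b p) (fderiv ℝ φ p (0, 1))) (Ioo 0 T ×ˢ Λ.cell) ∧
    IntegrableOn (fun x => inner ℝ (c x) (φ (0, x))) Λ.cell := by
  obtain ⟨K, hK⟩ := h.lipschitz
  obtain ⟨B, hB⟩ := h.bounded
  have hB0 : 0 ≤ B := (norm_nonneg _).trans (hB 0)
  have hcell := Λ.measurableSet_cell
  borelize V
  obtain ⟨R, hR⟩ := exists_support_radius h.support_space
  have hm : ∀ w : ℝ × ℝ, AEStronglyMeasurable (fun p => fderiv ℝ φ p w)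
      (volume.restrict (Ioo 0 T ×ˢ Λ.cell)) := fun w =>
    (measurable_fderiv_apply_const ℝ φ w).aestronglyMeasurable
  constructor
  · refine (integrable_boxBound T R (A * K + A * K) Λ).mono'
      ((hd.meas_a.inner (hm _)).add (hd.meas_b.inner (hm _))) ?_
    filter_upwards [hd.bound_a, hd.bound_b, ae_restrict_mem (measurableSet_Ioo.prod hcell)]
      with p ha hb hp
    have hA : 0 ≤ A := (norm_nonneg _).trans ha
    by_cases hpR : R < |p.2|
    · rw [(hR p hp.2 hpR).2]
      simp only [zero_apply, inner_zero_right, add_zero, norm_zero]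
      exact indicator_nonneg (fun _ _ => by positivity) _
    · have hm : p ∈ Icc 0 T ×ˢ Icc (-R) R :=
        ⟨Ioo_subset_Icc_self hp.1, abs_le.1 (not_lt.1 hpR)⟩
      rw [indicator_of_mem hm]
      have hn := norm_fderiv_le_of_lipschitz ℝ hK (x₀ := p)
      refine (norm_add_le _ _).trans (add_le_add ?_ ?_)
      · exact (norm_inner_le_norm _ _).trans
          (mul_le_mul ha (norm_fderiv_apply_fst_le hn) (norm_nonneg _) hA)
      · exact (norm_inner_le_norm _ _).trans
          (mul_le_mul hb (norm_fderiv_apply_snd_le hn) (norm_nonneg _) hA)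
  · refine (integrable_segBound R (A * B) Λ).mono' (hd.meas_c.inner ?_) ?_
    · exact (hK.continuous.comp (by fun_prop : Continuous fun x : ℝ => ((0 : ℝ), x))).aestronglyMeasurable
    filter_upwards [hd.bound_c, ae_restrict_mem hcell] with x hc hx
    have hA : 0 ≤ A := (norm_nonneg _).trans hc
    by_cases hpR : R < |x|
    · rw [(hR (0, x) hx hpR).1]
      simp only [inner_zero_right, norm_zero]
      exact indicator_nonneg (fun _ _ => by positivity) _
    · have hm : x ∈ Icc (-R) R := abs_le.1 (not_lt.1 hpR)
      rw [indicator_of_mem hm]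
      exact (norm_inner_le_norm _ _).trans (mul_le_mul hc (hB _) (norm_nonneg _) hA)

end Integrability

lemma integrable_divergence {Λ : Domain} {T : ℝ} {W : ℝ × ℝ → ℝ} (h : IsLipschitzTest Λ T W) :
    IntegrableOn (fun p => fderiv ℝ W p (1, 0)) (Ioo 0 T ×ˢ Λ.cell) ∧
    IntegrableOn (fun p => fderiv ℝ W p (0, 1)) (Ioo 0 T ×ˢ Λ.cell) ∧
    IntegrableOn (fun x => W (0, x)) Λ.cell := by
  have h1 : BoundedData Λ T (fun _ => (1 : ℝ)) (fun _ => 0) (fun _ => 1) 1 := by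
    constructor <;> first | exact aestronglyMeasurable_const | simp
  have h2 : BoundedData Λ T (fun _ => (0 : ℝ)) (fun _ => 1) (fun _ => 0) 1 := by
    constructor <;> first | exact aestronglyMeasurable_const | simp
  have k1 := integrable_weakPairing h1 h
  have k2 := integrable_weakPairing h2 h
  refine ⟨?_, ?_, ?_⟩
  · simpa using k1.1
  · simpa using k2.1
  · simpa using k1.2

/-- An entropy solution `u` and a Lipschitz approximation `v` of it, both with values in `C`, for
one fixed value of the random parameter. -/
structure EntropyComparison {m : ℕ} (Λ : Domain) (T : ℝ) (U C : Set (State m))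
    (F : State m → State m) (η q : State m → ℝ) (CF lo up : ℝ) (u₀ : ℝ → State m)
    (u : ℝ → ℝ → State m) (v : ℝ × ℝ → State m) : Prop
    extends EntropySetting U C F η q CF lo up where
  T_pos : 0 < T
  weak : IsWeakSolution Λ T F u₀ u
  entropy : SatisfiesEntropyInequality Λ T η q u₀ u
  meas_u : AEStronglyMeasurable (fun p : ℝ × ℝ => u p.1 p.2)
    (volume.restrict (Ioo 0 T ×ˢ Λ.cell))
  meas_u₀ : AEStronglyMeasurable u₀ (volume.restrict Λ.cell)
  mem_u : ∀ᵐ p : ℝ × ℝ ∂(volume.restrict (Ioo 0 T ×ˢ Λ.cell)), u p.1 p.2 ∈ C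
  mem_u₀ : ∀ᵐ x ∂(volume.restrict Λ.cell), u₀ x ∈ C
  lipschitz_v : ∃ K, LipschitzWith K v
  mem_v : ∀ p, v p ∈ C
  on_domain_v : ∀ t, Λ.IsFunctionOn fun x => v (t, x)

lemma aestronglyMeasurable_comp_of_continuousOn {α E V : Type*} [MeasurableSpace α]
    [NormedAddCommGroup E] [MeasurableSpace E] [BorelSpace E] [SecondCountableTopology E]
    [NormedAddCommGroup V]
    [MeasurableSpace V] [BorelSpace V] [SecondCountableTopology V] {μ : Measure α}
    {C : Set E} {f : E → V} {u : α → E} (hC : IsClosed C) (hf : ContinuousOn f C)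
    (hu : AEStronglyMeasurable u μ) (huC : ∀ᵐ x ∂μ, u x ∈ C) :
    AEStronglyMeasurable (fun x => f (u x)) μ := by
  classical
  have hm : Measurable (C.piecewise f 0) :=
    hf.measurable_piecewise continuousOn_const hC.measurableSet
  refine ((hm.comp_aemeasurable hu.aemeasurable).aestronglyMeasurable).congr ?_
  filter_upwards [huC] with x hx
  simp [hx]

/-- The gradient associated with a differential, as a continuous linear map. -/
noncomputable def toGradient (m : ℕ) : (State m →L[ℝ] ℝ) →L[ℝ] State m :=
  LinearMap.toContinuousLinearMap
    { toFun := fun L => WithLp.toLp 2 (fun i => L (EuclideanSpace.single i 1))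
      map_add' := fun _ _ => rfl
      map_smul' := fun _ _ => rfl }

lemma inner_toGradient {m : ℕ} (L : State m →L[ℝ] ℝ) (a : State m) :
    inner ℝ a (toGradient m L) = L a := by
  have h : a = ∑ i, a i • EuclideanSpace.single i (1 : ℝ) := by
    have := (EuclideanSpace.basisFun (Fin m) ℝ).sum_repr a
    simpa using this.symm
  conv_rhs => rw [h]
  simp only [map_sum, map_smul, smul_eq_mul]
  simp only [PiLp.inner_apply, RCLike.inner_apply, conj_trivial, mul_comm]
  rfl

namespace EntropyComparison

variable {m : ℕ} {Λ : Domain} {T : ℝ} {U C : Set (State m)} {F : State m → State m}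
  {η q : State m → ℝ} {CF lo up : ℝ} {u₀ : ℝ → State m} {u : ℝ → ℝ → State m}
  {v : ℝ × ℝ → State m}

lemma boundedData (h : EntropyComparison Λ T U C F η q CF lo up u₀ u v) {V : Type*}
    [NormedAddCommGroup V] [MeasurableSpace V] [BorelSpace V] [SecondCountableTopology V]
    {f g k : State m → V} (hf : ContinuousOn f C) (hg : ContinuousOn g C)
    (hk : ContinuousOn k C) :
    ∃ A, BoundedData Λ T (fun p => f (u p.1 p.2)) (fun p => g (u p.1 p.2)) (fun x => k (u₀ x)) A
    := by
  obtain ⟨A, hA⟩ := h.isCompact.exists_bound_of_continuousOn hf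
  obtain ⟨B, hB⟩ := h.isCompact.exists_bound_of_continuousOn hg
  obtain ⟨D, hD⟩ := h.isCompact.exists_bound_of_continuousOn hk
  refine ⟨max A (max B D), ?_, ?_, ?_, ?_, ?_, ?_⟩
  · exact aestronglyMeasurable_comp_of_continuousOn h.isCompact.isClosed hf h.meas_u h.mem_u
  · exact aestronglyMeasurable_comp_of_continuousOn h.isCompact.isClosed hg h.meas_u h.mem_u
  · exact aestronglyMeasurable_comp_of_continuousOn h.isCompact.isClosed hk h.meas_u₀ h.mem_u₀
  · filter_upwards [h.mem_u] with p hp using (hA _ hp).trans (le_max_left _ _)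
  · filter_upwards [h.mem_u] with p hp using
      (hB _ hp).trans ((le_max_left _ _).trans (le_max_right _ _))
  · filter_upwards [h.mem_u₀] with p hp using
      (hD _ hp).trans ((le_max_right _ _).trans (le_max_right _ _))

/-- The derivatives of the test function `Φ ∇η(v)` and of the fields `Φ (η(v) - Dη(v) v)` and
`Φ (q(v) - Dη(v) F(v))`; the first order terms in the last two cancel, by compatibility in the
case of the flux. -/
lemma fderiv_test (h : EntropySetting U C F η q CF lo up) {Φ : ℝ × ℝ → ℝ}
    {p : ℝ × ℝ} (hvp : v p ∈ C) (hΦ : DifferentiableAt ℝ Φ p) (hv : DifferentiableAt ℝ v p)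
    (d : ℝ × ℝ) :
    fderiv ℝ (fun p => Φ p • toGradient m (fderiv ℝ η (v p))) p d
      = fderiv ℝ Φ p d • toGradient m (fderiv ℝ η (v p))
        + Φ p • toGradient m (fderiv ℝ (fderiv ℝ η) (v p) (fderiv ℝ v p d)) ∧
    fderiv ℝ (fun p => Φ p * (η (v p) - fderiv ℝ η (v p) (v p))) p d
      = fderiv ℝ Φ p d * (η (v p) - fderiv ℝ η (v p) (v p))
        - Φ p * fderiv ℝ (fderiv ℝ η) (v p) (fderiv ℝ v p d) (v p) ∧
    fderiv ℝ (fun p => Φ p * (q (v p) - fderiv ℝ η (v p) (F (v p)))) p d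
      = fderiv ℝ Φ p d * (q (v p) - fderiv ℝ η (v p) (F (v p)))
        - Φ p * fderiv ℝ (fderiv ℝ η) (v p) (fderiv ℝ v p d) (F (v p)) := by
  have hU := h.subset hvp
  have hη := (hasFDerivAt_of_contDiffOn h.isOpen h.pair.contDiffOn_entropy hU).comp p hv.hasFDerivAt
  have hq := (hasFDerivAt_of_contDiffOn h.isOpen h.pair.contDiffOn_flux hU).comp p hv.hasFDerivAt
  have hF := (hasFDerivAt_of_contDiffOn h.isOpen h.contDiffOn_F hU).comp p hv.hasFDerivAt
  have hG := (hasFDerivAt_fderiv h.isOpen h.pair.contDiffOn_entropy hU).comp p hv.hasFDerivAt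
  have hcomp := DFunLike.congr_fun (h.pair.compatible _ hU) (fderiv ℝ v p d)
  rw [ContinuousLinearMap.comp_apply] at hcomp
  refine ⟨?_, ?_, ?_⟩
  · have e := (hΦ.hasFDerivAt.smul ((toGradient m).hasFDerivAt.comp p hG)).fderiv
    have e' := DFunLike.congr_fun e d
    refine Eq.trans e' ?_
    simp [add_comm]
  · have e := (hΦ.hasFDerivAt.mul (hη.sub (hG.clm_apply hv.hasFDerivAt))).fderiv
    have e' := DFunLike.congr_fun e d
    refine Eq.trans e' ?_
    simp
    ring
  · have e := (hΦ.hasFDerivAt.mul (hq.sub (hG.clm_apply hF))).fderiv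
    have e' := DFunLike.congr_fun e d
    refine Eq.trans e' ?_
    simp [hcomp]
    ring

/-- The density of the relative entropy balance tested with `Φ`. -/
noncomputable def balanceDensity (F : State m → State m) (η q : State m → ℝ)
    (u : ℝ → ℝ → State m) (v : ℝ × ℝ → State m) (Φ : ℝ × ℝ → ℝ) (p : ℝ × ℝ) : ℝ :=
  fderiv ℝ Φ p (1, 0) * bregman η (u p.1 p.2) (v p)
    + fderiv ℝ Φ p (0, 1) * relFlux F η q (u p.1 p.2) (v p)
    - Φ p * (fderiv ℝ (fderiv ℝ η) (v p) (fderiv ℝ v p (1, 0)) (u p.1 p.2 - v p)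
      + fderiv ℝ (fderiv ℝ η) (v p) (fderiv ℝ v p (0, 1)) (F (u p.1 p.2) - F (v p)))

/-- The relative entropy inequality, tested with a nonnegative Lipschitz function. It is the
entropy inequality tested with `Φ`, minus the weak formulation tested with `Φ ∇η(v)`, minus a
divergence that collects the terms containing only `v`. -/
theorem balance (h : EntropyComparison Λ T U C F η q CF lo up u₀ u v) {Φ : ℝ × ℝ → ℝ}
    (hΦ : IsLipschitzTest Λ T Φ) (h0 : ∀ p, 0 ≤ Φ p) :
    IntegrableOn (balanceDensity F η q u v Φ) (Ioo 0 T ×ˢ Λ.cell) ∧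
    IntegrableOn (fun x => Φ (0, x) * bregman η (u₀ x) (v (0, x))) Λ.cell ∧
    0 ≤ (∫ p in Ioo 0 T ×ˢ Λ.cell, balanceDensity F η q u v Φ p)
      + ∫ x in Λ.cell, Φ (0, x) * bregman η (u₀ x) (v (0, x)) := by
  have hηc : ContinuousOn η C := h.pair.contDiffOn_entropy.continuousOn.mono h.subset
  have hqc : ContinuousOn q C := h.pair.contDiffOn_flux.continuousOn.mono h.subset
  have hFc : ContinuousOn F C := h.contDiffOn_F.continuousOn.mono h.subset
  obtain ⟨A₁, hd₁⟩ := h.boundedData hηc hqc hηc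
  obtain ⟨A₂, hd₂⟩ := h.boundedData (f := fun z => z) (k := fun z => z) continuousOn_id hFc
    continuousOn_id
  have hmaps : MapsTo (Prod.snd : ℝ × State m → State m) (univ ×ˢ U) U := fun z hz => hz.2
  have c1 : ContDiffOn ℝ 1 (fun z : ℝ × State m => z.1) (univ ×ˢ U) := contDiffOn_fst
  have c2 : ContDiffOn ℝ 1 (fun z : ℝ × State m => z.2) (univ ×ˢ U) := contDiffOn_snd
  have cη : ContDiffOn ℝ 1 (fun z : ℝ × State m => η z.2) (univ ×ˢ U) :=
    (h.pair.contDiffOn_entropy.of_le (by norm_num)).comp c2 hmaps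
  have cq : ContDiffOn ℝ 1 (fun z : ℝ × State m => q z.2) (univ ×ˢ U) :=
    (h.pair.contDiffOn_flux.of_le (by norm_num)).comp c2 hmaps
  have cF : ContDiffOn ℝ 1 (fun z : ℝ × State m => F z.2) (univ ×ˢ U) :=
    (h.contDiffOn_F.of_le (by norm_num)).comp c2 hmaps
  have cG : ContDiffOn ℝ 1 (fun z : ℝ × State m => fderiv ℝ η z.2) (univ ×ˢ U) :=
    (contDiffOn_fderiv h.isOpen h.pair.contDiffOn_entropy).comp c2 hmaps
  have hφ : IsLipschitzTest Λ T (fun p => Φ p • toGradient m (fderiv ℝ η (v p))) :=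
    hΦ.comp h.isOpen h.subset h.isCompact h.convex h.lipschitz_v h.mem_v h.on_domain_v
      (H := fun z => z.1 • toGradient m (fderiv ℝ η z.2))
      (c1.smul ((toGradient m).contDiff.comp_contDiffOn cG)) (by simp)
  have hW₁ : IsLipschitzTest Λ T (fun p => Φ p * (η (v p) - fderiv ℝ η (v p) (v p))) :=
    hΦ.comp h.isOpen h.subset h.isCompact h.convex h.lipschitz_v h.mem_v h.on_domain_v
      (H := fun z => z.1 * (η z.2 - fderiv ℝ η z.2 z.2))
      (c1.mul (cη.sub (cG.clm_apply c2))) (by simp)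
  have hW₂ : IsLipschitzTest Λ T (fun p => Φ p * (q (v p) - fderiv ℝ η (v p) (F (v p)))) :=
    hΦ.comp h.isOpen h.subset h.isCompact h.convex h.lipschitz_v h.mem_v h.on_domain_v
      (H := fun z => z.1 * (q z.2 - fderiv ℝ η z.2 (F z.2)))
      (c1.mul (cq.sub (cG.clm_apply cF))) (by simp)
  have iE := integrable_weakPairing hd₁ hΦ
  have iW := integrable_weakPairing hd₂ hφ
  have iD₁ := integrable_divergence hW₁
  have iD₂ := integrable_divergence hW₂
  have eE := weakPairing_nonneg_of_entropyInequality h.entropy hd₁ hΦ h0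
  have eW := weakPairing_eq_zero_of_isWeakSolution h.weak hd₂ hφ
  obtain ⟨eD₁, eD₂⟩ := integral_divergence_eq_zero h.T_pos hW₁ hW₂
  obtain ⟨K₁, hK₁⟩ := hΦ.lipschitz
  obtain ⟨K₂, hK₂⟩ := h.lipschitz_v
  have hae : ∀ᵐ p ∂(volume.restrict (Ioo 0 T ×ˢ Λ.cell)),
      (inner ℝ (η (u p.1 p.2)) (fderiv ℝ Φ p (1, 0)) + inner ℝ (q (u p.1 p.2)) (fderiv ℝ Φ p (0, 1)))
      - (inner ℝ (u p.1 p.2) (fderiv ℝ (fun p => Φ p • toGradient m (fderiv ℝ η (v p))) p (1, 0))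
        + inner ℝ (F (u p.1 p.2))
          (fderiv ℝ (fun p => Φ p • toGradient m (fderiv ℝ η (v p))) p (0, 1)))
      - (fderiv ℝ (fun p => Φ p * (η (v p) - fderiv ℝ η (v p) (v p))) p (1, 0)
        + fderiv ℝ (fun p => Φ p * (q (v p) - fderiv ℝ η (v p) (F (v p)))) p (0, 1))
      = balanceDensity F η q u v Φ p := by
    filter_upwards [ae_restrict_of_ae hK₁.ae_differentiableAt,
      ae_restrict_of_ae hK₂.ae_differentiableAt] with p h1 h2
    obtain ⟨a1, a2, -⟩ := fderiv_test h.toEntropySetting (h.mem_v p) h1 h2 (1, 0)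
    obtain ⟨b1, -, b3⟩ := fderiv_test h.toEntropySetting (h.mem_v p) h1 h2 (0, 1)
    rw [a1, a2, b1, b3]
    simp only [inner_add_right, inner_smul_right, inner_toGradient, balanceDensity, bregman,
      relFlux, map_sub, RCLike.inner_apply, conj_trivial]
    ring
  have hinit : ∀ x, inner ℝ (η (u₀ x)) (Φ (0, x))
      - inner ℝ (u₀ x) (Φ (0, x) • toGradient m (fderiv ℝ η (v (0, x))))
      - Φ (0, x) * (η (v (0, x)) - fderiv ℝ η (v (0, x)) (v (0, x)))
      = Φ (0, x) * bregman η (u₀ x) (v (0, x)) := fun x => by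
    simp only [inner_smul_right, inner_toGradient, bregman, map_sub, RCLike.inner_apply,
      conj_trivial]
    ring
  have i1 := (iE.1.sub iW.1).sub (iD₁.1.add iD₂.2.1)
  have i2 := (iE.2.sub iW.2).sub iD₁.2.2
  refine ⟨i1.congr hae, i2.congr (Eventually.of_forall hinit), ?_⟩
  have s1 := (integral_congr_ae hae).symm.trans
    ((integral_sub (iE.1.sub iW.1) (iD₁.1.add iD₂.2.1)).trans
      (congrArg₂ (· - ·) (integral_sub iE.1 iW.1) (integral_add iD₁.1 iD₂.2.1)))
  have s2 := (integral_congr_ae (Eventually.of_forall hinit)).symm.trans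
    ((integral_sub (iE.2.sub iW.2) iD₁.2.2).trans
      (congrArg (· - _) (integral_sub iE.2 iW.2)))
  rw [s1, s2]
  unfold weakPairing at eE eW
  linarith

end EntropyComparison

/-! ### The Lipschitz seminorm in space -/

section Slope

variable {m : ℕ} {v : ℝ × ℝ → State m} {K : NNReal}

lemma lipschitzWith_slice (hv : LipschitzWith K v) (t : ℝ) :
    LipschitzWith K fun x => v (t, x) := by
  have := hv.comp (LipschitzWith.prodMk_left t)
  rwa [mul_one] at this

lemma measurable_deriv_slice (hv : LipschitzWith K v) :
    Measurable fun p : ℝ × ℝ => deriv (fun x => v (p.1, x)) p.2 :=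
  measurable_deriv_with_param (f := fun t x => v (t, x)) hv.continuous

lemma eLpNorm_slope_le (hv : LipschitzWith K v) (Λ : Domain) (t : ℝ) :
    eLpNorm (fun x => deriv (fun x' => v (t, x')) x) ⊤ (volume.restrict Λ.cell) ≤ K := by
  rw [eLpNorm_exponent_top]
  refine eLpNormEssSup_le_of_ae_nnnorm_bound (Eventually.of_forall fun x => ?_)
  exact norm_deriv_le_of_lipschitz (lipschitzWith_slice hv t)

lemma supNorm_nonneg (Λ : Domain) (f : ℝ → State m) : 0 ≤ Λ.supNorm f :=
  ENNReal.toReal_nonneg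

lemma supNorm_slope_le (hv : LipschitzWith K v) (Λ : Domain) (t : ℝ) :
    Λ.supNorm (fun x => deriv (fun x' => v (t, x')) x) ≤ K :=
  ENNReal.toReal_le_coe_of_le_coe (eLpNorm_slope_le hv Λ t)

/-- `‖g(t, ·)‖_∞ ≤ c` says that a slice of a measurable set is null, a measurable condition on
`t`. -/
lemma measurable_eLpNorm_top_slice {E : Type*} [NormedAddCommGroup E] [MeasurableSpace E]
    [OpensMeasurableSpace E] {g : ℝ × ℝ → E} (hg : Measurable g) (μ : Measure ℝ) [SFinite μ] :
    Measurable fun t => eLpNorm (fun x => g (t, x)) ⊤ μ := by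
  refine measurable_of_Iic fun c => ?_
  have hs : MeasurableSet {p : ℝ × ℝ | c < ‖g p‖ₑ} := measurableSet_lt measurable_const hg.enorm
  have e : (fun t => eLpNorm (fun x => g (t, x)) ⊤ μ) ⁻¹' Iic c
      = (fun t => μ (Prod.mk t ⁻¹' {p : ℝ × ℝ | c < ‖g p‖ₑ})) ⁻¹' {0} := by
    ext t
    simp only [mem_preimage, mem_Iic, mem_singleton_iff, eLpNorm_exponent_top]
    have : (∀ᵐ x ∂μ, ‖g (t, x)‖ₑ ≤ c) ↔ μ (Prod.mk t ⁻¹' {p : ℝ × ℝ | c < ‖g p‖ₑ}) = 0 := by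
      rw [ae_iff]
      simp only [not_le]
      rfl
    rw [← this]
    refine ⟨fun h => ?_, fun h => eLpNormEssSup_le_of_ae_enorm_bound h⟩
    filter_upwards [ae_le_eLpNormEssSup (f := fun x => g (t, x)) (μ := μ)] with x hx
    exact hx.trans h
  rw [e]
  exact measurable_measure_prodMk_left hs (measurableSet_singleton 0)

lemma measurable_supNorm_slope (hv : LipschitzWith K v) (Λ : Domain) :
    Measurable fun t => Λ.supNorm (fun x => deriv (fun x' => v (t, x')) x) :=
  (measurable_eLpNorm_top_slice (measurable_deriv_slice hv) _).ennreal_toReal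

lemma ae_norm_fderiv_snd_le (hv : LipschitzWith K v) (Λ : Domain) (T : ℝ) :
    ∀ᵐ p ∂(volume.restrict (Ioo 0 T ×ˢ Λ.cell)),
      ‖fderiv ℝ v p (0, 1)‖ ≤ Λ.supNorm (fun x => deriv (fun x' => v (p.1, x')) x) := by
  have h1 : ∀ᵐ p ∂(volume.restrict (Ioo 0 T ×ˢ Λ.cell)), ‖deriv (fun x => v (p.1, x)) p.2‖
      ≤ Λ.supNorm (fun x => deriv (fun x' => v (p.1, x')) x) := by
    rw [Measure.volume_eq_prod, ← Measure.prod_restrict, Measure.ae_prod_iff_ae_ae]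
    · refine Eventually.of_forall fun t => ?_
      filter_upwards [ae_le_eLpNormEssSup (f := fun x => deriv (fun x' => v (t, x')) x)
        (μ := volume.restrict Λ.cell)] with x hx
      have hfin := ne_top_of_le_ne_top ENNReal.coe_ne_top (eLpNorm_slope_le hv Λ t)
      rw [← eLpNorm_exponent_top] at hx
      have := ENNReal.toReal_mono hfin hx
      rwa [toReal_enorm] at this
    · exact measurableSet_le (measurable_deriv_slice hv).norm
        ((measurable_supNorm_slope hv Λ).comp measurable_fst)
  filter_upwards [h1, ae_restrict_of_ae hv.ae_differentiableAt] with p hp hd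
  rwa [(hasDerivAt_snd (φ := v) (t := p.1) (x := p.2) hd).deriv] at hp

end Slope

/-! ### Time weights and space cutoffs -/

lemma lipschitzWith_mul {α : Type*} [PseudoMetricSpace α] {f g : α → ℝ} {K L : NNReal}
    (hf : LipschitzWith K f) (hg : LipschitzWith L g) (hf1 : ∀ x, |f x| ≤ 1)
    (hg1 : ∀ x, |g x| ≤ 1) : LipschitzWith (K + L) fun x => f x * g x := by
  refine LipschitzWith.of_dist_le_mul fun x y => ?_
  have h1 := hf.dist_le_mul x y
  have h2 := hg.dist_le_mul x y
  rw [Real.dist_eq] at *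
  have e : f x * g x - f y * g y = (f x - f y) * g x + f y * (g x - g y) := by ring
  rw [e, NNReal.coe_add, add_mul]
  refine (abs_add_le _ _).trans (add_le_add ?_ ?_)
  · rw [abs_mul]
    exact (mul_le_of_le_one_right (abs_nonneg _) (hg1 x)).trans h1
  · rw [abs_mul]
    exact (mul_le_of_le_one_left (abs_nonneg _) (hf1 y)).trans h2

/-- The Gronwall weight `exp (-∫₀ᵗ k)`, continued by `1` to negative times. -/
noncomputable def decay (k : ℝ → ℝ) (t : ℝ) : ℝ :=
  Real.exp (-∫ s in (0 : ℝ)..t, (Ioi 0).indicator k s)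

section Decay

variable {k : ℝ → ℝ} {M : ℝ}

lemma intervalIntegrable_rate (hk : Measurable k) (h0 : ∀ t, 0 ≤ k t) (hM : ∀ t, k t ≤ M)
    (a b : ℝ) : IntervalIntegrable k volume a b := by
  refine (intervalIntegrable_const (c := M)).mono_fun hk.aestronglyMeasurable ?_
  refine Eventually.of_forall fun t => ?_
  simp only [Real.norm_eq_abs, abs_of_nonneg (h0 t)]
  exact (hM t).trans (le_abs_self M)

lemma norm_indicator_rate_le (h0 : ∀ t, 0 ≤ k t) (hM : ∀ t, k t ≤ M) (t : ℝ) :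
    |(Ioi 0).indicator k t| ≤ M := by
  by_cases ht : t ∈ Ioi (0 : ℝ)
  · rw [indicator_of_mem ht, abs_of_nonneg (h0 t)]; exact hM t
  · rw [indicator_of_notMem ht, abs_zero]; exact (h0 t).trans (hM t)

lemma locallyIntegrable_indicator_rate (hk : Measurable k) (h0 : ∀ t, 0 ≤ k t)
    (hM : ∀ t, k t ≤ M) : LocallyIntegrable ((Ioi 0).indicator k) := by
  refine (locallyIntegrable_const M).mono (hk.indicator measurableSet_Ioi).aestronglyMeasurable ?_
  refine Eventually.of_forall fun t => ?_
  exact (norm_indicator_rate_le h0 hM t).trans (le_abs_self M)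

lemma integral_indicator_rate_nonneg (h0 : ∀ t, 0 ≤ k t) (t : ℝ) :
    0 ≤ ∫ s in (0 : ℝ)..t, (Ioi 0).indicator k s := by
  rcases le_total 0 t with ht | ht
  · exact intervalIntegral.integral_nonneg ht fun s _ => indicator_nonneg (fun s _ => h0 s) s
  · have : ∫ s in (0 : ℝ)..t, (Ioi 0).indicator k s = ∫ s in (0 : ℝ)..t, (0 : ℝ) := by
      refine intervalIntegral.integral_congr fun s hs => ?_
      rw [uIcc_of_ge ht] at hs
      exact indicator_of_notMem (fun h => absurd hs.2 (not_le.2 h)) _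
    simp [this]

lemma decay_pos (t : ℝ) : 0 < decay k t := Real.exp_pos _

lemma decay_le_one (h0 : ∀ t, 0 ≤ k t) (t : ℝ) : decay k t ≤ 1 :=
  Real.exp_le_one_iff.2 (neg_nonpos.2 (integral_indicator_rate_nonneg h0 t))

lemma decay_zero : decay k 0 = 1 := by simp [decay]

lemma decay_eq {t : ℝ} (ht : 0 ≤ t) : decay k t = Real.exp (-∫ s in (0 : ℝ)..t, k s) := by
  have : ∫ s in (0 : ℝ)..t, (Ioi 0).indicator k s = ∫ s in (0 : ℝ)..t, k s := by
    rw [intervalIntegral.integral_of_le ht, intervalIntegral.integral_of_le ht]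
    refine setIntegral_congr_fun measurableSet_Ioc fun s hs => ?_
    exact indicator_of_mem (show s ∈ Ioi 0 from hs.1) _
  rw [decay, this]

lemma lipschitzWith_decay (hk : Measurable k) (h0 : ∀ t, 0 ≤ k t) (hM : ∀ t, k t ≤ M) :
    LipschitzWith M.toNNReal (decay k) := by
  have hexp : ∀ x y : ℝ, 0 ≤ x → x ≤ y → Real.exp (-x) - Real.exp (-y) ≤ y - x := fun x y hx hy => by
    have e : Real.exp (-y) = Real.exp (-x) * Real.exp (-(y - x)) := by
      rw [← Real.exp_add]; ring_nf
    have h1 := Real.one_sub_le_exp_neg (y - x)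
    have h2 : Real.exp (-x) ≤ 1 := Real.exp_le_one_iff.2 (neg_nonpos.2 hx)
    have h3 := Real.exp_pos (-x)
    rw [e]
    nlinarith
  have hint : ∀ a b, IntervalIntegrable ((Ioi 0).indicator k) volume a b := fun a b =>
    intervalIntegrable_iff.2 (((locallyIntegrable_indicator_rate hk h0 hM).integrableOn_isCompact
      isCompact_uIcc).mono_set uIoc_subset_uIcc)
  have hdiff : ∀ s t : ℝ, |(∫ r in (0 : ℝ)..t, (Ioi 0).indicator k r)
      - ∫ r in (0 : ℝ)..s, (Ioi 0).indicator k r| ≤ M * |t - s| := fun s t => by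
    rw [intervalIntegral.integral_interval_sub_left (hint _ _) (hint _ _)]
    rw [← Real.norm_eq_abs]
    exact intervalIntegral.norm_integral_le_of_norm_le_const fun r _ =>
      (Real.norm_eq_abs _).trans_le (norm_indicator_rate_le h0 hM r)
  refine LipschitzWith.of_dist_le_mul fun s t => ?_
  have hM0 : 0 ≤ M := (h0 0).trans (hM 0)
  rw [Real.dist_eq, Real.dist_eq, Real.coe_toNNReal _ hM0]
  have n1 := integral_indicator_rate_nonneg h0 s
  have n2 := integral_indicator_rate_nonneg h0 t
  unfold decay
  refine le_trans ?_ (hdiff t s)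
  set A := ∫ r in (0 : ℝ)..s, (Ioi 0).indicator k r
  set B := ∫ r in (0 : ℝ)..t, (Ioi 0).indicator k r
  rcases le_total A B with h | h
  · rw [abs_of_nonneg (sub_nonneg.2 (Real.exp_le_exp.2 (neg_le_neg h))),
      abs_of_nonpos (sub_nonpos.2 h)]
    linarith [hexp A B n1 h]
  · rw [abs_of_nonpos (sub_nonpos.2 (Real.exp_le_exp.2 (neg_le_neg h))),
      abs_of_nonneg (sub_nonneg.2 h)]
    linarith [hexp B A n2 h]

lemma ae_hasDerivAt_decay (hk : Measurable k) (h0 : ∀ t, 0 ≤ k t) (hM : ∀ t, k t ≤ M) :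
    ∀ᵐ t, 0 < t → HasDerivAt (decay k) (-(k t * decay k t)) t := by
  filter_upwards [LocallyIntegrable.ae_hasDerivAt_integral
    (locallyIntegrable_indicator_rate hk h0 hM)] with t ht hpos
  have := (ht 0).neg.exp
  rw [indicator_of_mem (show t ∈ Ioi 0 from hpos)] at this
  refine this.congr_deriv ?_
  change Real.exp (-∫ s in (0 : ℝ)..t, (Ioi 0).indicator k s) * -k t = _
  rw [decay]; ring

lemma decay_antitone (hk : Measurable k) (h0 : ∀ t, 0 ≤ k t) (hM : ∀ t, k t ≤ M) {s t : ℝ}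
    (hs : 0 ≤ s) (hst : s ≤ t) : decay k t ≤ decay k s := by
  rw [decay_eq hs, decay_eq (hs.trans hst), Real.exp_le_exp, neg_le_neg_iff,
    ← intervalIntegral.integral_add_adjacent_intervals
      (intervalIntegrable_rate hk h0 hM 0 s) (intervalIntegrable_rate hk h0 hM s t)]
  linarith [intervalIntegral.integral_nonneg (μ := volume) hst fun r _ => h0 r]

end Decay

/-- The continuous function that is `1` up to time `a`, `0` from time `b` on, and affine in
between. -/
noncomputable def ramp (a b t : ℝ) : ℝ := min 1 (max 0 ((b - t) / (b - a)))

section Ramp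

variable {a b : ℝ}

lemma ramp_nonneg (t : ℝ) : 0 ≤ ramp a b t := le_min zero_le_one (le_max_left _ _)

lemma ramp_le_one (t : ℝ) : ramp a b t ≤ 1 := min_le_left _ _

lemma ramp_of_le (hab : a < b) {t : ℝ} (ht : t ≤ a) : ramp a b t = 1 := by
  have : 1 ≤ (b - t) / (b - a) := by rw [le_div_iff₀ (by linarith)]; linarith
  exact min_eq_left (this.trans (le_max_right _ _))

lemma ramp_of_ge (hab : a < b) {t : ℝ} (ht : b ≤ t) : ramp a b t = 0 := by
  have : (b - t) / (b - a) ≤ 0 := div_nonpos_of_nonpos_of_nonneg (by linarith) (by linarith)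
  rw [ramp, max_eq_left this, min_eq_right zero_le_one]

lemma lipschitzWith_ramp (hab : a < b) : LipschitzWith (Real.toNNReal (b - a)⁻¹) (ramp a b) := by
  have h : LipschitzWith (Real.toNNReal (b - a)⁻¹) fun t : ℝ => (b - t) / (b - a) := by
    refine LipschitzWith.of_dist_le_mul fun s t => le_of_eq ?_
    have hba : 0 < (b - a)⁻¹ := inv_pos.2 (by linarith)
    rw [Real.dist_eq, Real.dist_eq, Real.coe_toNNReal _ hba.le,
      show (b - s) / (b - a) - (b - t) / (b - a) = (b - a)⁻¹ * -(s - t) by ring, abs_mul, abs_neg,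
      abs_of_pos hba]
  exact (h.const_max 0).const_min 1

lemma hasDerivAt_ramp (hab : a < b) {t : ℝ} (ha : t ≠ a) (hb : t ≠ b) :
    HasDerivAt (ramp a b) ((Ioo a b).indicator (fun _ => -(b - a)⁻¹) t) t := by
  rcases lt_or_gt_of_ne ha with h | h
  · rw [indicator_of_notMem fun h' => absurd h'.1 h.not_gt]
    refine (hasDerivAt_const t (1 : ℝ)).congr_of_eventuallyEq ?_
    filter_upwards [Iio_mem_nhds h] with s hs using ramp_of_le hab (le_of_lt hs)
  rcases lt_or_gt_of_ne hb with h' | h'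
  · rw [indicator_of_mem (show t ∈ Ioo a b from ⟨h, h'⟩)]
    have h1 : HasDerivAt (fun s : ℝ => (b - s) / (b - a)) (-(b - a)⁻¹) t := by
      have := ((hasDerivAt_id t).const_sub b).div_const (b - a)
      simpa [div_eq_mul_inv] using this
    refine h1.congr_of_eventuallyEq ?_
    filter_upwards [Ioo_mem_nhds h h'] with s hs
    have e1 : 0 ≤ (b - s) / (b - a) := div_nonneg (by linarith [hs.2]) (by linarith)
    have e2 : (b - s) / (b - a) ≤ 1 := by rw [div_le_one (by linarith)]; linarith [hs.1]
    rw [ramp, max_eq_right e1, min_eq_right e2]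
  · rw [indicator_of_notMem fun hh => absurd hh.2 h'.not_gt]
    refine (hasDerivAt_const t (0 : ℝ)).congr_of_eventuallyEq ?_
    filter_upwards [Ioi_mem_nhds h'] with s hs using ramp_of_ge hab (le_of_lt hs)

end Ramp

/-- A space cutoff that, for nonnegative times, does not increase along lines of speed at most
`s`. -/
structure IsCutoff (Λ : Domain) (s : ℝ) (ζ : ℝ × ℝ → ℝ) : Prop where
  lipschitz : ∃ K, LipschitzWith K ζ
  nonneg : ∀ p, 0 ≤ ζ p
  le_one : ∀ p, ζ p ≤ 1
  on_domain : ∀ t, Λ.IsFunctionOn fun x => ζ (t, x)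
  support : Λ.HasBoundedSupport fun t x => ζ (t, x)
  antitone : ∀ p : ℝ × ℝ, 0 ≤ p.1 → ∀ h : ℝ, 0 ≤ h → ∀ σ : ℝ, |σ| ≤ s → ζ (p + h • ((1, σ) : ℝ × ℝ)) ≤ ζ p

lemma IsCutoff.fderiv_le {Λ : Domain} {s : ℝ} {ζ : ℝ × ℝ → ℝ} (h : IsCutoff Λ s ζ) {p : ℝ × ℝ}
    (hp : 0 ≤ p.1) (hd : DifferentiableAt ℝ ζ p) {σ : ℝ} (hσ : |σ| ≤ s) :
    fderiv ℝ ζ p (1, 0) + σ * fderiv ℝ ζ p (0, 1) ≤ 0 := by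
  have e : fderiv ℝ ζ p (1, σ) = fderiv ℝ ζ p (1, 0) + σ * fderiv ℝ ζ p (0, 1) := by
    rw [← smul_eq_mul, ← map_smul, ← map_add]; simp
  rw [← e]
  have h1 : HasDerivAt (fun r : ℝ => ζ (p + r • ((1, σ) : ℝ × ℝ))) (fderiv ℝ ζ p (1, σ)) 0 := by
    have hl : HasDerivAt (fun r : ℝ => p + r • ((1, σ) : ℝ × ℝ)) ((1, σ) : ℝ × ℝ) 0 := by
      simpa using ((hasDerivAt_id (0 : ℝ)).smul_const ((1, σ) : ℝ × ℝ)).const_add p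
    have hd' : HasFDerivAt ζ (fderiv ℝ ζ p) (p + (0 : ℝ) • ((1, σ) : ℝ × ℝ)) := by
      simpa using hd.hasFDerivAt
    exact hd'.comp_hasDerivAt 0 hl
  have h2 := (hasDerivAt_iff_tendsto_slope_zero.1 h1).mono_left
    (nhdsWithin_mono 0 (fun r (hr : r ∈ Ioi (0 : ℝ)) => ne_of_gt hr))
  refine le_of_tendsto h2 ?_
  filter_upwards [self_mem_nhdsWithin] with r hr
  have := h.antitone p hp r (le_of_lt hr) σ hσ
  simp only [zero_add, zero_smul, add_zero, smul_eq_mul]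
  exact mul_nonpos_of_nonneg_of_nonpos (inv_nonneg.2 (le_of_lt hr)) (sub_nonpos.2 this)

lemma isCutoff_one (s : ℝ) : IsCutoff Domain.periodic s fun _ => 1 where
  lipschitz := ⟨0, LipschitzWith.const 1⟩
  nonneg _ := zero_le_one
  le_one _ := le_rfl
  on_domain _ _ := rfl
  support := trivial
  antitone _ _ _ _ _ _ := le_rfl

/-- The cutoff to a backward cone with lateral speed `s`, for problems on the line. Negative times
are treated as `0`, which makes the support bounded in space uniformly in time. -/
noncomputable def cone (s T R : ℝ) (p : ℝ × ℝ) : ℝ :=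
  min 1 (max 0 (R + s * (T - max p.1 0) - |p.2|))

lemma cone_eq_zero {s T R : ℝ} (hs : 0 ≤ s) {p : ℝ × ℝ} (hx : R + s * T ≤ |p.2|) :
    cone s T R p = 0 := by
  have : R + s * (T - max p.1 0) - |p.2| ≤ 0 := by
    nlinarith [mul_nonneg hs (le_max_right p.1 0)]
  rw [cone, max_eq_left this, min_eq_right zero_le_one]

lemma isCutoff_cone {s : ℝ} (hs : 0 ≤ s) (T R : ℝ) : IsCutoff Domain.line s (cone s T R) where
  lipschitz := by
    have h : LipschitzWith (s.toNNReal + 1)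
        fun p : ℝ × ℝ => R + s * (T - max p.1 0) - |p.2| := by
      refine LipschitzWith.of_dist_le_mul fun p p' => ?_
      rw [Real.dist_eq, NNReal.coe_add, Real.coe_toNNReal _ hs, NNReal.coe_one, add_mul, one_mul]
      have e : R + s * (T - max p.1 0) - |p.2| - (R + s * (T - max p'.1 0) - |p'.2|)
          = s * (max p'.1 0 - max p.1 0) + (|p'.2| - |p.2|) := by ring
      rw [e, dist_comm]
      refine (abs_add_le _ _).trans (add_le_add ?_ ?_)
      · rw [abs_mul, abs_of_nonneg hs]
        refine mul_le_mul_of_nonneg_left ((abs_max_sub_max_le_abs _ _ _).trans ?_) hs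
        simp [Real.dist_eq, Prod.dist_eq]
      · refine (abs_abs_sub_abs_le_abs_sub _ _).trans ?_
        simp [Real.dist_eq, Prod.dist_eq]
    exact ⟨_, (h.const_max 0).const_min 1⟩
  nonneg _ := le_min zero_le_one (le_max_left _ _)
  le_one _ := min_le_left _ _
  on_domain _ := trivial
  support := ⟨R + s * T, fun _ _ hx => cone_eq_zero hs hx⟩
  antitone p hp h hh σ hσ := by
    refine min_le_min_left _ (max_le_max_left _ ?_)
    simp only [Prod.fst_add, Prod.snd_add, Prod.smul_mk, smul_eq_mul, mul_one]
    rw [max_eq_left hp, max_eq_left (add_nonneg hp hh)]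
    have h1 : |p.2| ≤ |p.2 + h * σ| + h * |σ| := by
      have := abs_sub_abs_le_abs_sub p.2 (-(h * σ))
      rw [sub_neg_eq_add, abs_neg, abs_mul, abs_of_nonneg hh] at this
      linarith
    nlinarith [mul_le_mul_of_nonneg_left hσ hh]

lemma cone_eq_one {s T R : ℝ} (hs : 0 ≤ s) {p : ℝ × ℝ} (h0 : 0 ≤ p.1) (ht : p.1 ≤ T)
    (hx : |p.2| ≤ R - 1) : cone s T R p = 1 := by
  have : 1 ≤ R + s * (T - max p.1 0) - |p.2| := by
    rw [max_eq_left h0]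
    nlinarith [mul_nonneg hs (sub_nonneg.2 ht)]
  exact min_eq_left (this.trans (le_max_right _ _))

/-! ### The localized stability estimate -/

section Weight

variable {Λ : Domain} {T a b s M : ℝ} {k : ℝ → ℝ} {ζ : ℝ × ℝ → ℝ}

/-- The test function of the Gronwall argument: a cutoff in time between `a` and `b`, the Gronwall
factor, and a cutoff in space. -/
noncomputable def weight (a b : ℝ) (k : ℝ → ℝ) (ζ : ℝ × ℝ → ℝ) (p : ℝ × ℝ) : ℝ :=
  ramp a b p.1 * decay k p.1 * ζ p

lemma time_weight_mem (h0 : ∀ t, 0 ≤ k t) (t : ℝ) :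
    0 ≤ ramp a b t * decay k t ∧ ramp a b t * decay k t ≤ 1 :=
  ⟨mul_nonneg (ramp_nonneg t) (decay_pos t).le,
    mul_le_one₀ (ramp_le_one t) (decay_pos t).le (decay_le_one h0 t)⟩

/-- The time factors are bounded and Lipschitz on the whole real line, `decay k` because `k` is
cut off to positive times. -/
lemma isLipschitzTest_weight (hab : a < b) (hb : b < T) (hk : Measurable k) (h0 : ∀ t, 0 ≤ k t)
    (hM : ∀ t, k t ≤ M) (hζ : IsCutoff Λ s ζ) : IsLipschitzTest Λ T (weight a b k ζ) := by
  have hw := time_weight_mem (a := a) (b := b) h0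
  have abs1 : ∀ {r : ℝ}, 0 ≤ r ∧ r ≤ 1 → |r| ≤ 1 := fun hr => by rw [abs_of_nonneg hr.1]; exact hr.2
  have l1 := lipschitzWith_mul (lipschitzWith_ramp hab) (lipschitzWith_decay hk h0 hM)
    (fun t => abs1 ⟨ramp_nonneg t, ramp_le_one t⟩) (fun t => abs1 ⟨(decay_pos t).le, decay_le_one h0 t⟩)
  obtain ⟨K, hK⟩ := hζ.lipschitz
  refine ⟨⟨_, lipschitzWith_mul (l1.comp LipschitzWith.prod_fst) hK (fun p => abs1 (hw p.1))
    fun p => abs1 ⟨hζ.nonneg p, hζ.le_one p⟩⟩, ⟨1, fun p => ?_⟩, fun t => ?_, ⟨b, hb, ?_⟩, ?_⟩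
  · rw [weight, norm_mul]
    exact mul_le_one₀ (abs1 (hw p.1)) (norm_nonneg _) (abs1 ⟨hζ.nonneg p, hζ.le_one p⟩)
  · have := hζ.on_domain t
    cases Λ
    · trivial
    · intro x
      have e : ζ (t, x + 1) = ζ (t, x) := this x
      simp only [weight, e]
  · intro t x ht
    simp [weight, ramp_of_ge hab ht]
  · have := hζ.support
    cases Λ
    · obtain ⟨R, hR⟩ := this
      exact ⟨R, fun t x hx => by simp [weight, hR t x hx]⟩
    · trivial

lemma fderiv_weight {p : ℝ × ℝ} {χ' E' : ℝ} (h1 : HasDerivAt (ramp a b) χ' p.1)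
    (h2 : HasDerivAt (decay k) E' p.1) (h3 : DifferentiableAt ℝ ζ p) :
    fderiv ℝ (weight a b k ζ) p (1, 0) = (χ' * decay k p.1 + ramp a b p.1 * E') * ζ p
      + ramp a b p.1 * decay k p.1 * fderiv ℝ ζ p (1, 0) ∧
    fderiv ℝ (weight a b k ζ) p (0, 1)
      = ramp a b p.1 * decay k p.1 * fderiv ℝ ζ p (0, 1) := by
  have h12 := (h1.mul h2).comp_hasFDerivAt p (hasFDerivAt_fst (𝕜 := ℝ) (p := p))
  have h := (h12.mul h3.hasFDerivAt).fderiv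
  have e : fderiv ℝ (weight a b k ζ) p = _ := h
  constructor
  · rw [e]; simp; ring
  · rw [e]; simp

end Weight

lemma integrableOn_of_bounded {Λ : Domain} {T R D : ℝ} {f : ℝ × ℝ → ℝ}
    (hm : AEStronglyMeasurable f (volume.restrict (Ioo 0 T ×ˢ Λ.cell)))
    (hD : ∀ᵐ p ∂(volume.restrict (Ioo 0 T ×ˢ Λ.cell)), ‖f p‖ ≤ D)
    (hR : ∀ p : ℝ × ℝ, p.2 ∈ Λ.cell → R < |p.2| → f p = 0) :
    IntegrableOn f (Ioo 0 T ×ˢ Λ.cell) := by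
  refine (integrable_boxBound T R D Λ).mono' hm ?_
  filter_upwards [hD, ae_restrict_mem (measurableSet_Ioo.prod Λ.measurableSet_cell)] with p h1 hp
  by_cases hpR : R < |p.2|
  · rw [hR p hp.2 hpR, norm_zero]
    exact indicator_nonneg (fun _ _ => (norm_nonneg _).trans h1) _
  · have hm : p ∈ Icc 0 T ×ˢ Icc (-R) R :=
      ⟨Ioo_subset_Icc_self hp.1, abs_le.1 (not_lt.1 hpR)⟩
    rwa [indicator_of_mem hm]

namespace EntropyComparison

variable {m : ℕ} {Λ : Domain} {T : ℝ} {U C : Set (State m)} {F : State m → State m}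
  {η q : State m → ℝ} {CF lo up : ℝ} {u₀ : ℝ → State m} {u : ℝ → ℝ → State m}
  {v : ℝ × ℝ → State m} {s M a b : ℝ} {k : ℝ → ℝ} {ζ : ℝ × ℝ → ℝ}

/-- The residual `∂ₜ v + DF(v) ∂ₓ v`. -/
noncomputable def residual (F : State m → State m) (v : ℝ × ℝ → State m) (p : ℝ × ℝ) : State m :=
  fderiv ℝ v p (1, 0) + fderiv ℝ F (v p) (fderiv ℝ v p (0, 1))

/-- The pointwise Gronwall argument: the derivative of the Gronwall factor cancels the part of the
source proportional to the relative entropy, and the cutoff in time produces the term on `(a,b)`. -/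
lemma balanceDensity_le (h : EntropyComparison Λ T U C F η q CF lo up u₀ u v)
    (hs : ∀ u ∈ C, ∀ v ∈ C, |relFlux F η q u v| ≤ s * bregman η u v) (hζ : IsCutoff Λ s ζ)
    (hk : Measurable k) (h0 : ∀ t, 0 ≤ k t) (hM : ∀ t, k t ≤ M) (hab : a < b)
    {p : ℝ × ℝ} (hp : 0 < p.1) (hup : u p.1 p.2 ∈ C)
    (hkp : (up * CF * ‖fderiv ℝ v p (0, 1)‖ + up ^ 2) / lo ≤ k p.1)
    (hζd : DifferentiableAt ℝ ζ p) (hE : HasDerivAt (decay k) (-(k p.1 * decay k p.1)) p.1)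
    (hpa : p.1 ≠ a) (hpb : p.1 ≠ b) :
    balanceDensity F η q u v (weight a b k ζ) p
      ≤ (Iio b).indicator (fun _ => 1) p.1 * ζ p * (‖residual F v p‖ ^ 2 / 2)
        - (b - a)⁻¹ * decay k b
          * ((Ioo a b).indicator (fun _ => 1) p.1 * ζ p * bregman η (u p.1 p.2) (v p)) := by
  have hB := h.relEntropy_nonneg hup (h.mem_v p)
  have hQ := hs _ hup _ (h.mem_v p)
  have hsrc := h.source_le hup (h.mem_v p) (fderiv ℝ v p (1, 0)) (fderiv ℝ v p (0, 1)) le_rfl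
  have hw := time_weight_mem (a := a) (b := b) h0 p.1
  obtain ⟨d1, d2⟩ := fderiv_weight (hasDerivAt_ramp hab hpa hpb) hE hζd
  have hζ0 := hζ.nonneg p
  set B := bregman η (u p.1 p.2) (v p)
  set Q := relFlux F η q (u p.1 p.2) (v p)
  have hpos : 0 < (b - a)⁻¹ := inv_pos.2 (by linarith)
  -- transport of the cutoff absorbs the relative entropy flux
  have htr : fderiv ℝ ζ p (1, 0) * B + fderiv ℝ ζ p (0, 1) * Q ≤ 0 := by
    rcases hB.eq_or_lt with hB0 | hBpos
    · rw [← hB0, mul_zero, abs_nonpos_iff] at hQ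
      rw [← hB0, hQ]; simp
    · have hσ : |Q / B| ≤ s := by rw [abs_div, abs_of_pos hBpos, div_le_iff₀ hBpos]; exact hQ
      have := mul_nonpos_of_nonpos_of_nonneg (hζ.fderiv_le hp.le hζd hσ) hB
      have e : (fderiv ℝ ζ p (1, 0) + Q / B * fderiv ℝ ζ p (0, 1)) * B
        = fderiv ℝ ζ p (1, 0) * B + fderiv ℝ ζ p (0, 1) * Q := by field_simp
      linarith
  have hsrc' : -(fderiv ℝ (fderiv ℝ η) (v p) (fderiv ℝ v p (1, 0)) (u p.1 p.2 - v p)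
      + fderiv ℝ (fderiv ℝ η) (v p) (fderiv ℝ v p (0, 1)) (F (u p.1 p.2) - F (v p)))
      ≤ ‖residual F v p‖ ^ 2 / 2 + k p.1 * B :=
    hsrc.trans (add_le_add le_rfl (mul_le_mul_of_nonneg_right hkp hB))
  rw [balanceDensity, d1, d2]
  set S := fderiv ℝ (fderiv ℝ η) (v p) (fderiv ℝ v p (1, 0)) (u p.1 p.2 - v p)
      + fderiv ℝ (fderiv ℝ η) (v p) (fderiv ℝ v p (0, 1)) (F (u p.1 p.2) - F (v p))
  set r := ‖residual F v p‖ ^ 2 / 2 with hr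
  have hr0 : 0 ≤ r := by positivity
  set θ := ramp a b p.1 * decay k p.1 with hθ
  have key : ((Ioo a b).indicator (fun _ => -(b - a)⁻¹) p.1 * decay k p.1
      + ramp a b p.1 * -(k p.1 * decay k p.1)) * ζ p * B + θ * (fderiv ℝ ζ p (1, 0) * B
      + fderiv ℝ ζ p (0, 1) * Q) - θ * ζ p * S
      ≤ (Ioo a b).indicator (fun _ => -(b - a)⁻¹) p.1 * decay k p.1 * ζ p * B + θ * ζ p * r := by
    have h1 := mul_nonpos_of_nonneg_of_nonpos hw.1 htr
    have h2 := mul_le_mul_of_nonneg_left hsrc' (mul_nonneg hw.1 hζ0)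
    have e : ramp a b p.1 * -(k p.1 * decay k p.1) = - (k p.1 * θ) := by rw [hθ]; ring
    rw [e]
    linarith
  have h3 : θ * ζ p * r ≤ (Iio b).indicator (fun _ => 1) p.1 * ζ p * r := by
    gcongr
    by_cases hb : p.1 < b
    · rw [indicator_of_mem (show p.1 ∈ Iio b from hb)]; exact hw.2
    · rw [indicator_of_notMem (show p.1 ∉ Iio b from hb), hθ, ramp_of_ge hab (not_lt.1 hb), zero_mul]
  have h4 : (Ioo a b).indicator (fun _ => -(b - a)⁻¹) p.1 * decay k p.1 * ζ p * B
      ≤ -((b - a)⁻¹ * decay k b * ((Ioo a b).indicator (fun _ => 1) p.1 * ζ p * B)) := by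
    by_cases hmem : p.1 ∈ Ioo a b
    · rw [indicator_of_mem hmem, indicator_of_mem hmem]
      have h5 := decay_antitone hk h0 hM hp.le hmem.2.le
      have h6 := mul_le_mul_of_nonneg_left h5
        (mul_nonneg hpos.le (mul_nonneg hζ0 hB))
      linarith
    · rw [indicator_of_notMem hmem, indicator_of_notMem hmem]; simp
  have e : (((Ioo a b).indicator (fun _ => -(b - a)⁻¹) p.1 * decay k p.1
      + ramp a b p.1 * -(k p.1 * decay k p.1)) * ζ p + θ * fderiv ℝ ζ p (1, 0)) * B
      + θ * fderiv ℝ ζ p (0, 1) * Q - weight a b k ζ p * S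
      = ((Ioo a b).indicator (fun _ => -(b - a)⁻¹) p.1 * decay k p.1
      + ramp a b p.1 * -(k p.1 * decay k p.1)) * ζ p * B + θ * (fderiv ℝ ζ p (1, 0) * B
      + fderiv ℝ ζ p (0, 1) * Q) - θ * ζ p * S := by rw [weight]; ring
  linarith

lemma continuousOn_bregman (h : EntropySetting U C F η q CF lo up) :
    ContinuousOn (fun z : State m × State m => bregman η z.1 z.2) (C ×ˢ C) := by
  have hηc : ContinuousOn η C := h.pair.contDiffOn_entropy.continuousOn.mono h.subset
  have hGc : ContinuousOn (fderiv ℝ η) C :=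
    (contDiffOn_fderiv h.isOpen h.pair.contDiffOn_entropy).continuousOn.mono h.subset
  have m1 : MapsTo (Prod.fst : State m × State m → State m) (C ×ˢ C) C := fun z hz => hz.1
  have m2 : MapsTo (Prod.snd : State m × State m → State m) (C ×ˢ C) C := fun z hz => hz.2
  exact ((hηc.comp continuousOn_fst m1).sub (hηc.comp continuousOn_snd m2)).sub
    ((hGc.comp continuousOn_snd m2).clm_apply (continuousOn_fst.sub continuousOn_snd))

lemma aestronglyMeasurable_relEntropy (h : EntropyComparison Λ T U C F η q CF lo up u₀ u v) :
    AEStronglyMeasurable (fun p : ℝ × ℝ => bregman η (u p.1 p.2) (v p))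
      (volume.restrict (Ioo 0 T ×ˢ Λ.cell)) := by
  obtain ⟨K, hK⟩ := h.lipschitz_v
  exact aestronglyMeasurable_comp_of_continuousOn
    (u := fun p : ℝ × ℝ => (u p.1 p.2, v p)) (h.isCompact.prod h.isCompact).isClosed
    (continuousOn_bregman h.toEntropySetting)
    (h.meas_u.prodMk hK.continuous.aestronglyMeasurable)
    (h.mem_u.mono fun p hp => ⟨hp, h.mem_v p⟩)

lemma exists_relEntropy_bound (h : EntropySetting U C F η q CF lo up) :
    ∃ D : ℝ, ∀ u ∈ C, ∀ v ∈ C, |bregman η u v| ≤ D := by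
  obtain ⟨D, hD⟩ := (h.isCompact.prod h.isCompact).exists_bound_of_continuousOn
    (continuousOn_bregman h)
  exact ⟨D, fun u hu v hv => hD (u, v) ⟨hu, hv⟩⟩

lemma exists_residual_bound (h : EntropyComparison Λ T U C F η q CF lo up u₀ u v) :
    ∃ D : ℝ, 0 ≤ D ∧ ∀ p, ‖residual F v p‖ ^ 2 ≤ D := by
  obtain ⟨K, hK⟩ := h.lipschitz_v
  obtain ⟨D, hD⟩ := IsCompact.exists_bound_of_continuousOn (E := State m →L[ℝ] State m) h.isCompact
    ((contDiffOn_fderiv h.isOpen h.contDiffOn_F).continuousOn.mono h.subset)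
  refine ⟨(K + |D| * K) ^ 2, sq_nonneg _, fun p => ?_⟩
  have hn := norm_fderiv_le_of_lipschitz ℝ hK (x₀ := p)
  gcongr
  refine (norm_add_le _ _).trans (add_le_add (norm_fderiv_apply_fst_le hn) ?_)
  refine ((fderiv ℝ F (v p)).le_opNorm _).trans ?_
  exact mul_le_mul ((hD _ (h.mem_v p)).trans (le_abs_self D)) (norm_fderiv_apply_snd_le hn)
    (norm_nonneg _) (abs_nonneg _)

lemma measurable_residual (h : EntropyComparison Λ T U C F η q CF lo up u₀ u v) :
    Measurable (residual F v) := by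
  obtain ⟨K, hK⟩ := h.lipschitz_v
  have h1 : Continuous fun p => fderiv ℝ F (v p) :=
    ((contDiffOn_fderiv h.isOpen h.contDiffOn_F).continuousOn.mono h.subset).comp_continuous
      hK.continuous h.mem_v
  have h2 : Measurable fun p => fderiv ℝ F (v p) (fderiv ℝ v p (0, 1)) := by
    have hc : Continuous fun z : (State m →L[ℝ] State m) × State m => z.1 z.2 := by fun_prop
    exact hc.measurable.comp
      (h1.measurable.prodMk (measurable_fderiv_apply_const ℝ v (0, 1)))
  exact (measurable_fderiv_apply_const ℝ v (1, 0)).add h2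

/-- Gronwall's inequality in integrated form: the weight contains the Gronwall factor, so that the
time average of the localized relative entropy over `(a,b)` is bounded by the data. -/
theorem local_estimate (h : EntropyComparison Λ T U C F η q CF lo up u₀ u v)
    (hs : ∀ u ∈ C, ∀ v ∈ C, |relFlux F η q u v| ≤ s * bregman η u v) (hζ : IsCutoff Λ s ζ)
    (hk : Measurable k) (h0 : ∀ t, 0 ≤ k t) (hM : ∀ t, k t ≤ M)
    (hkv : ∀ᵐ p ∂(volume.restrict (Ioo 0 T ×ˢ Λ.cell)),
      (up * CF * ‖fderiv ℝ v p (0, 1)‖ + up ^ 2) / lo ≤ k p.1)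
    (ha : 0 ≤ a) (hab : a < b) (hbT : b < T) :
    IntegrableOn (fun p : ℝ × ℝ => (Ioo a b).indicator (fun _ => (1 : ℝ)) p.1 * ζ p
      * bregman η (u p.1 p.2) (v p)) (Ioo 0 T ×ˢ Λ.cell) ∧
    IntegrableOn (fun p : ℝ × ℝ => (Iio b).indicator (fun _ => (1 : ℝ)) p.1 * ζ p
      * (‖residual F v p‖ ^ 2 / 2)) (Ioo 0 T ×ˢ Λ.cell) ∧
    IntegrableOn (fun x => ζ (0, x) * bregman η (u₀ x) (v (0, x))) Λ.cell ∧
    (b - a)⁻¹ * decay k b * (∫ p in Ioo 0 T ×ˢ Λ.cell,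
        (Ioo a b).indicator (fun _ => (1 : ℝ)) p.1 * ζ p * bregman η (u p.1 p.2) (v p))
      ≤ (∫ p in Ioo 0 T ×ˢ Λ.cell,
          (Iio b).indicator (fun _ => (1 : ℝ)) p.1 * ζ p * (‖residual F v p‖ ^ 2 / 2))
        + ∫ x in Λ.cell, ζ (0, x) * bregman η (u₀ x) (v (0, x)) := by
  obtain ⟨K, hK⟩ := hζ.lipschitz
  obtain ⟨R, hR⟩ := exists_support_radius hζ.support
  obtain ⟨D₁, hD₁⟩ := exists_relEntropy_bound h.toEntropySetting
  obtain ⟨D₂, hD₂0, hD₂⟩ := h.exists_residual_bound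
  obtain ⟨b1, b2, b3⟩ := h.balance (isLipschitzTest_weight hab hbT hk h0 hM hζ)
    (fun p => mul_nonneg (time_weight_mem h0 p.1).1 (hζ.nonneg p))
  have ind : ∀ (A : Set ℝ) (t : ℝ), |A.indicator (fun _ => (1 : ℝ)) t| ≤ 1 := fun A t => by
    by_cases ht : t ∈ A
    · simp [indicator_of_mem ht]
    · simp [indicator_of_notMem ht]
  have indm : ∀ {A : Set ℝ}, MeasurableSet A →
      Measurable fun p : ℝ × ℝ => A.indicator (fun _ => (1 : ℝ)) p.1 * ζ p := fun hA =>
    ((measurable_const.indicator hA).comp measurable_fst).mul hK.continuous.measurable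
  have indb : ∀ (A : Set ℝ) (p : ℝ × ℝ), |A.indicator (fun _ => (1 : ℝ)) p.1 * ζ p| ≤ 1 :=
    fun A p => by
      rw [abs_mul, abs_of_nonneg (hζ.nonneg p)]
      exact mul_le_one₀ (ind A p.1) (hζ.nonneg p) (hζ.le_one p)
  have i1 : IntegrableOn (fun p : ℝ × ℝ => (Ioo a b).indicator (fun _ => (1 : ℝ)) p.1 * ζ p
      * bregman η (u p.1 p.2) (v p)) (Ioo 0 T ×ˢ Λ.cell) := by
    refine integrableOn_of_bounded (R := R) (D := D₁)
      ((indm measurableSet_Ioo).aestronglyMeasurable.mul h.aestronglyMeasurable_relEntropy) ?_ ?_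
    · filter_upwards [h.mem_u] with p hp
      rw [norm_mul]
      have := hD₁ _ hp _ (h.mem_v p)
      exact (mul_le_mul (indb _ p) this (abs_nonneg _) zero_le_one).trans_eq (one_mul _)
    · intro p hp hpR
      simp [(hR p hp hpR).1]
  have i2 : IntegrableOn (fun p : ℝ × ℝ => (Iio b).indicator (fun _ => (1 : ℝ)) p.1 * ζ p
      * (‖residual F v p‖ ^ 2 / 2)) (Ioo 0 T ×ˢ Λ.cell) := by
    refine integrableOn_of_bounded (R := R) (D := D₂)
      ((indm measurableSet_Iio).mul
        ((h.measurable_residual.norm.pow_const 2).div_const 2)).aestronglyMeasurable ?_ ?_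
    · refine Eventually.of_forall fun p => ?_
      rw [norm_mul]
      have h1 := hD₂ p
      have h2 : ‖‖residual F v p‖ ^ 2 / 2‖ ≤ D₂ := by
        rw [Real.norm_of_nonneg (by positivity)]; linarith [sq_nonneg ‖residual F v p‖]
      exact (mul_le_mul (indb _ p) h2 (norm_nonneg _) zero_le_one).trans_eq (one_mul _)
    · intro p hp hpR
      simp [(hR p hp hpR).1]
  have hw0 : ∀ x, weight a b k ζ (0, x) = ζ (0, x) := fun x => by
    simp [weight, ramp_of_le hab ha, decay_zero]
  simp only [hw0] at b2 b3
  refine ⟨i1, i2, b2, ?_⟩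
  have hle : ∫ p in Ioo 0 T ×ˢ Λ.cell, balanceDensity F η q u v (weight a b k ζ) p
      ≤ ∫ p in Ioo 0 T ×ˢ Λ.cell,
        ((Iio b).indicator (fun _ => (1 : ℝ)) p.1 * ζ p * (‖residual F v p‖ ^ 2 / 2)
        - (b - a)⁻¹ * decay k b
          * ((Ioo a b).indicator (fun _ => (1 : ℝ)) p.1 * ζ p * bregman η (u p.1 p.2) (v p))) := by
    refine integral_mono_ae b1 (i2.sub (i1.const_mul _)) ?_
    have fstae : ∀ {P : ℝ → Prop}, (∀ᵐ t, P t) → ∀ᵐ p : ℝ × ℝ, P p.1 := fun hP =>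
      Measure.quasiMeasurePreserving_fst.ae hP
    filter_upwards [h.mem_u, hkv, ae_restrict_mem (measurableSet_Ioo.prod Λ.measurableSet_cell),
      ae_restrict_of_ae hK.ae_differentiableAt,
      ae_restrict_of_ae (fstae (ae_hasDerivAt_decay hk h0 hM)),
      ae_restrict_of_ae (fstae (P := fun t => t ≠ a) (by simp [ae_iff])),
      ae_restrict_of_ae (fstae (P := fun t => t ≠ b) (by simp [ae_iff]))]
      with p hu hkp hp hd hE hpa hpb
    exact h.balanceDensity_le hs hζ hk h0 hM hab hp.1.1 hu hkp hd (hE hp.1.1) hpa hpb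
  rw [integral_sub i2 (i1.const_mul _), integral_const_mul] at hle
  linarith

end EntropyComparison

/-! ### Weak lower semicontinuity of the square norm -/

section WeakLimit

variable {V : Type*} [NormedAddCommGroup V] [NormedSpace ℝ V]

/-- Jensen's inequality for the square of a norm. -/
lemma enorm_integral_smul_sq_le {ρ : ℝ → ℝ} (hρ : Measurable ρ) (hρ0 : ∀ x, 0 ≤ ρ x)
    (hρ1 : ∫⁻ x, ENNReal.ofReal (ρ x) = 1) {f : ℝ → V}
    (hf : AEStronglyMeasurable f volume) :
    ‖∫ x, ρ x • f x‖ₑ ^ 2 ≤ ∫⁻ x, ENNReal.ofReal (ρ x) * ‖f x‖ₑ ^ 2 := by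
  set ν : Measure ℝ := volume.withDensity fun x => ENNReal.ofReal (ρ x) with hν
  have hprob : IsProbabilityMeasure ν := ⟨by
    rw [hν, withDensity_apply _ MeasurableSet.univ, Measure.restrict_univ, hρ1]⟩
  have hfν : AEStronglyMeasurable f ν := hf.mono_ac (withDensity_absolutelyContinuous _ _)
  have hd : ∀ g : ℝ → ℝ≥0∞, AEMeasurable g volume →
      ∫⁻ x, g x ∂ν = ∫⁻ x, ENNReal.ofReal (ρ x) * g x := fun g hg => by
    rw [hν, lintegral_withDensity_eq_lintegral_mul₀ hρ.ennreal_ofReal.aemeasurable hg]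
    rfl
  have h1 : ‖∫ x, ρ x • f x‖ₑ ≤ eLpNorm f 1 ν := by
    rw [eLpNorm_one_eq_lintegral_enorm, hd _ hf.enorm]
    refine (enorm_integral_le_lintegral_enorm _).trans (le_of_eq ?_)
    refine lintegral_congr fun x => ?_
    rw [enorm_smul, Real.enorm_of_nonneg (hρ0 x)]
  have h2 : eLpNorm f 1 ν ≤ eLpNorm f 2 ν :=
    eLpNorm_le_eLpNorm_of_exponent_le (by norm_num) hfν
  have h3 : eLpNorm f 2 ν ^ 2 = ∫⁻ x, ENNReal.ofReal (ρ x) * ‖f x‖ₑ ^ 2 := by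
    rw [← hd _ (hf.enorm.pow_const 2)]
    have := eLpNorm_nnreal_pow_eq_lintegral (μ := ν) (f := f) (p := 2) (by norm_num)
    simpa using this
  rw [← h3]
  gcongr
  exact h1.trans h2

/-- Mollifiers on the line with support radius `1 / (i + 1)`, and a fixed ratio of the radii. -/
noncomputable def lineBump (i : ℕ) : ContDiffBump (0 : ℝ) where
  rIn := 1 / ((i : ℝ) + 1) / 2
  rOut := 1 / ((i : ℝ) + 1)
  rIn_pos := by positivity
  rIn_lt_rOut := half_lt_self (by positivity)

lemma lintegral_bump_eq_one (b : ContDiffBump (0 : ℝ)) :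
    ∫⁻ x, ENNReal.ofReal (b.normed volume x) = 1 := by
  rw [← ofReal_integral_eq_lintegral_ofReal b.integrable_normed
    (Eventually.of_forall fun x => b.nonneg_normed x), b.integral_normed, ENNReal.ofReal_one]

open scoped Convolution in
/-- Mollification does not increase local `L²` norms, up to the loss of the mollification radius at
the ends of the interval. -/
lemma lintegral_convolution_sq_le {b : ContDiffBump (0 : ℝ)} {α β : ℝ} {f : ℝ → V}
    (hf : AEStronglyMeasurable f volume) :
    ∫⁻ x in Ioo (α + b.rOut) (β - b.rOut),
        ‖(b.normed volume ⋆[ContinuousLinearMap.lsmul ℝ ℝ, volume] f) x‖ₑ ^ 2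
      ≤ ∫⁻ y in Ioo α β, ‖f y‖ₑ ^ 2 := by
  set ρ : ℝ → ℝ := b.normed volume with hρ
  have hρc : Continuous ρ := b.continuous_normed
  have hsupp : ∀ x ∈ Ioo (α + b.rOut) (β - b.rOut), ∀ y, y ∉ Ioo α β → ρ (x - y) = 0 := by
    intro x hx y hy
    by_contra hne
    have : x - y ∈ Function.support ρ := hne
    rw [hρ, b.support_normed_eq, mem_ball_zero_iff, Real.norm_eq_abs, abs_lt] at this
    exact hy ⟨by linarith [hx.1, this.2], by linarith [hx.2, this.1]⟩
  have h1 : ∀ x ∈ Ioo (α + b.rOut) (β - b.rOut),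
      ‖(ρ ⋆[ContinuousLinearMap.lsmul ℝ ℝ, volume] f) x‖ₑ ^ 2
        ≤ ∫⁻ y in Ioo α β, ENNReal.ofReal (ρ (x - y)) * ‖f y‖ₑ ^ 2 := by
    intro x hx
    rw [convolution_eq_swap]
    have hone : ∫⁻ y, ENNReal.ofReal (ρ (x - y)) = 1 := by
      rw [lintegral_sub_left_eq_self (fun y => ENNReal.ofReal (ρ y)) x]
      exact lintegral_bump_eq_one b
    refine (enorm_integral_smul_sq_le (hρc.comp (continuous_const.sub continuous_id)).measurable
      (fun y => b.nonneg_normed _) hone hf).trans ?_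
    rw [← lintegral_indicator measurableSet_Ioo]
    refine lintegral_mono fun y => ?_
    by_cases hy : y ∈ Ioo α β
    · rw [indicator_of_mem hy]; rfl
    · change ENNReal.ofReal (ρ (x - y)) * _ ≤ _
      rw [hsupp x hx y hy, ENNReal.ofReal_zero, zero_mul]
      exact zero_le
  calc _ ≤ ∫⁻ x in Ioo (α + b.rOut) (β - b.rOut),
        ∫⁻ y in Ioo α β, ENNReal.ofReal (ρ (x - y)) * ‖f y‖ₑ ^ 2 :=
        setLIntegral_mono' measurableSet_Ioo h1
    _ ≤ ∫⁻ x, ∫⁻ y in Ioo α β, ENNReal.ofReal (ρ (x - y)) * ‖f y‖ₑ ^ 2 :=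
        lintegral_mono' Measure.restrict_le_self le_rfl
    _ = ∫⁻ y in Ioo α β, ∫⁻ x, ENNReal.ofReal (ρ (x - y)) * ‖f y‖ₑ ^ 2 := by
        refine lintegral_lintegral_swap ?_
        have m1 : AEMeasurable (fun z : ℝ × ℝ => ENNReal.ofReal (ρ (z.1 - z.2)))
            (volume.prod (volume.restrict (Ioo α β))) :=
          (ENNReal.continuous_ofReal.comp
            (hρc.comp (continuous_fst.sub continuous_snd))).aemeasurable
        have m2 : AEMeasurable (fun z : ℝ × ℝ => ‖f z.2‖ₑ ^ 2)
            (volume.prod (volume.restrict (Ioo α β))) :=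
          (hf.restrict.enorm.pow_const 2).comp_quasiMeasurePreserving
            Measure.quasiMeasurePreserving_snd
        exact m1.mul m2
    _ = ∫⁻ y in Ioo α β, ‖f y‖ₑ ^ 2 := by
        refine lintegral_congr fun y => ?_
        rw [lintegral_mul_const _ (by fun_prop),
          lintegral_sub_right_eq_self (fun x => ENNReal.ofReal (ρ x)) y, lintegral_bump_eq_one,
          one_mul]

open scoped Convolution in
/-- A distributional limit inherits local `L²` bounds: bound its mollifications, which are
pointwise limits, by Fatou's lemma, and remove the mollification by Fatou's lemma again. -/
lemma lintegral_sq_le_of_weak_limit [CompleteSpace V] {f : ℕ → ℝ → V} {g : ℝ → V} {α β : ℝ}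
    (hf : ∀ j, LocallyIntegrable (f j)) (hg : LocallyIntegrable g)
    (hw : ∀ ψ : ℝ → ℝ, ContDiff ℝ ∞ ψ → HasCompactSupport ψ →
      Tendsto (fun j => ∫ x, ψ x • f j x) atTop (𝓝 (∫ x, ψ x • g x)))
    {M : ℕ → ℝ≥0∞} {M' : ℝ≥0∞} (hM : ∀ j, ∫⁻ x in Ioo α β, ‖f j x‖ₑ ^ 2 ≤ M j)
    (hMt : Tendsto M atTop (𝓝 M')) : ∫⁻ x in Ioo α β, ‖g x‖ₑ ^ 2 ≤ M' := by
  borelize V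
  set ρ : ℕ → ℝ → ℝ := fun i => (lineBump i).normed volume with hρ
  set G : (ℝ → V) → ℕ → ℝ → V := fun h i =>
    ρ i ⋆[ContinuousLinearMap.lsmul ℝ ℝ, volume] h with hG
  have hGc : ∀ h : ℝ → V, LocallyIntegrable h → ∀ i, Continuous (G h i) := fun h hh i =>
    ((lineBump i).hasCompactSupport_normed.contDiff_convolution_left (n := 0) _
      (lineBump i).contDiff_normed hh).continuous
  set J : ℕ → Set ℝ := fun i => Ioo (α + (lineBump i).rOut) (β - (lineBump i).rOut) with hJ
  have hr : Tendsto (fun i => (lineBump i).rOut) atTop (𝓝 0) :=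
    tendsto_one_div_add_atTop_nhds_zero_nat (𝕜 := ℝ)
  have hmoll : ∀ i, ∫⁻ x in J i, ‖G g i x‖ₑ ^ 2 ≤ M' := by
    intro i
    have hlim : ∀ x, Tendsto (fun j => ‖G (f j) i x‖ₑ ^ 2) atTop (𝓝 (‖G g i x‖ₑ ^ 2)) := by
      intro x
      have h1 := hw (fun y => ρ i (x - y))
        ((lineBump i).contDiff_normed.comp (contDiff_const.sub contDiff_id))
        ((lineBump i).hasCompactSupport_normed.comp_homeomorph (Homeomorph.subLeft x))
      have h2 : Tendsto (fun j => G (f j) i x) atTop (𝓝 (G g i x)) := by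
        simpa only [hG, convolution_eq_swap, ContinuousLinearMap.lsmul_apply] using h1
      exact ((ENNReal.continuous_pow 2).tendsto _).comp h2.enorm
    calc ∫⁻ x in J i, ‖G g i x‖ₑ ^ 2
        = ∫⁻ x in J i, liminf (fun j => ‖G (f j) i x‖ₑ ^ 2) atTop :=
          lintegral_congr fun x => (hlim x).liminf_eq.symm
      _ ≤ liminf (fun j => ∫⁻ x in J i, ‖G (f j) i x‖ₑ ^ 2) atTop :=
          lintegral_liminf_le fun j => ((hGc _ (hf j) i).enorm.measurable.pow_const 2)
      _ ≤ liminf M atTop := liminf_le_liminf (Eventually.of_forall fun j =>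
          (lintegral_convolution_sq_le (hf j).aestronglyMeasurable).trans (hM j))
      _ = M' := hMt.liminf_eq
  have hae : ∀ᵐ x, Tendsto (fun i => G g i x) atTop (𝓝 (g x)) :=
    ContDiffBump.ae_convolution_tendsto_right_of_locallyIntegrable (K := 2) hr
      (Eventually.of_forall fun i => by
        show 1 / ((i : ℝ) + 1) ≤ 2 * (1 / ((i : ℝ) + 1) / 2); linarith) hg
  have hlim : ∀ᵐ x, (Ioo α β).indicator (fun x => ‖g x‖ₑ ^ 2) x
      ≤ liminf (fun i => (J i).indicator (fun x => ‖G g i x‖ₑ ^ 2) x) atTop := by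
    filter_upwards [hae] with x hx
    by_cases hmem : x ∈ Ioo α β
    · rw [indicator_of_mem hmem]
      have h1 : Tendsto (fun i => ‖G g i x‖ₑ ^ 2) atTop (𝓝 (‖g x‖ₑ ^ 2)) :=
        ((ENNReal.continuous_pow 2).tendsto _).comp hx.enorm
      refine (h1.congr' ?_).liminf_eq.ge
      have e1 : ∀ᶠ i in atTop, (lineBump i).rOut < x - α :=
        hr.eventually_lt_const (by linarith [hmem.1])
      have e2 : ∀ᶠ i in atTop, (lineBump i).rOut < β - x :=
        hr.eventually_lt_const (by linarith [hmem.2])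
      filter_upwards [e1, e2] with i h1 h2
      rw [indicator_of_mem (show x ∈ J i from ⟨by linarith, by linarith⟩)]
    · rw [indicator_of_notMem hmem]; exact zero_le
  calc ∫⁻ x in Ioo α β, ‖g x‖ₑ ^ 2
      = ∫⁻ x, (Ioo α β).indicator (fun x => ‖g x‖ₑ ^ 2) x :=
        (lintegral_indicator measurableSet_Ioo _).symm
    _ ≤ ∫⁻ x, liminf (fun i => (J i).indicator (fun x => ‖G g i x‖ₑ ^ 2) x) atTop :=
        lintegral_mono_ae hlim
    _ ≤ liminf (fun i => ∫⁻ x, (J i).indicator (fun x => ‖G g i x‖ₑ ^ 2) x) atTop :=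
        lintegral_liminf_le fun i =>
          ((hGc _ hg i).enorm.measurable.pow_const 2).indicator measurableSet_Ioo
    _ ≤ M' := by
        refine liminf_le_of_le (by isBoundedDefault) fun c hc => ?_
        obtain ⟨i, hi⟩ := hc.exists
        refine hi.trans ?_
        rw [lintegral_indicator measurableSet_Ioo]
        exact hmoll i

end WeakLimit

/-! ### The stability estimate at a fixed time -/

lemma ofReal_norm_sq {V : Type*} [NormedAddCommGroup V] (w : V) :
    ENNReal.ofReal (‖w‖ ^ 2) = ‖w‖ₑ ^ 2 := by
  rw [ENNReal.ofReal_pow (norm_nonneg _), ofReal_norm]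

/-- On a nonempty interval an integrable function does not exceed its mean at some point that may
be chosen outside a null set. -/
lemma exists_le_mean {a b : ℝ} (hab : a < b) {g : ℝ → ℝ} (hg : IntegrableOn g (Ioo a b))
    {P : ℝ → Prop} (hP : ∀ᵐ t ∂(volume.restrict (Ioo a b)), P t) :
    ∃ t ∈ Ioo a b, P t ∧ g t ≤ (b - a)⁻¹ * ∫ s in Ioo a b, g s := by
  have hne : volume.restrict (Ioo a b) ≠ 0 := by
    rw [Ne, Measure.restrict_eq_zero, Real.volume_Ioo]
    simpa using hab
  have hN : ∀ᵐ t ∂(volume.restrict (Ioo a b)), P t ∧ t ∈ Ioo a b :=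
    hP.and (ae_restrict_mem measurableSet_Ioo)
  obtain ⟨t, ht, hle⟩ := exists_notMem_null_le_average hne hg (ae_iff.1 hN)
  have ht' : P t ∧ t ∈ Ioo a b := not_not.1 ht
  refine ⟨t, ht'.2, ht'.1, hle.trans_eq ?_⟩
  rw [setAverage_eq, smul_eq_mul]
  simp [Measure.real, Real.volume_Ioo, hab.le]

namespace EntropyComparison

variable {m : ℕ} {Λ : Domain} {T : ℝ} {U C : Set (State m)} {F : State m → State m}
  {η q : State m → ℝ} {CF lo up : ℝ} {u₀ : ℝ → State m} {u : ℝ → ℝ → State m}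
  {v : ℝ × ℝ → State m} {s M a b : ℝ} {k : ℝ → ℝ} {ζ : ℝ × ℝ → ℝ}

lemma lintegral_residual_le (hbT : b < T)
    (hζ : IsCutoff Λ s ζ)
    (hi : IntegrableOn (fun p : ℝ × ℝ => (Iio b).indicator (fun _ => (1 : ℝ)) p.1 * ζ p
      * (‖residual F v p‖ ^ 2 / 2)) (Ioo 0 T ×ˢ Λ.cell)) :
    ENNReal.ofReal (2 * ∫ p in Ioo 0 T ×ˢ Λ.cell,
          (Iio b).indicator (fun _ => (1 : ℝ)) p.1 * ζ p * (‖residual F v p‖ ^ 2 / 2))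
      ≤ ∫⁻ p in Ioo 0 b ×ˢ Λ.cell, ENNReal.ofReal (ζ p) * ‖residual F v p‖ₑ ^ 2 := by
  have hcell := Λ.measurableSet_cell
  rw [← integral_const_mul, ofReal_integral_eq_lintegral_ofReal (hi.const_mul 2)
    (Eventually.of_forall fun p => by
      have := hζ.nonneg p
      have h1 : 0 ≤ (Iio b).indicator (fun _ => (1 : ℝ)) p.1 :=
        indicator_nonneg (fun _ _ => zero_le_one) _
      show 0 ≤ 2 * _
      positivity)]
  have hsub : Ioo 0 b ×ˢ Λ.cell ⊆ Ioo 0 T ×ˢ Λ.cell :=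
    prod_mono (Ioo_subset_Ioo_right hbT.le) le_rfl
  rw [← inter_eq_left.2 hsub, ← setLIntegral_indicator (measurableSet_Ioo.prod hcell)]
  refine setLIntegral_mono' (measurableSet_Ioo.prod hcell) fun p hp => ?_
  by_cases hb : p.1 < b
  · rw [indicator_of_mem (show p.1 ∈ Iio b from hb),
      indicator_of_mem (show p ∈ Ioo 0 b ×ˢ Λ.cell from ⟨⟨hp.1.1, hb⟩, hp.2⟩),
      ← ofReal_norm_sq, ← ENNReal.ofReal_mul (hζ.nonneg p)]
    exact ENNReal.ofReal_le_ofReal (by linarith)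
  · rw [indicator_of_notMem (show p.1 ∉ Iio b from hb)]
    simp

lemma lintegral_initial_le (h : EntropyComparison Λ T U C F η q CF lo up u₀ u v)
    (hζ : IsCutoff Λ s ζ)
    (hi : IntegrableOn (fun x => ζ (0, x) * bregman η (u₀ x) (v (0, x))) Λ.cell) :
    ENNReal.ofReal (2 * ∫ x in Λ.cell, ζ (0, x) * bregman η (u₀ x) (v (0, x)))
      ≤ ENNReal.ofReal up * Λ.sqNorm fun x => u₀ x - v (0, x) := by
  rw [← integral_const_mul, ofReal_integral_eq_lintegral_ofReal (hi.const_mul 2), Domain.sqNorm,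
    ← lintegral_const_mul' _ _ ENNReal.ofReal_ne_top]
  · refine lintegral_mono_ae ?_
    filter_upwards [h.mem_u₀] with x hx
    rw [← ofReal_norm_sq, ← ENNReal.ofReal_mul h.up_pos.le]
    refine ENNReal.ofReal_le_ofReal ?_
    have h1 := h.relEntropy_le hx (h.mem_v (0, x))
    have h2 := mul_le_of_le_one_left (h.relEntropy_nonneg hx (h.mem_v (0, x))) (hζ.le_one (0, x))
    linarith
  · filter_upwards [h.mem_u₀] with x hx
    have := mul_nonneg (hζ.nonneg (0, x)) (h.relEntropy_nonneg hx (h.mem_v (0, x)))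
    show 0 ≤ 2 * _
    linarith

/-- Between any two times there is one at which the localized error is bounded by the data: a time
at which the localized relative entropy does not exceed its mean. -/
theorem exists_good_time (h : EntropyComparison Λ T U C F η q CF lo up u₀ u v)
    (hs : ∀ u ∈ C, ∀ v ∈ C, |relFlux F η q u v| ≤ s * bregman η u v) (hζ : IsCutoff Λ s ζ)
    (hk : Measurable k) (h0 : ∀ t, 0 ≤ k t) (hM : ∀ t, k t ≤ M)
    (hkv : ∀ᵐ p ∂(volume.restrict (Ioo 0 T ×ˢ Λ.cell)),
      (up * CF * ‖fderiv ℝ v p (0, 1)‖ + up ^ 2) / lo ≤ k p.1)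
    (ha : 0 ≤ a) (hab : a < b) (hbT : b < T) :
    ∃ t ∈ Ioo a b, ∫⁻ x in Λ.cell, ENNReal.ofReal (ζ (t, x)) * ‖u t x - v (t, x)‖ₑ ^ 2
      ≤ ENNReal.ofReal (lo⁻¹ * (decay k b)⁻¹)
        * ((∫⁻ p in Ioo 0 b ×ˢ Λ.cell, ENNReal.ofReal (ζ p) * ‖residual F v p‖ₑ ^ 2)
          + ENNReal.ofReal up * Λ.sqNorm fun x => u₀ x - v (0, x)) := by
  obtain ⟨i1, i2, i3, hle⟩ := h.local_estimate hs hζ hk h0 hM hkv ha hab hbT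
  have hlo := h.lo_pos
  have hcell := Λ.measurableSet_cell
  have hX := lintegral_residual_le hbT hζ i2
  have hY := h.lintegral_initial_le hζ i3
  set X := ∫ p in Ioo 0 T ×ˢ Λ.cell,
          (Iio b).indicator (fun _ => (1 : ℝ)) p.1 * ζ p * (‖residual F v p‖ ^ 2 / 2) with hXd
  set Y := ∫ x in Λ.cell, ζ (0, x) * bregman η (u₀ x) (v (0, x)) with hYd
  have hX0 : 0 ≤ X := integral_nonneg fun p => mul_nonneg (mul_nonneg
    (indicator_nonneg (fun _ _ => zero_le_one) _) (hζ.nonneg p)) (by positivity)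
  have hY0 : 0 ≤ Y := integral_nonneg_of_ae (by
    filter_upwards [h.mem_u₀] with x hx
    exact mul_nonneg (hζ.nonneg _) (h.relEntropy_nonneg hx (h.mem_v _)))
  set f : ℝ × ℝ → ℝ := fun p => (Ioo a b).indicator (fun _ => (1 : ℝ)) p.1 * ζ p
      * bregman η (u p.1 p.2) (v p) with hf
  have hsub : Ioo a b ⊆ Ioo 0 T := Ioo_subset_Ioo ha hbT.le
  have i1' : Integrable f ((volume.restrict (Ioo 0 T)).prod (volume.restrict Λ.cell)) := by
    rw [Measure.prod_restrict, ← Measure.volume_eq_prod]; exact i1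
  have hprod : ∫ p in Ioo 0 T ×ˢ Λ.cell, f p = ∫ t in Ioo a b, ∫ x in Λ.cell, f (t, x) := by
    rw [Measure.volume_eq_prod, ← Measure.prod_restrict, integral_prod _ i1']
    refine setIntegral_eq_of_subset_of_forall_sdiff_eq_zero measurableSet_Ioo hsub fun t ht => ?_
    simp [hf, indicator_of_notMem ht.2]
  have hu : ∀ᵐ t ∂(volume.restrict (Ioo 0 T)), ∀ᵐ x ∂(volume.restrict Λ.cell), u t x ∈ C := by
    have := h.mem_u
    rw [Measure.volume_eq_prod, ← Measure.prod_restrict] at this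
    exact Measure.ae_ae_of_ae_prod this
  obtain ⟨t, ht, ⟨htC, hti⟩, htle⟩ := exists_le_mean hab
    ((i1'.integral_prod_left).mono_measure (Measure.restrict_mono hsub le_rfl))
    (P := fun t => (∀ᵐ x ∂(volume.restrict Λ.cell), u t x ∈ C) ∧
      Integrable (fun x => f (t, x)) (volume.restrict Λ.cell))
    (ae_restrict_of_ae_restrict_of_subset hsub (hu.and i1'.prod_right_ae))
  refine ⟨t, ht, ?_⟩
  have hd := decay_pos (k := k) b
  have hbound : ∫ x in Λ.cell, f (t, x) ≤ (decay k b)⁻¹ * (X + Y) := by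
    rw [← hprod] at htle
    rw [le_inv_mul_iff₀ hd]
    have := mul_le_mul_of_nonneg_left htle hd.le
    linarith
  have hft : ∀ x, f (t, x) = ζ (t, x) * bregman η (u t x) (v (t, x)) := fun x => by
    simp [hf, indicator_of_mem ht]
  calc ∫⁻ x in Λ.cell, ENNReal.ofReal (ζ (t, x)) * ‖u t x - v (t, x)‖ₑ ^ 2
      ≤ ∫⁻ x in Λ.cell, ENNReal.ofReal (2 / lo * f (t, x)) := by
        refine lintegral_mono_ae ?_
        filter_upwards [htC] with x hx
        rw [hft, ← ofReal_norm_sq, ← ENNReal.ofReal_mul (hζ.nonneg _)]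
        refine ENNReal.ofReal_le_ofReal ?_
        have h1 := mul_le_mul_of_nonneg_left (h.le_relEntropy hx (h.mem_v (t, x)))
          (hζ.nonneg (t, x))
        have h2 := mul_le_mul_of_nonneg_left h1 (show 0 ≤ 2 / lo by positivity)
        refine le_trans (le_of_eq ?_) h2
        field_simp
    _ = ENNReal.ofReal (∫ x in Λ.cell, 2 / lo * f (t, x)) := by
        rw [ofReal_integral_eq_lintegral_ofReal (hti.const_mul _)]
        filter_upwards [htC] with x hx
        rw [hft]
        have := mul_nonneg (hζ.nonneg (t, x)) (h.relEntropy_nonneg hx (h.mem_v (t, x)))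
        show 0 ≤ _
        positivity
    _ ≤ ENNReal.ofReal (lo⁻¹ * (decay k b)⁻¹ * (2 * X + 2 * Y)) := by
        refine ENNReal.ofReal_le_ofReal ?_
        rw [integral_const_mul]
        refine (mul_le_mul_of_nonneg_left hbound (by positivity)).trans (le_of_eq ?_)
        field_simp
    _ = ENNReal.ofReal (lo⁻¹ * (decay k b)⁻¹)
        * (ENNReal.ofReal (2 * X) + ENNReal.ofReal (2 * Y)) := by
        rw [ENNReal.ofReal_mul (by positivity), ENNReal.ofReal_add (by positivity) (by positivity)]
    _ ≤ _ := by gcongr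

/-- The residual on a short time interval, inside the support of the cutoff, is small. -/
lemma lintegral_residual_extend (hζ : IsCutoff Λ s ζ) {D R ε t₁ : ℝ}
    (hD : ∀ p, ‖residual F v p‖ ^ 2 ≤ D)
    (hR : ∀ p : ℝ × ℝ, p.2 ∈ Λ.cell → R < |p.2| → ζ p = 0) (hb : b ≤ t₁ + ε) :
    ∫⁻ p in Ioo 0 b ×ˢ Λ.cell, ENNReal.ofReal (ζ p) * ‖residual F v p‖ₑ ^ 2
      ≤ (∫⁻ p in Ioo 0 t₁ ×ˢ Λ.cell, ‖residual F v p‖ₑ ^ 2)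
        + ENNReal.ofReal D * (ENNReal.ofReal ε * ENNReal.ofReal (R - -R)) := by
  have hcell := Λ.measurableSet_cell
  have hsub : Ioo 0 b ×ˢ Λ.cell ⊆ (Ioo 0 t₁ ×ˢ Λ.cell) ∪ (Ico t₁ (t₁ + ε) ×ˢ Λ.cell) := by
    rintro p ⟨hp1, hp2⟩
    by_cases h : p.1 < t₁
    · exact Or.inl ⟨⟨hp1.1, h⟩, hp2⟩
    · exact Or.inr ⟨⟨not_lt.1 h, hp1.2.trans_le hb⟩, hp2⟩
  refine (lintegral_mono_set hsub).trans ((lintegral_union_le _ _ _).trans (add_le_add ?_ ?_))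
  · refine lintegral_mono fun p => mul_le_of_le_one_left' ?_
    exact ENNReal.ofReal_le_one.2 (hζ.le_one p)
  · calc ∫⁻ p in Ico t₁ (t₁ + ε) ×ˢ Λ.cell, ENNReal.ofReal (ζ p) * ‖residual F v p‖ₑ ^ 2
        ≤ ∫⁻ p in Ico t₁ (t₁ + ε) ×ˢ Λ.cell,
            (univ ×ˢ Icc (-R) R).indicator (fun _ => ENNReal.ofReal D) p := by
          refine setLIntegral_mono' (measurableSet_Ico.prod hcell) fun p hp => ?_
          by_cases hpR : R < |p.2|
          · rw [hR p hp.2 hpR]; simp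
          · have hm : p ∈ (univ : Set ℝ) ×ˢ Icc (-R) R := ⟨trivial, abs_le.1 (not_lt.1 hpR)⟩
            rw [indicator_of_mem hm, ← ofReal_norm_sq, ← ENNReal.ofReal_mul (hζ.nonneg p)]
            exact ENNReal.ofReal_le_ofReal
              ((mul_le_of_le_one_left (sq_nonneg _) (hζ.le_one p)).trans (hD p))
      _ = ENNReal.ofReal D
          * volume ((univ ×ˢ Icc (-R) R) ∩ (Ico t₁ (t₁ + ε) ×ˢ Λ.cell)) := by
          rw [setLIntegral_indicator (MeasurableSet.univ.prod measurableSet_Icc),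
            setLIntegral_const]
      _ ≤ ENNReal.ofReal D * volume (Ico t₁ (t₁ + ε) ×ˢ Icc (-R) R) := by
          gcongr
          rintro p ⟨h1, h2⟩
          exact ⟨h2.1, h1.2⟩
      _ = _ := by
          rw [Measure.volume_eq_prod, Measure.prod_prod, Real.volume_Ico, Real.volume_Icc,
            add_sub_cancel_left]

/-- The error is continuous in time in the sense of distributions. -/
lemma tendsto_integral_smul_sub (hut : IsWeaklyContinuousInTime T u) {K : NNReal}
    (hv : LipschitzWith K v) {B : ℝ} (hB : ∀ p, ‖v p‖ ≤ B) {ψ : ℝ → ℝ} (hψ : ContDiff ℝ ∞ ψ)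
    (hψc : HasCompactSupport ψ) {τ : ℕ → ℝ} {t₁ : ℝ} (hτ : ∀ j, τ j ∈ Icc 0 T)
    (ht₁ : t₁ ∈ Icc 0 T) (hlim : Tendsto τ atTop (𝓝 t₁)) :
    Tendsto (fun j => ∫ x, ψ x • (u (τ j) x - v (τ j, x))) atTop
      (𝓝 (∫ x, ψ x • (u t₁ x - v (t₁, x)))) := by
  have hi1 : ∀ t ∈ Icc 0 T, Integrable fun x => ψ x • u t x := fun t ht =>
    (hut.1 t ht).integrable_smul_left_of_hasCompactSupport hψ.continuous hψc
  have hvc : ∀ t, Continuous fun x => v (t, x) := fun t => hv.continuous.comp (by fun_prop)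
  have hi2 : ∀ t, Integrable fun x => ψ x • v (t, x) := fun t =>
    (hψ.continuous.smul (hvc t)).integrable_of_hasCompactSupport hψc.smul_right
  have e : ∀ t ∈ Icc 0 T, ∫ x, ψ x • (u t x - v (t, x))
      = (∫ x, ψ x • u t x) - ∫ x, ψ x • v (t, x) := fun t ht => by
    simp only [smul_sub]
    exact integral_sub (hi1 t ht) (hi2 t)
  have h1 : Tendsto (fun j => ∫ x, ψ x • u (τ j) x) atTop (𝓝 (∫ x, ψ x • u t₁ x)) := by
    have := hut.2 ψ hψ hψc t₁ ht₁
    exact this.tendsto.comp (tendsto_nhdsWithin_iff.2 ⟨hlim, Eventually.of_forall hτ⟩)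
  have h2 : Tendsto (fun j => ∫ x, ψ x • v (τ j, x)) atTop (𝓝 (∫ x, ψ x • v (t₁, x))) := by
    refine tendsto_integral_of_dominated_convergence (fun x => ‖ψ x‖ * B)
      (fun j => (hi2 _).aestronglyMeasurable)
      ((hψ.continuous.integrable_of_hasCompactSupport hψc).norm.mul_const B)
      (fun j => Eventually.of_forall fun x => ?_) (Eventually.of_forall fun x => ?_)
    · rw [norm_smul]
      exact mul_le_mul_of_nonneg_left (hB _) (norm_nonneg _)
    · have : Tendsto (fun j => (τ j, x)) atTop (𝓝 (t₁, x)) := hlim.prodMk_nhds tendsto_const_nhds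
      exact tendsto_const_nhds.smul ((hv.continuous.tendsto _).comp this)
  rw [e t₁ ht₁]
  exact (h1.sub h2).congr fun j => (e _ (hτ j)).symm

/-- The localized estimate at a fixed time, obtained from good times close to it and the weak
continuity of the solution. -/
theorem estimate_on_interval (h : EntropyComparison Λ T U C F η q CF lo up u₀ u v)
    (hut : IsWeaklyContinuousInTime T u)
    (hs : ∀ u ∈ C, ∀ v ∈ C, |relFlux F η q u v| ≤ s * bregman η u v) (hζ : IsCutoff Λ s ζ)
    (hk : Measurable k) (h0 : ∀ t, 0 ≤ k t) (hM : ∀ t, k t ≤ M)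
    (hkv : ∀ᵐ p ∂(volume.restrict (Ioo 0 T ×ˢ Λ.cell)),
      (up * CF * ‖fderiv ℝ v p (0, 1)‖ + up ^ 2) / lo ≤ k p.1)
    {α β : ℝ} (hcell : Ioo α β ⊆ Λ.cell) (hone : ∀ t ∈ Icc 0 T, ∀ x ∈ Ioo α β, ζ (t, x) = 1)
    {t₁ : ℝ} (ht₁ : t₁ ∈ Icc 0 T) :
    ∫⁻ x in Ioo α β, ‖u t₁ x - v (t₁, x)‖ₑ ^ 2
      ≤ ENNReal.ofReal (lo⁻¹ * (decay k t₁)⁻¹)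
        * ((∫⁻ p in Ioo 0 t₁ ×ˢ Λ.cell, ‖residual F v p‖ₑ ^ 2)
          + ENNReal.ofReal up * Λ.sqNorm fun x => u₀ x - v (0, x)) := by
  obtain ⟨K, hK⟩ := h.lipschitz_v
  obtain ⟨D, -, hD⟩ := h.exists_residual_bound
  obtain ⟨B, hB⟩ := h.isCompact.exists_bound_of_continuousOn (f := id) continuousOn_id
  obtain ⟨R, hR⟩ := exists_support_radius hζ.support
  have hlo := h.lo_pos
  set E := ∫⁻ p in Ioo 0 t₁ ×ˢ Λ.cell, ‖residual F v p‖ₑ ^ 2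
  set E₀ := Λ.sqNorm fun x => u₀ x - v (0, x)
  set ε : ℕ → ℝ := fun j => 1 / ((j : ℝ) + 1) with hε
  have hε0 : ∀ j, 0 < ε j := fun j => by positivity
  have hεt : Tendsto ε atTop (𝓝 0) := tendsto_one_div_add_atTop_nhds_zero_nat
  have key : ∀ j, ∃ t ∈ Icc 0 T, |t - t₁| ≤ ε j ∧ ∫⁻ x in Ioo α β, ‖u t x - v (t, x)‖ₑ ^ 2
      ≤ ENNReal.ofReal (lo⁻¹ * (decay k (t₁ + ε j))⁻¹)
        * (E + ENNReal.ofReal D * (ENNReal.ofReal (ε j) * ENNReal.ofReal (R - -R))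
          + ENNReal.ofReal up * E₀) := by
    intro j
    have hj := hε0 j
    -- an interval near `t₁` that stays away from the final time
    obtain ⟨a, b, ha, hab, hbT, hbε, hnear⟩ : ∃ a b, 0 ≤ a ∧ a < b ∧ b < T ∧ b ≤ t₁ + ε j ∧
        ∀ t ∈ Ioo a b, |t - t₁| ≤ ε j := by
      rcases lt_or_eq_of_le ht₁.2 with hlt | heq
      · have h1 : t₁ < (t₁ + T) / 2 := by linarith
        refine ⟨t₁, min (t₁ + ε j) ((t₁ + T) / 2), ht₁.1, lt_min (by linarith) h1,
          (min_le_right _ _).trans_lt (by linarith), min_le_left _ _, fun t ht => ?_⟩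
        rw [abs_of_pos (sub_pos.2 ht.1)]
        linarith [ht.2.trans_le (min_le_left _ _)]
      · have hT := h.T_pos
        have h1 : max 0 (T - ε j) < T := max_lt hT (by linarith)
        refine ⟨max 0 (T - ε j), (max 0 (T - ε j) + T) / 2, le_max_left _ _, by linarith,
          by linarith, by linarith, fun t ht => ?_⟩
        have h2 := (le_max_right 0 (T - ε j)).trans_lt ht.1
        have h3 : t < T := ht.2.trans (by linarith)
        rw [heq, abs_of_neg (sub_neg.2 h3)]
        linarith
    obtain ⟨t, ht, hle⟩ := h.exists_good_time hs hζ hk h0 hM hkv ha hab hbT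
    have htT : t ∈ Icc 0 T := ⟨ha.trans ht.1.le, ht.2.le.trans hbT.le⟩
    refine ⟨t, htT, hnear t ht, ?_⟩
    calc ∫⁻ x in Ioo α β, ‖u t x - v (t, x)‖ₑ ^ 2
        = ∫⁻ x in Ioo α β, ENNReal.ofReal (ζ (t, x)) * ‖u t x - v (t, x)‖ₑ ^ 2 := by
          refine setLIntegral_congr_fun measurableSet_Ioo fun x hx => ?_
          simp only [hone t htT x hx, ENNReal.ofReal_one, one_mul]
      _ ≤ _ := lintegral_mono_set hcell
      _ ≤ _ := hle
      _ ≤ _ := by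
          have hmono := decay_antitone hk h0 hM (ha.trans hab.le) hbε
          have hpos := decay_pos (k := k) (t₁ + ε j)
          have hres := lintegral_residual_extend (F := F) (v := v) hζ hD
            (fun p hp hp' => (hR p hp hp').1) hbε
          gcongr
  choose τ hτ hτt hτle using key
  have hτlim : Tendsto τ atTop (𝓝 t₁) := by
    rw [tendsto_iff_dist_tendsto_zero]
    exact squeeze_zero (fun _ => dist_nonneg) (fun j => by rw [Real.dist_eq]; exact hτt j) hεt
  have hvl : ∀ t, LocallyIntegrable fun x => v (t, x) := fun t =>
    (hK.continuous.comp (by fun_prop : Continuous fun x : ℝ => (t, x))).locallyIntegrable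
  refine lintegral_sq_le_of_weak_limit (f := fun j x => u (τ j) x - v (τ j, x))
    (fun j => (hut.1 _ (hτ j)).sub (hvl _)) ((hut.1 _ ht₁).sub (hvl _))
    (fun ψ hψ hψc => tendsto_integral_smul_sub hut hK (fun p => hB _ (h.mem_v p))
      hψ hψc hτ ht₁ hτlim) hτle ?_
  have hd : Tendsto (fun j => ENNReal.ofReal (lo⁻¹ * (decay k (t₁ + ε j))⁻¹)) atTop
      (𝓝 (ENNReal.ofReal (lo⁻¹ * (decay k t₁)⁻¹))) := by
    refine (ENNReal.continuous_ofReal.tendsto _).comp (Tendsto.const_mul _ (Tendsto.inv₀ ?_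
      (decay_pos t₁).ne'))
    have h1 : Tendsto (fun j => t₁ + ε j) atTop (𝓝 t₁) := by simpa using hεt.const_add t₁
    exact ((lipschitzWith_decay hk h0 hM).continuous.tendsto _).comp h1
  have hsmall : Tendsto (fun j => ENNReal.ofReal D
      * (ENNReal.ofReal (ε j) * ENNReal.ofReal (R - -R))) atTop (𝓝 0) := by
    have h1 : Tendsto (fun j => ENNReal.ofReal (ε j)) atTop (𝓝 0) := by
      rw [← ENNReal.ofReal_zero]
      exact (ENNReal.continuous_ofReal.tendsto 0).comp hεt
    have h2 := ENNReal.Tendsto.const_mul (a := ENNReal.ofReal D)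
      (ENNReal.Tendsto.mul_const (b := ENNReal.ofReal (R - -R)) h1 (Or.inr ENNReal.ofReal_ne_top))
      (Or.inr ENNReal.ofReal_ne_top)
    simpa using h2
  have hsum : Tendsto (fun j => E + ENNReal.ofReal D
      * (ENNReal.ofReal (ε j) * ENNReal.ofReal (R - -R)) + ENNReal.ofReal up * E₀) atTop
      (𝓝 (E + ENNReal.ofReal up * E₀)) := by
    simpa using (hsmall.const_add E).add_const (ENNReal.ofReal up * E₀)
  refine ENNReal.Tendsto.mul hd (Or.inl ?_) hsum (Or.inr ENNReal.ofReal_ne_top)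
  have := decay_pos (k := k) t₁
  exact (ENNReal.ofReal_pos.2 (by positivity)).ne'

/-- The stability estimate for one value of the random parameter. -/
theorem stability (h : EntropyComparison Λ T U C F η q CF lo up u₀ u v)
    (hut : IsWeaklyContinuousInTime T u) {t₁ : ℝ} (ht₁ : t₁ ∈ Icc 0 T) :
    (Λ.sqNorm fun x => u t₁ x - v (t₁, x))
      ≤ ENNReal.ofReal lo⁻¹
        * ((∫⁻ p in Ioo 0 t₁ ×ˢ Λ.cell, ‖residual F v p‖ₑ ^ 2)
          + ENNReal.ofReal up * Λ.sqNorm fun x => u₀ x - v (0, x))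
        * ENNReal.ofReal (Real.exp (∫ t in (0 : ℝ)..t₁,
          (up * CF * Λ.supNorm (fun x => deriv (fun x' => v (t, x')) x) + up ^ 2) / lo)) := by
  obtain ⟨s, hs0, hs⟩ := h.exists_speed
  obtain ⟨K, hK⟩ := h.lipschitz_v
  have hlo := h.lo_pos
  have hup := h.up_pos
  have hCF := h.CF_nonneg
  set L : ℝ → ℝ := fun t => Λ.supNorm (fun x => deriv (fun x' => v (t, x')) x) with hL
  set k : ℝ → ℝ := fun t => (up * CF * L t + up ^ 2) / lo with hk
  have hL0 : ∀ t, 0 ≤ L t := fun t => supNorm_nonneg _ _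
  have hkm : Measurable k :=
    (((measurable_supNorm_slope hK Λ).const_mul _).add_const _).div_const _
  have hk0 : ∀ t, 0 ≤ k t := fun t => by have := hL0 t; positivity
  have hkM : ∀ t, k t ≤ (up * CF * K + up ^ 2) / lo := fun t => by
    have := supNorm_slope_le hK Λ t
    simp only [hk]
    gcongr
  have hkv : ∀ᵐ p ∂(volume.restrict (Ioo 0 T ×ˢ Λ.cell)),
      (up * CF * ‖fderiv ℝ v p (0, 1)‖ + up ^ 2) / lo ≤ k p.1 := by
    filter_upwards [ae_norm_fderiv_snd_le hK Λ T] with p hp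
    simp only [hk]
    gcongr
  have hrhs : ∀ X : ℝ≥0∞, ENNReal.ofReal (lo⁻¹ * (decay k t₁)⁻¹) * X
      = ENNReal.ofReal lo⁻¹ * X * ENNReal.ofReal (Real.exp (∫ t in (0 : ℝ)..t₁, k t)) := fun X => by
    rw [decay_eq ht₁.1, Real.exp_neg, inv_inv, ENNReal.ofReal_mul (by positivity), mul_right_comm]
  rw [← hrhs]
  cases Λ
  -- on the line, exhaust by the intervals `(-n, n)`, on which the cone of radius `n + 1` is `1`
  · have hn : ∀ n : ℕ, ∫⁻ x in Ioo (-(n : ℝ)) n, ‖u t₁ x - v (t₁, x)‖ₑ ^ 2 ≤ _ := fun n =>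
      h.estimate_on_interval hut hs (isCutoff_cone hs0 T (n + 1)) hkm hk0 hkM hkv
        (subset_univ _) (fun t ht x hx => cone_eq_one hs0 ht.1 ht.2 (by
          simpa using (abs_lt.2 hx).le)) ht₁
    have hU : (⋃ n : ℕ, Ioo (-(n : ℝ)) n) = univ := by
      refine eq_univ_of_forall fun x => ?_
      obtain ⟨n, hn⟩ := exists_nat_gt |x|
      exact mem_iUnion.2 ⟨n, abs_lt.1 hn⟩
    have hdir : Directed (· ⊆ ·) fun n : ℕ => Ioo (-(n : ℝ)) n :=
      Monotone.directed_le fun i j hij => by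
        have : (i : ℝ) ≤ j := by exact_mod_cast hij
        exact Ioo_subset_Ioo (neg_le_neg this) this
    refine le_trans (le_of_eq ?_) (iSup_le hn)
    rw [← setLIntegral_iUnion_of_directed _ hdir, hU]
    rfl
  · have := h.estimate_on_interval hut hs (isCutoff_one s) hkm hk0 hkM hkv
        (α := 0) (β := 1) Ioo_subset_Ico_self (fun _ _ _ _ => rfl) ht₁
    rw [Domain.sqNorm, Domain.cell, setLIntegral_congr Ioo_ae_eq_Ico.symm]
    exact this

end EntropyComparison

/-! ### The law of the random parameter -/

/-- The law of `ξ` has the product density `w`: by independence it is the product of the marginal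
laws, and the two measures agree on boxes by Fubini's theorem. -/
lemma HasIndependentDensities.map_eq_weightedMeasure {Ω : Type*} [MeasurableSpace Ω]
    {P : Measure Ω} [IsProbabilityMeasure P] {N : ℕ} {ξ : Ω → Fin N → ℝ} {w : Fin N → ℝ → ℝ}
    (h : HasIndependentDensities P ξ w) : P.map ξ = weightedMeasure w := by
  have hm : ∀ i, Measurable fun a => ξ a i := fun i => (measurable_pi_apply i).comp h.measurable
  have hprob : ∀ i, IsProbabilityMeasure (P.map fun a => ξ a i) := fun i =>
    Measure.isProbabilityMeasure_map (hm i).aemeasurable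
  have h1 : P.map ξ = Measure.pi fun i => P.map fun a => ξ a i :=
    (iIndepFun_iff_map_fun_eq_pi_map fun i => (hm i).aemeasurable).1 h.indep
  rw [h1]
  refine Measure.pi_eq fun s hs => ?_
  have hw0 : ∀ i x, 0 ≤ (s i).indicator (w i) x := fun i x =>
    indicator_nonneg (fun x _ => h.density_nonneg i x) x
  have hofReal : ∀ i x, ENNReal.ofReal ((s i).indicator (w i) x)
      = (s i).indicator (fun x => ENNReal.ofReal (w i x)) x := fun i x => by
    by_cases hx : x ∈ s i <;> simp [hx]
  have hmass : ∀ i, ∫⁻ x, ENNReal.ofReal ((s i).indicator (w i) x)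
      = P.map (fun a => ξ a i) (s i) := fun i => by
    simp only [hofReal]
    rw [lintegral_indicator (hs i), h.map_eq i, withDensity_apply _ (hs i)]
  have hint : ∀ i, Integrable ((s i).indicator (w i)) := fun i => by
    refine ⟨((h.measurable_density i).indicator (hs i)).aestronglyMeasurable, ?_⟩
    rw [hasFiniteIntegral_iff_ofReal (Eventually.of_forall (hw0 i)), hmass i]
    exact measure_lt_top _ _
  have hprod : ∀ y : Fin N → ℝ, (univ.pi s).indicator (fun y => ENNReal.ofReal (jointDensity w y)) y
      = ENNReal.ofReal (∏ i, (s i).indicator (w i) (y i)) := fun y => by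
    by_cases hy : y ∈ univ.pi s
    · rw [indicator_of_mem hy, jointDensity]
      congr 1
      exact Finset.prod_congr rfl fun i _ => (indicator_of_mem (hy i trivial) _).symm
    · rw [indicator_of_notMem hy]
      obtain ⟨i, hi⟩ : ∃ i, y i ∉ s i := by simpa [Set.mem_pi] using hy
      rw [Finset.prod_eq_zero (Finset.mem_univ i) (indicator_of_notMem hi _), ENNReal.ofReal_zero]
  have hpi : MeasurableSet (univ.pi s) := MeasurableSet.univ_pi hs
  rw [weightedMeasure, withDensity_apply _ hpi, ← lintegral_indicator hpi]
  simp only [hprod]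
  have hI : Integrable (fun y : Fin N → ℝ => ∏ i, (s i).indicator (w i) (y i)) volume := by
    rw [volume_pi]
    exact Integrable.fintype_prod hint
  rw [← ofReal_integral_eq_lintegral_ofReal hI
    (Eventually.of_forall fun y => Finset.prod_nonneg fun i _ => hw0 i _),
    integral_fintype_prod_volume_eq_prod, ENNReal.ofReal_prod_of_nonneg
      fun i _ => integral_nonneg (hw0 i)]
  refine Finset.prod_congr rfl fun i _ => ?_
  rw [ofReal_integral_eq_lintegral_ofReal (hint i) (Eventually.of_forall (hw0 i)), hmass i]

/-! ### The space-time-stochastic reconstruction -/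

section Reconstruction

variable {m N r : ℕ} {Λ : Domain} {T : ℝ} {z : Fin N → Fin (r + 1) → ℝ}
  {ust : (Fin N → Fin (r + 1)) → ℝ → ℝ → State m}

/-- The reconstruction at a fixed parameter, extended to the whole plane by its values at the
initial and the final time. -/
noncomputable def clampedReconstruction (T : ℝ) (z : Fin N → Fin (r + 1) → ℝ)
    (ust : (Fin N → Fin (r + 1)) → ℝ → ℝ → State m) (y : Fin N → ℝ) (p : ℝ × ℝ) : State m :=
  stsReconstruction z ust (max 0 (min T p.1)) p.2 y

lemma clamp_mem (hT : 0 ≤ T) (t : ℝ) : max 0 (min T t) ∈ Icc 0 T :=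
  ⟨le_max_left _ _, max_le hT (min_le_left _ _)⟩

lemma clamp_of_mem {t : ℝ} (ht : t ∈ Icc 0 T) : max 0 (min T t) = t := by
  rw [min_eq_right ht.2, max_eq_right ht.1]

lemma clampedReconstruction_eq {t : ℝ} (ht : t ∈ Icc 0 T) (x : ℝ) (y : Fin N → ℝ) :
    clampedReconstruction T z ust y (t, x) = stsReconstruction z ust t x y := by
  rw [clampedReconstruction, clamp_of_mem ht]

lemma exists_lipschitzWith_sum {α ι E : Type*} [PseudoEMetricSpace α] [NormedAddCommGroup E]
    [NormedSpace ℝ E] (c : ι → ℝ) {f : ι → α → E} (hf : ∀ i, ∃ K, LipschitzWith K (f i))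
    (S : Finset ι) : ∃ K, LipschitzWith K fun p => ∑ i ∈ S, c i • f i p := by
  classical
  induction S using Finset.induction_on with
  | empty => exact ⟨0, LipschitzWith.const (0 : E)⟩
  | insert i S hi ih =>
    obtain ⟨K, hK⟩ := ih
    obtain ⟨L, hL⟩ := hf i
    have h := ((lipschitzWith_smul (β := E) (c i)).comp hL).add hK
    exact ⟨_, by simp only [Finset.sum_insert hi]; exact h⟩

lemma exists_lipschitzWith_clamped (hT : 0 ≤ T)
    (hust : ∀ k, IsSpaceTimeReconstruction Λ T (ust k)) (y : Fin N → ℝ) :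
    ∃ K, LipschitzWith K (clampedReconstruction T z ust y) := by
  have hc : LipschitzWith 1 fun p : ℝ × ℝ => (max 0 (min T p.1), p.2) := by
    simpa using ((LipschitzWith.prod_fst.const_min T).const_max 0).prodMk
      (LipschitzWith.prod_snd (α := ℝ) (β := ℝ))
  have hf : ∀ k, ∃ K, LipschitzWith K fun p : ℝ × ℝ => ust k (max 0 (min T p.1)) p.2 := by
    intro k
    obtain ⟨K, hK⟩ := (hust k).lipschitz
    refine ⟨K, fun p p' => ?_⟩
    have h1 := hK (x := (max 0 (min T p.1), p.2)) ⟨clamp_mem hT _, trivial⟩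
      (y := (max 0 (min T p'.1), p'.2)) ⟨clamp_mem hT _, trivial⟩
    have h2 := hc p p'
    rw [ENNReal.coe_one, one_mul] at h2
    exact h1.trans (mul_le_mul_right h2 _)
  obtain ⟨K, hK⟩ := exists_lipschitzWith_sum (fun k => lagrangeTensor z k y) hf Finset.univ
  exact ⟨K, hK⟩

lemma isFunctionOn_clamped (hust : ∀ k, IsSpaceTimeReconstruction Λ T (ust k)) (y : Fin N → ℝ)
    (t : ℝ) : Λ.IsFunctionOn fun x => clampedReconstruction T z ust y (t, x) := by
  have h := fun k => (hust k).on_domain (max 0 (min T t))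
  cases Λ
  · trivial
  · intro x
    simp only [clampedReconstruction, stsReconstruction, collocationInterpolant]
    exact Finset.sum_congr rfl fun k _ => by rw [h k x]

lemma clamped_eventuallyEq {t : ℝ} (ht : t ∈ Ioo 0 T) (x : ℝ) (y : Fin N → ℝ) :
    (fun s => stsReconstruction z ust s x y) =ᶠ[𝓝 t]
      fun s => clampedReconstruction T z ust y (s, x) := by
  filter_upwards [Ioo_mem_nhds ht.1 ht.2] with s hs
  exact (clampedReconstruction_eq (Ioo_subset_Icc_self hs) x y).symm

/-- The residual of the reconstruction, written with total derivatives of the extension: these exist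
almost everywhere by Rademacher's theorem, and the extension agrees with the reconstruction near
every interior time. -/
lemma residualIndicator_eq {U C : Set (State m)} {F : (Fin N → ℝ) → State m → State m}
    {y : Fin N → ℝ} {K : NNReal} (hK : LipschitzWith K (clampedReconstruction T z ust y))
    (hU : IsOpen U) (hCU : C ⊆ U) (hF : ContDiffOn ℝ 2 (F y) U)
    (hC : ∀ p, clampedReconstruction T z ust y p ∈ C) {t : ℝ} (ht : t ≤ T) :
    residualIndicator Λ F (stsReconstruction z ust) t y = ∫⁻ p in Ioo 0 t ×ˢ Λ.cell,
      ‖EntropyComparison.residual (F y) (clampedReconstruction T z ust y) p‖ₑ ^ 2 := by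
  refine lintegral_congr_ae ?_
  filter_upwards [ae_restrict_of_ae hK.ae_differentiableAt,
    ae_restrict_mem (measurableSet_Ioo.prod Λ.measurableSet_cell)] with p hd hp
  have hp1 : p.1 ∈ Ioo 0 T := ⟨hp.1.1, hp.1.2.trans_le ht⟩
  have e1 : deriv (fun s => stsReconstruction z ust s p.2 y) p.1
      = fderiv ℝ (clampedReconstruction T z ust y) p (1, 0) := by
    rw [(clamped_eventuallyEq hp1 p.2 y).deriv_eq]
    exact (hasDerivAt_fst (t := p.1) (x := p.2) hd).deriv
  have e2 : deriv (fun x' => F y (stsReconstruction z ust p.1 x' y)) p.2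
      = fderiv ℝ (F y) (clampedReconstruction T z ust y p)
        (fderiv ℝ (clampedReconstruction T z ust y) p (0, 1)) := by
    simp only [← clampedReconstruction_eq (z := z) (ust := ust) (Ioo_subset_Icc_self hp1)]
    exact ((hasFDerivAt_of_contDiffOn hU hF (hCU (hC p))).comp_hasDerivAt p.2
      (hasDerivAt_snd (t := p.1) (x := p.2) hd)).deriv
  simp only [stsResidual, EntropyComparison.residual, e1, e2]

lemma continuous_lagrangeTensor (k : Fin N → Fin (r + 1)) :
    Continuous (lagrangeTensor z k) := by
  unfold lagrangeTensor
  refine continuous_finsetProd _ fun i _ => ?_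
  exact (Lagrange.basis Finset.univ (z i) (k i)).continuous.comp (continuous_apply i)

lemma measurable_collocationInterpolant {f : (Fin N → Fin (r + 1)) → ℝ → State m}
    (hf : ∀ k, Measurable (f k)) :
    Measurable fun p : (Fin N → ℝ) × ℝ => collocationInterpolant z (fun k => f k p.2) p.1 := by
  unfold collocationInterpolant
  refine Finset.measurable_sum _ fun k _ => ?_
  exact ((continuous_lagrangeTensor k).measurable.comp measurable_fst).smul
    ((hf k).comp measurable_snd)

lemma measurable_reconstruction (hust : ∀ k, IsSpaceTimeReconstruction Λ T (ust k)) {t : ℝ}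
    (ht : t ∈ Icc 0 T) (k : Fin N → Fin (r + 1)) : Measurable (ust k t) := by
  obtain ⟨K, hK⟩ := (hust k).lipschitz
  have : Continuous (ust k t) :=
    hK.continuousOn.comp_continuous (by fun_prop : Continuous fun x : ℝ => (t, x))
      fun x => ⟨ht, trivial⟩
  exact this.measurable

end Reconstruction

lemma enorm_sub_sq_le {V : Type*} [NormedAddCommGroup V] (a b c : V) :
    ‖a - c‖ₑ ^ 2 ≤ 2 * ‖b - c‖ₑ ^ 2 + 2 * ‖a - b‖ₑ ^ 2 := by
  have h2 : (2 : ℝ≥0∞) = ENNReal.ofReal 2 := by simp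
  rw [← ofReal_norm_sq, ← ofReal_norm_sq, ← ofReal_norm_sq, h2, ← ENNReal.ofReal_mul zero_le_two,
    ← ENNReal.ofReal_mul zero_le_two, ← ENNReal.ofReal_add (by positivity) (by positivity)]
  refine ENNReal.ofReal_le_ofReal ?_
  have h := norm_sub_le_norm_sub_add_norm_sub a b c
  nlinarith [norm_nonneg (a - c), norm_nonneg (a - b), norm_nonneg (b - c),
    sq_nonneg (‖a - b‖ - ‖b - c‖)]

end RandomCL

theorem mainTheorem2
    -- spatial domain, final time, random parameter
    {m N : ℕ} (Λ : RandomCL.Domain) (T : ℝ) (hT : 0 < T)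
    {Ω : Type*} [MeasurableSpace Ω] (P : Measure Ω) [IsProbabilityMeasure P]
    (ξ : Ω → Fin N → ℝ) (Ξ : Set (Fin N → ℝ)) (hξΞ : ∀ a, ξ a ∈ Ξ)
    (w : Fin N → ℝ → ℝ) (hξ : RandomCL.HasIndependentDensities P ξ w)
    -- state space, random flux, random entropy pair, random initial datum
    (U C : Set (RandomCL.State m)) (hU : IsOpen U) (hCU : C ⊆ U)
    (hCcompact : IsCompact C) (hCconvex : Convex ℝ C)
    (F : (Fin N → ℝ) → RandomCL.State m → RandomCL.State m)
    (hF : ∀ᵐ y ∂(P.map ξ), ContDiffOn ℝ 2 (F y) U)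
    (η q : (Fin N → ℝ) → RandomCL.State m → ℝ)
    (hη : ∀ᵐ y ∂(P.map ξ), RandomCL.IsEntropyPair U (F y) (η y) (q y))
    (u₀ : ℝ → (Fin N → ℝ) → RandomCL.State m)
    (hu₀ : Integrable (fun p : (Fin N → ℝ) × ℝ => u₀ p.2 p.1)
      ((P.map ξ).prod (volume.restrict Λ.cell)))
    (hu₀Λ : ∀ y, Λ.IsFunctionOn (fun x => u₀ x y))
    (hu₀C : ∀ᵐ y ∂(P.map ξ), ∀ᵐ x ∂(volume.restrict Λ.cell), u₀ x y ∈ C)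
    -- the bounds on the second derivatives of flux and entropy
    (CF ηlow ηup : (Fin N → ℝ) → ℝ)
    (hconst : ∀ᵐ y ∂(P.map ξ), 0 ≤ CF y ∧ 0 < ηlow y ∧ ηlow y ≤ ηup y ∧
      ∀ z ∈ C, ∀ v : RandomCL.State m,
        ‖RandomCL.hessianForm (F y) z v‖ ≤ CF y * ‖v‖ ^ 2 ∧
        ηlow y * ‖v‖ ^ 2 ≤ RandomCL.hessianForm (η y) z v ∧
        RandomCL.hessianForm (η y) z v ≤ ηup y * ‖v‖ ^ 2)
    -- the random entropy admissible solution, with values in `C`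
    (u : ℝ → ℝ → (Fin N → ℝ) → RandomCL.State m)
    (hu : RandomCL.IsRandomEntropySolution Λ T U (P.map ξ) F η q u₀ u)
    (huC : ∀ᵐ y ∂(P.map ξ),
      ∀ᵐ p : ℝ × ℝ ∂(volume.restrict (Ioo 0 T ×ˢ Λ.cell)), u p.1 p.2 y ∈ C)
    (hut : ∀ᵐ y ∂(P.map ξ), RandomCL.IsWeaklyContinuousInTime T (fun t x => u t x y))
    -- time levels, collocation points, numerical solution and space-time reconstructions
    (Nt : ℕ) (τ : Fin (Nt + 1) → ℝ) (hτ : StrictMono τ) (hτ0 : τ 0 = 0)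
    (hτT : τ (Fin.last Nt) = T)
    (r : ℕ) (z : Fin N → Fin (r + 1) → ℝ) (hz : ∀ i, Function.Injective (z i))
    (uh : Fin (Nt + 1) → (Fin N → Fin (r + 1)) → ℝ → RandomCL.State m)
    (huh : ∀ n k, Measurable (uh n k))
    (ust : (Fin N → Fin (r + 1)) → ℝ → ℝ → RandomCL.State m)
    (hust : ∀ k, RandomCL.IsSpaceTimeReconstruction Λ T (ust k))
    (hustC : ∀ᵐ y ∂(P.map ξ), ∀ t ∈ Icc 0 T, ∀ x, RandomCL.stsReconstruction z ust t x y ∈ C)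
    -- the bound at every time level and on every measurable part of `Ξ`
    (n : Fin (Nt + 1)) (Ξt : Set (Fin N → ℝ)) (hΞt : Ξt ⊆ Ξ)
    (hΞtm : NullMeasurableSet Ξt (P.map ξ)) :
    RandomCL.weightedSqNorm Λ w Ξt
        (fun x y => u (τ n) x y - RandomCL.collocationSolution z (uh n) x y)
      ≤ 2 * RandomCL.weightedSqNorm Λ w Ξt
          (fun x y => RandomCL.stsReconstruction z ust (τ n) x y
            - RandomCL.collocationSolution z (uh n) x y)
        + 2 * ∫⁻ y in Ξt,
            (ENNReal.ofReal (ηlow y)⁻¹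
              * (RandomCL.residualIndicator Λ F (RandomCL.stsReconstruction z ust) (τ n) y
                + ENNReal.ofReal (ηup y)
                  * RandomCL.initialIndicator Λ u₀ (RandomCL.stsReconstruction z ust) y))
            * ENNReal.ofReal (Real.exp (∫ t in (0 : ℝ)..(τ n),
                (ηup y * CF y
                    * Λ.supNorm (fun x =>
                        deriv (fun x' => RandomCL.stsReconstruction z ust t x' y) x)
                  + ηup y ^ 2) / ηlow y))
            ∂(RandomCL.weightedMeasure w) := by
  have hlaw := hξ.map_eq_weightedMeasure
  have hprob : IsProbabilityMeasure (P.map ξ) :=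
    Measure.isProbabilityMeasure_map hξ.measurable.aemeasurable
  have hτn : τ n ∈ Icc 0 T :=
    ⟨hτ0 ▸ hτ.monotone (Fin.zero_le n), hτT ▸ hτ.monotone (Fin.le_last n)⟩
  have h0T : (0 : ℝ) ∈ Icc 0 T := left_mem_Icc.2 hT.le
  -- measurability of the reconstruction error, needed to split the integrals
  have hmeas : Measurable fun p : (Fin N → ℝ) × ℝ =>
      RandomCL.stsReconstruction z ust (τ n) p.2 p.1 - RandomCL.collocationSolution z (uh n) p.2 p.1 :=
    (RandomCL.measurable_collocationInterpolant
      fun k => RandomCL.measurable_reconstruction hust hτn k).sub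
      (RandomCL.measurable_collocationInterpolant (huh n))
  have hmeas1 : ∀ y, Measurable fun x =>
      ‖RandomCL.stsReconstruction z ust (τ n) x y
        - RandomCL.collocationSolution z (uh n) x y‖ₑ ^ 2 := fun y =>
    (hmeas.comp measurable_prodMk_left).enorm.pow_const 2
  have hmeas2 : Measurable fun y => Λ.sqNorm fun x =>
      RandomCL.stsReconstruction z ust (τ n) x y - RandomCL.collocationSolution z (uh n) x y :=
    (hmeas.enorm.pow_const 2).lintegral_prod_right'
  have hpath : ∀ᵐ y ∂(P.map ξ),
      (Λ.sqNorm fun x => u (τ n) x y - RandomCL.collocationSolution z (uh n) x y)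
      ≤ 2 * (Λ.sqNorm fun x => RandomCL.stsReconstruction z ust (τ n) x y
            - RandomCL.collocationSolution z (uh n) x y)
        + 2 * ((ENNReal.ofReal (ηlow y)⁻¹
              * (RandomCL.residualIndicator Λ F (RandomCL.stsReconstruction z ust) (τ n) y
                + ENNReal.ofReal (ηup y)
                  * RandomCL.initialIndicator Λ u₀ (RandomCL.stsReconstruction z ust) y))
            * ENNReal.ofReal (Real.exp (∫ t in (0 : ℝ)..(τ n),
                (ηup y * CF y
                    * Λ.supNorm (fun x =>
                        deriv (fun x' => RandomCL.stsReconstruction z ust t x' y) x)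
                  + ηup y ^ 2) / ηlow y))) := by
    filter_upwards [hF, hη, hu₀.prod_right_ae, hu₀C, hconst, hu.integrable.prod_right_ae, hu.weak,
      hu.entropy, huC, hut, hustC] with y hFy hηy hu₀y hu₀Cy hcy huy hwy hey huCy huty hvy
    obtain ⟨K, hK⟩ := RandomCL.exists_lipschitzWith_clamped (z := z) hT.le hust y
    have hvC : ∀ p, RandomCL.clampedReconstruction T z ust y p ∈ C := fun p =>
      hvy _ (RandomCL.clamp_mem hT.le _) _
    have hcmp : RandomCL.EntropyComparison Λ T U C (F y) (η y) (q y) (CF y) (ηlow y) (ηup y)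
        (fun x => u₀ x y) (fun t x => u t x y) (RandomCL.clampedReconstruction T z ust y) :=
      { isOpen := hU
        subset := hCU
        isCompact := hCcompact
        convex := hCconvex
        contDiffOn_F := hFy
        pair := hηy
        CF_nonneg := hcy.1
        lo_pos := hcy.2.1
        lo_le_up := hcy.2.2.1
        bounds := hcy.2.2.2
        T_pos := hT
        weak := hwy
        entropy := hey
        meas_u := huy.aestronglyMeasurable
        meas_u₀ := hu₀y.aestronglyMeasurable
        mem_u := huCy
        mem_u₀ := hu₀Cy
        lipschitz_v := ⟨K, hK⟩
        mem_v := hvC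
        on_domain_v := RandomCL.isFunctionOn_clamped hust y }
    have hstab := hcmp.stability huty hτn
    have hexp : ∫ t in (0 : ℝ)..(τ n), (ηup y * CF y * Λ.supNorm (fun x =>
          deriv (fun x' => RandomCL.clampedReconstruction T z ust y (t, x')) x)
            + ηup y ^ 2) / ηlow y
        = ∫ t in (0 : ℝ)..(τ n), (ηup y * CF y * Λ.supNorm (fun x =>
          deriv (fun x' => RandomCL.stsReconstruction z ust t x' y) x) + ηup y ^ 2) / ηlow y := by
      refine intervalIntegral.integral_congr fun t ht => ?_
      rw [uIcc_of_le hτn.1] at ht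
      have htT : t ∈ Icc 0 T := ⟨ht.1, ht.2.trans hτn.2⟩
      simp only [RandomCL.clampedReconstruction_eq htT]
    rw [hexp, ← RandomCL.residualIndicator_eq hK hU hCU hFy hvC hτn.2] at hstab
    simp only [RandomCL.clampedReconstruction_eq hτn, RandomCL.clampedReconstruction_eq h0T]
      at hstab
    calc (Λ.sqNorm fun x => u (τ n) x y - RandomCL.collocationSolution z (uh n) x y)
        ≤ ∫⁻ x in Λ.cell, (2 * ‖RandomCL.stsReconstruction z ust (τ n) x y
              - RandomCL.collocationSolution z (uh n) x y‖ₑ ^ 2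
            + 2 * ‖u (τ n) x y - RandomCL.stsReconstruction z ust (τ n) x y‖ₑ ^ 2) :=
          lintegral_mono fun x => RandomCL.enorm_sub_sq_le _ _ _
      _ = 2 * (Λ.sqNorm fun x => RandomCL.stsReconstruction z ust (τ n) x y
            - RandomCL.collocationSolution z (uh n) x y)
          + 2 * (Λ.sqNorm fun x => u (τ n) x y - RandomCL.stsReconstruction z ust (τ n) x y) := by
          rw [lintegral_add_left ((hmeas1 y).const_mul 2),
            lintegral_const_mul' _ _ ENNReal.ofNat_ne_top,
            lintegral_const_mul' _ _ ENNReal.ofNat_ne_top]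
          rfl
      _ ≤ _ := by gcongr; exact hstab
  rw [hlaw] at hpath
  refine (lintegral_mono_ae (ae_restrict_of_ae hpath)).trans (le_of_eq ?_)
  rw [lintegral_add_left (hmeas2.const_mul 2), lintegral_const_mul' _ _ ENNReal.ofNat_ne_top,
    lintegral_const_mul' _ _ ENNReal.ofNat_ne_top]
  rfl
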